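/- **Conventions.** Line bundles are topological complex line bundles, and $H_*(-)=H_*(-,\mathbb Z_2)$ is singular homology. An *H-space* $(X,e,\mu)$ is a topological space $X$ with a point $e\in X$ and a continuous map $\mu\colon X\times X\to X$ such that $\mu(e,\cdot)\simeq\mathrm{id}_X\simeq\mu(\cdot,e)$ and $\mu$ is associative and commutative up to homotopy. Assume that $X$ is homotopy equivalent to a locally contractible space (for instance, that $X$ has the homotopy type of a CW complex). **Hochschild–Pontryagin cohomology.** Let $R=\bigoplus_n H_n(X)$ with the Pontryagin product $rs=\mu_*(r\times s)$, and let $\epsilon\colon R\to\mathbb Z_2$ be the projection to $H_0(X)=\bigoplus_{\pi_0(X)}\mathbb Z_2$ followed by summation. Put $C^n=\mathrm{Hom}_{\mathbb Z_2}(R^{\otimes n},\mathbb Z_2)$ and $$\mathrm df(r_0,\dots,r_n)=\epsilon(r_0)f(r_1,\dots,r_n)+\sum_{i=1}^n f(\dots,r_{i-1}r_i,\dots)+f(r_0,\dots,r_{n-1})\epsilon(r_n).$$ Let $C^{n,j}\subset C^n$ be the cochains vanishing on all $r_1\otimes\dots\otimes r_n$ with the $r_k$ homogeneous of degrees not adding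 up to $j$. Then $HP^{i,j}(X,\mathbb Z_2)$ is the $i$-th cohomology group of $(C^{*,j},\mathrm d)$. **Setup.** Let $L\to X\times X$ be a line bundle, $K=\Delta^*L$ with $\Delta$ the diagonal, and let $$\phi\colon\pi_1^*K\otimes\pi_2^*K\otimes L^{\otimes2}\to\mu^*K,\quad \chi\colon\pi_{13}^*L\otimes\pi_{23}^*L\to(\mu\times\mathrm{id})^*L,\quad \psi\colon\pi_{12}^*L\otimes\pi_{13}^*L\to(\mathrm{id}\times\mu)^*L$$ be isomorphisms, over $X\times X$, $X^3$ and $X^3$. Assume that for some homotopy $h\colon\mu\circ(\mu\times\mathrm{id})\simeq\mu\circ(\mathrm{id}\times\mu)$ there is an isomorphism over $X^3\times[0,1]$ $$\zeta\colon\pi_1^*K\otimes\pi_2^*K\otimes\pi_3^*K\otimes\pi_{12}^*L^{\otimes2}\otimes\pi_{13}^*L^{\otimes2}\otimes\pi_{23}^*L^{\otimes2}\to h^*K$$ which restricts to $(\mu\times\mathrm{id})^*\phi\circ(\pi_{12}^*\phi\otimes\mathrm{id}\otimes\chi^{\otimes2})$ over $X^3\times\{0\}$ and to $(\mathrm{id}\times\mu)^*\phi\circ(\mathrm{id}\otimes\pi_{23}^*\phi\otimes\psi^{\otimes2})$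 over $X^3\times\{1\}$. **Square roots.** A *square root* of $K$ is an isomorphism class $[J,\jmath]$ of a line bundle $J\to X$ and an isomorphism $\jmath\colon J\otimes J\to K$; an isomorphism $(J,\jmath)\to(J',\jmath')$ is a bundle isomorphism $\iota\colon J\to J'$ with $\jmath=\jmath'\circ(\iota\otimes\iota)$. It is *compatible* if there is an isomorphism $\xi\colon\pi_1^*J\otimes\pi_2^*J\otimes L\to\mu^*J$ with $\mu^*\jmath\circ(\xi\otimes\xi)=\phi\circ(\pi_1^*\jmath\otimes\pi_2^*\jmath\otimes\mathrm{id})$. Let $S^\phi_{K,L}$ be the set of compatible square roots. For a pair $(J,\jmath)$ let $Q_J\to X\times X$ be the double cover whose fibre over $(x,y)$ is the set of linear maps $\xi\colon J_x\otimes J_y\otimes L_{(x,y)}\to J_{\mu(x,y)}$ with $\jmath\circ(\xi\otimes\xi)=\phi\circ(\jmath\otimes\jmath\otimes\mathrm{id})$. For two pairs $(J_1,\jmath_1),(J_2,\jmath_2)$ let $P_{12}\to X$ be the double cover whose fibre over $x$ is the set of linear maps $\xi\colon J_2|_x\to J_1|_x$ with $\jmath_1\circ(\xi\otimes\xi)=\jmath_2$.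 The first Stiefel–Whitney class of a double cover of $Y$ is regarded as the homomorphism $w_1\colon H_1(Y)\to\mathbb Z_2$ whose value on the class of a loop is $0$ if and only if the loop lifts to a loop in the cover. **Proposition.** In this situation, assume that $K$ admits a square root. (a) There is a class $\mathrm o^\phi_{K,L}\in HP^{2,1}(X,\mathbb Z_2)$ such that for every pair $(J,\jmath)$ representing a square root of $K$, $\mathrm o^\phi_{K,L}$ is the class of the cocycle $(r,s)\mapsto w_1(Q_J)\bigl((r\times s)_1\bigr)$, where $(\;)_1$ denotes the component in $H_1(X\times X)$. Moreover, $K$ admits a compatible square root if and only if $\mathrm o^\phi_{K,L}=0$. (b) If $K$ admits a compatible square root, then $S^\phi_{K,L}$ is a torsor over the group $HP^{1,1}(X,\mathbb Z_2)$, in which the difference of $[J_1,\jmath_1]$ and $[J_2,\jmath_2]$ is the class of the cocycle $r\mapsto w_1(P_{12})(r_1)$, where $r_1\in H_1(X)$ is the degree-one component of $r$. -/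

import Mathlib

universe u v

noncomputable section

namespace HPSqrt

open CategoryTheory Topology
open scoped TensorProduct Simplicial

section HomologyPart

/-! ### Singular homology with coefficients in `ℤ/2` -/

/-- The coefficient module `ℤ/2`. -/
abbrev F2 : ModuleCat.{u} (ZMod 2) := ModuleCat.of (ZMod 2) (ULift.{u} (ZMod 2))

/-- The singular chain complex of `X` with coefficients in `ℤ/2`. -/
abbrev singChains (X : Type u) [TopologicalSpace X] : ChainComplex (ModuleCat.{u} (ZMod 2)) ℕ :=
  (TopCat.toSSet.obj (TopCat.of X)).chainComplex F2

/-- Singular homology `H_n(X, ℤ/2)`. -/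
abbrev Hlg (X : Type u) [TopologicalSpace X] (n : ℕ) : Type u :=
  ((AlgebraicTopology.singularHomologyFunctor (ModuleCat.{u} (ZMod 2)) n).obj F2).obj
    (TopCat.of X)

/-- The map induced on homology by a continuous map. -/
def Hlg.map {X Y : Type u} [TopologicalSpace X] [TopologicalSpace Y] (f : C(X, Y)) (n : ℕ) :
    Hlg X n →ₗ[ZMod 2] Hlg Y n :=
  (((AlgebraicTopology.singularHomologyFunctor (ModuleCat.{u} (ZMod 2)) n).obj F2).map
    (TopCat.ofHom f)).hom

variable {X : Type u} [TopologicalSpace X] {Y : Type u} [TopologicalSpace Y]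

/-- The module of `n`-chains of a simplicial set. -/
abbrev Chn (S : SSet.{u}) (n : ℕ) : ModuleCat.{u} (ZMod 2) := (S.chainComplex F2).X n

/-- The chain consisting of a single simplex. -/
def single {S : SSet.{u}} {n : ℕ} (s : S _⦋n⦌) : Chn S n :=
  (S.ιChainComplex (R := F2.{u}) s).hom (ULift.up 1)

/-- Linear extension of a function on simplices to chains. -/
def chainLift {S : SSet.{u}} {n : ℕ} {M : Type u} [AddCommGroup M] [Module (ZMod 2) M]
    (f : S _⦋n⦌ → M) : Chn S n →ₗ[ZMod 2] M :=
  (Limits.Cofan.IsColimit.desc (S.isColimitChainComplexXCofan F2 n)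
    (A := ModuleCat.of (ZMod 2) M) fun s ↦
      ModuleCat.ofHom ((LinearMap.toSpanSingleton (ZMod 2) M (f s)) ∘ₗ
        (ULift.moduleEquiv (R := ZMod 2) (M := ZMod 2)).toLinearMap)).hom

lemma chainLift_single {S : SSet.{u}} {n : ℕ} {M : Type u} [AddCommGroup M] [Module (ZMod 2) M]
    (f : S _⦋n⦌ → M) (s : S _⦋n⦌) : chainLift f (single s) = f s := by
  have h := Limits.Cofan.IsColimit.fac (S.isColimitChainComplexXCofan F2 n)
    (A := ModuleCat.of (ZMod 2) M) (fun s ↦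
    ModuleCat.ofHom ((LinearMap.toSpanSingleton (ZMod 2) M (f s)) ∘ₗ
      (ULift.moduleEquiv (R := ZMod 2) (M := ZMod 2)).toLinearMap)) s
  have h' := congrArg (fun g ↦ g.hom (ULift.up 1)) h
  refine Eq.trans h' ?_
  simp

lemma chain_ext {S : SSet.{u}} {n : ℕ} {M : Type u} [AddCommGroup M] [Module (ZMod 2) M]
    {f g : Chn S n →ₗ[ZMod 2] M}
    (h : ∀ s : S _⦋n⦌, f (single s) = g (single s)) : f = g := by
  have : ModuleCat.ofHom f = ModuleCat.ofHom g := by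
    apply SSet.chainComplex_hom_ext
    intro s
    ext x
    have hx : x = x.down • (ULift.up 1 : ULift.{u} (ZMod 2)) := by
      ext
      simp
    have hx' : ∀ k : Chn S n →ₗ[ZMod 2] M,
        k ((S.ιChainComplex (R := F2.{u}) s).hom x) = x.down • k (single s) := by
      intro k
      rw [hx, map_smul, map_smul]
      simp [single]
    exact (hx' f).trans ((congrArg _ (h s)).trans (hx' g).symm)
  exact congrArg ModuleCat.Hom.hom this

lemma d_single {S : SSet.{u}} {n : ℕ} (s : S _⦋n + 1⦌) :
    ((S.chainComplex (F2.{u})).d (n + 1) n).hom (single s) =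
      ∑ i : Fin (n + 2), single (S.δ i s) := by
  have h := S.ιChainComplex_d (R := F2.{u}) s
  have h' := congrArg (fun g ↦ g.hom (ULift.up 1)) h
  refine Eq.trans h' ?_
  simp only [ModuleCat.hom_sum]
  refine Eq.trans (LinearMap.sum_apply _ _ _) (Finset.sum_congr rfl fun i _ ↦ ?_)
  rcases Nat.even_or_odd i.val with hi | hi
  · simp [hi.neg_one_pow, single]
  · rw [hi.neg_one_pow, neg_smul, one_smul, ModuleCat.hom_neg, LinearMap.neg_apply]
    exact ZModModule.neg_eq_self _

/-- A strictly increasing sequence of `n + 1` elements of `{0,…,p} × {0,…,q}`. For `n = p + q` these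
are the maximal chains, i.e. the `(p, q)`-shuffles. -/
abbrev Shuffle (p q n : ℕ) : Type :=
  {c : Fin (n + 1) → Fin (p + 1) × Fin (q + 1) // StrictMono c}

noncomputable instance (p q n : ℕ) : Fintype (Shuffle p q n) :=
  Fintype.ofFinite _

lemma fin_strictMono_eq {n : ℕ} (f : Fin (n + 1) → ℕ) (hf : StrictMono f) (hn : ∀ k, f k ≤ n)
    (k : Fin (n + 1)) : f k = k := by
  let f' : Fin (n + 1) → Fin (n + 1) := fun k ↦ ⟨f k, Nat.lt_succ_of_le (hn k)⟩
  have hf' : StrictMono f' := fun a b h ↦ hf h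
  have : f' = id := by
    refine (StrictMono.range_inj hf' strictMono_id).1 ?_
    rw [(Finite.injective_iff_surjective.1 hf'.injective).range_eq, Set.range_id]
  exact congrArg Fin.val (congrFun this k)

lemma prod_lt {p q : ℕ} {x y : Fin (p + 1) × Fin (q + 1)} :
    x < y ↔ (x.1.val ≤ y.1.val ∧ x.2.val ≤ y.2.val ∧
      x.1.val + x.2.val < y.1.val + y.2.val) := by
  rw [Prod.lt_iff, Fin.lt_def, Fin.lt_def, Fin.le_def, Fin.le_def]
  omega

lemma shuffle_rank {p q n : ℕ} (h : p + q = n) (c : Shuffle p q n) (k : Fin (n + 1)) :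
    (c.1 k).1.val + (c.1 k).2.val = k := by
  refine fin_strictMono_eq (fun k ↦ (c.1 k).1.val + (c.1 k).2.val) ?_ ?_ k
  · intro a b hab
    exact (prod_lt.1 (c.2 hab)).2.2
  · intro k
    have := (c.1 k).1.isLt
    have := (c.1 k).2.isLt
    omega

lemma shuffle_mono {p q n : ℕ} (c : Shuffle p q n) {a b : Fin (n + 1)} (h : a ≤ b) :
    (c.1 a).1.val ≤ (c.1 b).1.val ∧ (c.1 a).2.val ≤ (c.1 b).2.val :=
  c.2.monotone h

/-- Deleting one element of a chain. -/
def Shuffle.del {p q n : ℕ} (c : Shuffle p q (n + 1)) (k : Fin (n + 2)) : Shuffle p q n :=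
  ⟨c.1 ∘ k.succAbove, c.2.comp (Fin.strictMono_succAbove k)⟩

/-- Exchanging the two coordinates. -/
def Shuffle.swap {p q n : ℕ} : Shuffle p q n ≃ Shuffle q p n where
  toFun c := ⟨fun k ↦ (c.1 k).swap, fun _ _ h ↦ Prod.swap_lt_swap.2 (c.2 h)⟩
  invFun c := ⟨fun k ↦ (c.1 k).swap, fun _ _ h ↦ Prod.swap_lt_swap.2 (c.2 h)⟩
  left_inv _ := rfl
  right_inv _ := rfl

lemma del_ext {p q n : ℕ} {c c' : Shuffle p q (n + 1)} {k : Fin (n + 2)}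
    (h : c.del k = c'.del k) (hk : c.1 k = c'.1 k) : c = c' := by
  apply Subtype.ext
  funext m
  by_cases hm : m = k
  · rw [hm, hk]
  · obtain ⟨l, rfl⟩ := Fin.exists_succAbove_eq hm
    exact congrFun (congrArg Subtype.val h) l

lemma del_apply {p q n : ℕ} {c c' : Shuffle p q (n + 1)} {k m : Fin (n + 2)}
    (h : c.del k = c'.del k) (hm : m ≠ k) : c.1 m = c'.1 m := by
  obtain ⟨l, rfl⟩ := Fin.exists_succAbove_eq hm
  exact congrFun (congrArg Subtype.val h) l

/-- A chain with position `k` replaced. -/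
lemma exists_replace {p q n : ℕ} (c : Shuffle p q (n + 1)) (k : Fin (n + 2))
    (z : Fin (p + 1) × Fin (q + 1)) (h₁ : ∀ m < k, c.1 m < z) (h₂ : ∀ m, k < m → z < c.1 m) :
    ∃ c' : Shuffle p q (n + 1), c'.del k = c.del k ∧ c'.1 k = z := by
  refine ⟨⟨Function.update c.1 k z, ?_⟩, ?_, by simp⟩
  · intro a b hab
    by_cases ha : a = k
    · subst ha
      rw [Function.update_self, Function.update_of_ne hab.ne']
      exact h₂ b hab
    · by_cases hb : b = k
      · subst hb
        rw [Function.update_self, Function.update_of_ne hab.ne]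
        exact h₁ a hab
      · rw [Function.update_of_ne ha, Function.update_of_ne hb]
        exact c.2 hab
  · apply Subtype.ext
    funext m
    simp [Shuffle.del, Fin.succAbove_ne]

/-- `c` takes its value at `k` in the first coordinate only at `k`. -/
def Shuffle.OnlyFst {p q n : ℕ} (c : Shuffle p q n) (k : Fin (n + 1)) : Prop :=
  ∀ m, (c.1 m).1 = (c.1 k).1 → m = k

lemma onlyFst_swap {p q n : ℕ} (c : Shuffle p q n) (k : Fin (n + 1)) :
    (Shuffle.swap c).OnlyFst k ↔ ∀ m, (c.1 m).2 = (c.1 k).2 → m = k := Iff.rfl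

/-- Description of the corners. -/
lemma corner {p q n : ℕ} (h : p + q = n + 1) (c : Shuffle p q (n + 1)) (k : Fin (n + 2))
    (h₁ : ¬ c.OnlyFst k) (h₂ : ¬ (Shuffle.swap c).OnlyFst k) :
    ∃ i j : Fin (n + 2), i.val + 1 = k.val ∧ k.val + 1 = j.val ∧
      (c.1 j).1.val = (c.1 i).1.val + 1 ∧ (c.1 j).2.val = (c.1 i).2.val + 1 := by
  rw [onlyFst_swap] at h₂
  unfold Shuffle.OnlyFst at h₁
  push Not at h₁ h₂
  obtain ⟨m, hm, hmk⟩ := h₁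
  obtain ⟨l, hl, hlk⟩ := h₂
  have hk := k.isLt
  have hr := shuffle_rank h c
  have rm := hr m
  have rl := hr l
  have rk := hr k
  rw [Fin.ext_iff] at hm hl
  have hmk' : m.val ≠ k.val := fun h ↦ hmk (Fin.ext h)
  have hlk' : l.val ≠ k.val := fun h ↦ hlk (Fin.ext h)
  have hml : (m < k ∧ k < l) ∨ (l < k ∧ k < m) := by
    rcases lt_or_gt_of_ne hmk with h1 | h1 <;> rcases lt_or_gt_of_ne hlk with h2 | h2
    · exfalso
      rcases le_total m l with h3 | h3
      · have := shuffle_mono c h3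
        have := shuffle_mono c h2.le
        rw [Fin.lt_def] at h1 h2
        omega
      · have := shuffle_mono c h3
        have := shuffle_mono c h1.le
        rw [Fin.lt_def] at h1 h2
        omega
    · exact Or.inl ⟨h1, h2⟩
    · exact Or.inr ⟨h2, h1⟩
    · exfalso
      rcases le_total m l with h3 | h3
      · have := shuffle_mono c h3
        have := shuffle_mono c h1.le
        rw [Fin.lt_def] at h1 h2
        omega
      · have := shuffle_mono c h3
        have := shuffle_mono c h2.le
        rw [Fin.lt_def] at h1 h2
        omega
  have key : ∀ s t : Fin (n + 2), s < k → k < t →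
      ((c.1 s).1.val = (c.1 k).1.val ∧ (c.1 t).2.val = (c.1 k).2.val) ∨
      ((c.1 s).2.val = (c.1 k).2.val ∧ (c.1 t).1.val = (c.1 k).1.val) →
      ∃ i j : Fin (n + 2), i.val + 1 = k.val ∧ k.val + 1 = j.val ∧
      (c.1 j).1.val = (c.1 i).1.val + 1 ∧ (c.1 j).2.val = (c.1 i).2.val + 1 := by
    intro s t hs ht hst
    have ht' := t.isLt
    rw [Fin.lt_def] at hs ht
    let i : Fin (n + 2) := ⟨k.val - 1, by omega⟩
    let j : Fin (n + 2) := ⟨k.val + 1, by omega⟩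
    have hi : i.val = k.val - 1 := rfl
    have hj : j.val = k.val + 1 := rfl
    have si := shuffle_mono c (show s ≤ i by rw [Fin.le_def]; omega)
    have ik := shuffle_mono c (show i ≤ k by rw [Fin.le_def]; omega)
    have kj := shuffle_mono c (show k ≤ j by rw [Fin.le_def]; omega)
    have jt := shuffle_mono c (show j ≤ t by rw [Fin.le_def]; omega)
    have ri := hr i
    have rj := hr j
    exact ⟨i, j, by omega, by omega, by omega, by omega⟩
  rcases hml with ⟨h1, h2⟩ | ⟨h1, h2⟩
  · exact key m l h1 h2 (Or.inl ⟨hm, hl⟩)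
  · exact key l m h1 h2 (Or.inr ⟨hl, hm⟩)

lemma exists_flip {p q n : ℕ} (h : p + q = n + 1) (c : Shuffle p q (n + 1)) (k : Fin (n + 2))
    (h₁ : ¬ c.OnlyFst k) (h₂ : ¬ (Shuffle.swap c).OnlyFst k) :
    ∃ c' : Shuffle p q (n + 1), c'.del k = c.del k ∧ c' ≠ c ∧ ¬ c'.OnlyFst k ∧
      ¬ (Shuffle.swap c').OnlyFst k ∧ ∀ c'', c''.del k = c.del k → c'' = c ∨ c'' = c' := by
  obtain ⟨i, j, hi, hj, h3, h4⟩ := corner h c k h₁ h₂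
  have hr := shuffle_rank h c
  have ri := hr i
  have rj := hr j
  have rk := hr k
  have bj := (c.1 j).1.isLt
  have bj' := (c.1 j).2.isLt
  have ik := shuffle_mono c (show i ≤ k by rw [Fin.le_def]; omega)
  have kj := shuffle_mono c (show k ≤ j by rw [Fin.le_def]; omega)
  let z : Fin (p + 1) × Fin (q + 1) :=
    (⟨(c.1 i).1.val + (c.1 j).1.val - (c.1 k).1.val, by omega⟩,
      ⟨(c.1 i).2.val + (c.1 j).2.val - (c.1 k).2.val, by omega⟩)
  have hz1 : z.1.val = (c.1 i).1.val + (c.1 j).1.val - (c.1 k).1.val := rfl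
  have hz2 : z.2.val = (c.1 i).2.val + (c.1 j).2.val - (c.1 k).2.val := rfl
  obtain ⟨c', hc', hck⟩ := exists_replace c k z
    (fun m hm ↦ by
      have := shuffle_mono c (show m ≤ i by rw [Fin.lt_def] at hm; rw [Fin.le_def]; omega)
      have := hr m
      rw [prod_lt]
      rw [Fin.lt_def] at hm
      omega)
    (fun m hm ↦ by
      have := shuffle_mono c (show j ≤ m by rw [Fin.lt_def] at hm; rw [Fin.le_def]; omega)
      have := hr m
      rw [prod_lt]
      rw [Fin.lt_def] at hm
      omega)
  have hik : i ≠ k := fun h ↦ by rw [h] at hi; omega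
  have hjk : j ≠ k := fun h ↦ by rw [h] at hj; omega
  have ci := del_apply hc' hik
  have cj := del_apply hc' hjk
  have ne : c' ≠ c := by
    rintro rfl
    have : (c'.1 k).1.val = z.1.val := by rw [hck]
    omega
  have hsame : ((c'.1 i).1 = (c'.1 k).1 ∧ (c'.1 j).2 = (c'.1 k).2) ∨
      ((c'.1 j).1 = (c'.1 k).1 ∧ (c'.1 i).2 = (c'.1 k).2) := by
    rw [ci, cj, hck, Fin.ext_iff, Fin.ext_iff, Fin.ext_iff, Fin.ext_iff]
    omega
  refine ⟨c', hc', ne, ?_, ?_, ?_⟩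
  · intro ho
    rcases hsame with hs | hs
    · exact hik (ho i hs.1)
    · exact hjk (ho j hs.1)
  · intro ho
    rw [onlyFst_swap] at ho
    rcases hsame with hs | hs
    · exact hjk (ho j hs.2)
    · exact hik (ho i hs.2)
  · intro c'' hc''
    have r'' := shuffle_rank h c'' k
    have ik'' := shuffle_mono c'' (show i ≤ k by rw [Fin.le_def]; omega)
    have kj'' := shuffle_mono c'' (show k ≤ j by rw [Fin.le_def]; omega)
    rw [del_apply hc'' hik] at ik''
    rw [del_apply hc'' hjk] at kj''
    have : (c''.1 k).1.val = (c.1 k).1.val ∧ (c''.1 k).2.val = (c.1 k).2.val ∨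
        (c''.1 k).1.val = z.1.val ∧ (c''.1 k).2.val = z.2.val := by
      omega
    rcases this with ⟨ha, hb⟩ | ⟨ha, hb⟩
    · exact Or.inl (del_ext hc'' (Prod.ext (Fin.ext ha) (Fin.ext hb)))
    · refine Or.inr (del_ext (hc''.trans hc'.symm) ?_)
      rw [hck]
      exact Prod.ext (Fin.ext ha) (Fin.ext hb)

section Sum

variable {M : Type*} [AddCommGroup M] [Module (ZMod 2) M]

open Classical in
/-- The corners contribute zero modulo `2`. -/
lemma sum_corner {p q n : ℕ} (h : p + q = n + 1) (g : Shuffle p q n → M) :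
    ∑ x : Shuffle p q (n + 1) × Fin (n + 2) with
      (¬ x.1.OnlyFst x.2 ∧ ¬ (Shuffle.swap x.1).OnlyFst x.2), g (x.1.del x.2) = 0 := by
  rcases isEmpty_or_nonempty (Shuffle p q (n + 1)) with hE | hE
  · exact Finset.sum_eq_zero fun x _ ↦ hE.elim x.1
  choose! F hF using fun (x : Shuffle p q (n + 1) × Fin (n + 2))
    (hx : ¬ x.1.OnlyFst x.2 ∧ ¬ (Shuffle.swap x.1).OnlyFst x.2) ↦
      exists_flip h x.1 x.2 hx.1 hx.2
  refine Finset.sum_involution (fun x _ ↦ (F x, x.2)) ?_ ?_ ?_ ?_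
  · intro x hx
    rw [Finset.mem_filter] at hx
    dsimp only
    rw [(hF x hx.2).1]
    exact ZModModule.add_self _
  · intro x hx _ he
    rw [Finset.mem_filter] at hx
    exact (hF x hx.2).2.1 (congrArg Prod.fst he)
  · intro x hx
    rw [Finset.mem_filter] at hx ⊢
    exact ⟨Finset.mem_univ _, (hF x hx.2).2.2.1, (hF x hx.2).2.2.2.1⟩
  · intro x hx
    rw [Finset.mem_filter] at hx
    obtain ⟨h1, h2, h3, h4, h5⟩ := hF x hx.2
    obtain ⟨k1, k2, k3, k4, k5⟩ := hF (F x, x.2) ⟨h3, h4⟩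
    refine Prod.ext ?_ rfl
    dsimp only at k1 k2 ⊢
    rcases h5 _ (k1.trans h1) with h6 | h6
    · exact h6
    · exact absurd h6 k2

end Sum

lemma del_lt {p q n : ℕ} (c : Shuffle p q (n + 1)) (k : Fin (n + 2)) (l : Fin (n + 1))
    (h : l.val < k.val) : (c.del k).1 l = c.1 l.castSucc := by
  change c.1 (k.succAbove l) = _
  rw [Fin.succAbove_of_castSucc_lt k l (by rw [Fin.lt_def]; exact h)]

lemma del_ge {p q n : ℕ} (c : Shuffle p q (n + 1)) (k : Fin (n + 2)) (l : Fin (n + 1))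
    (h : k.val ≤ l.val) : (c.del k).1 l = c.1 l.succ := by
  change c.1 (k.succAbove l) = _
  rw [Fin.succAbove_of_le_castSucc k l (by rw [Fin.le_def]; exact h)]

lemma insert_unique_aux {p q n : ℕ} (c c' : Shuffle p q (n + 1))
    (k k' : Fin (n + 2)) (ho' : c'.OnlyFst k') (hd : c.del k = c'.del k')
    (hk : (c.1 k).1 = (c'.1 k').1) : ¬ k < k' := by
  intro hlt
  rw [Fin.lt_def] at hlt
  have hk' := k'.isLt
  let l : Fin (n + 1) := ⟨k.val, by omega⟩
  have e1 := del_ge c k l (le_refl _)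
  have e2 := del_lt c' k' l hlt
  rw [hd, e2] at e1
  have m1 := shuffle_mono c (show k ≤ l.succ by rw [Fin.le_def]; simp [l])
  have m2 := shuffle_mono c' (show l.castSucc ≤ k' by
    rw [Fin.le_def]; simp only [l, Fin.castSucc_mk]; omega)
  rw [← e1] at m1
  have : (c'.1 l.castSucc).1 = (c'.1 k').1 := by
    rw [Fin.ext_iff]
    rw [Fin.ext_iff] at hk
    omega
  have := congrArg Fin.val (ho' _ this)
  simp only [l, Fin.castSucc_mk] at this
  omega

lemma insert_unique {p q n : ℕ} (h : p + q = n + 1) (c c' : Shuffle p q (n + 1))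
    (k k' : Fin (n + 2)) (ho : c.OnlyFst k) (ho' : c'.OnlyFst k') (hd : c.del k = c'.del k')
    (hk : (c.1 k).1 = (c'.1 k').1) : c = c' ∧ k = k' := by
  have hkk : k = k' := le_antisymm
    (not_lt.1 (insert_unique_aux c' c k' k ho hd.symm hk.symm))
    (not_lt.1 (insert_unique_aux c c' k k' ho' hd hk))
  subst hkk
  refine ⟨del_ext hd (Prod.ext hk (Fin.ext ?_)), rfl⟩
  have r1 := shuffle_rank h c k
  have r2 := shuffle_rank h c' k
  rw [hk] at r1
  omega

/-- The rank of an element of a chain that avoids a value of the first coordinate. -/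
lemma avoid_rank {p q n : ℕ} (h : p + q = n + 1) (e : Shuffle p q n) (i : Fin (p + 1))
    (hi : ∀ m, (e.1 m).1 ≠ i) (m : Fin (n + 1)) :
    ((e.1 m).1.val < i.val ∧ (e.1 m).1.val + (e.1 m).2.val = m) ∨
    (i.val < (e.1 m).1.val ∧ (e.1 m).1.val + (e.1 m).2.val = m + 1) := by
  have hne : ∀ m, (e.1 m).1.val ≠ i.val := fun m hm ↦ hi m (Fin.ext hm)
  have hil := i.isLt
  have := fin_strictMono_eq
    (fun m ↦ (if (e.1 m).1.val < i.val then (e.1 m).1.val else (e.1 m).1.val - 1) + (e.1 m).2.val)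
    (by
      intro a b hab
      have h1 := prod_lt.1 (e.2 hab)
      have := hne a
      have := hne b
      dsimp only
      split_ifs <;> omega)
    (by
      intro k
      have := (e.1 k).1.isLt
      have := (e.1 k).2.isLt
      have := hne k
      split_ifs <;> omega) m
  have hm := hne m
  split_ifs at this <;> omega

/-- Chains that miss the value `i` in the first coordinate can be extended. -/
lemma exists_insert {p q n : ℕ} (h : p + q = n + 1) (e : Shuffle p q n) (i : Fin (p + 1))
    (hi : ∀ m, (e.1 m).1 ≠ i) :
    ∃ (c : Shuffle p q (n + 1)) (k : Fin (n + 2)), c.del k = e ∧ (c.1 k).1 = i ∧ c.OnlyFst k := by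
  have hr := avoid_rank h e i hi
  have hil := i.isLt
  -- the position
  obtain ⟨k, hk1, hk2⟩ : ∃ k : Fin (n + 2), (∀ m : Fin (n + 1), m.val < k.val →
      (e.1 m).1.val < i.val) ∧ (∀ m : Fin (n + 1), k.val ≤ m.val → i.val < (e.1 m).1.val) := by
    by_cases hE : ∃ m : Fin (n + 1), i.val < (e.1 m).1.val
    · have hw := WellFounded.min_mem (wellFounded_lt (α := Fin (n + 1)))
        {m | i.val < (e.1 m).1.val} hE
      set m₀ := WellFounded.min (wellFounded_lt (α := Fin (n + 1)))
        {m | i.val < (e.1 m).1.val} hE with hm₀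
      refine ⟨m₀.castSucc, fun m hm ↦ ?_, fun m hm ↦ ?_⟩
      · by_contra hc
        have : i.val < (e.1 m).1.val := by
          have := hr m
          omega
        exact WellFounded.not_lt_min wellFounded_lt {m | i.val < (e.1 m).1.val} this
          (Fin.lt_def.2 hm)
      · have := shuffle_mono e (show m₀ ≤ m from hm)
        have hw' : i.val < (e.1 m₀).1.val := hw
        omega
    · push Not at hE
      refine ⟨Fin.last _, fun m _ ↦ ?_, fun m hm ↦ ?_⟩
      · have := hE m
        have := hr m
        omega
      · have := m.isLt
        simp at hm
        omega
  have hkl := k.isLt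
  -- the height of the new element
  have hb : i.val ≤ k.val ∧ k.val - i.val ≤ q ∧
      (∀ m : Fin (n + 1), m.val < k.val → (e.1 m).2.val ≤ k.val - i.val) ∧
      (∀ m : Fin (n + 1), k.val ≤ m.val → k.val - i.val ≤ (e.1 m).2.val) := by
    have lo : ∀ (hk : 0 < k.val), ∃ s : Fin (n + 1), s.val + 1 = k.val :=
      fun hk ↦ ⟨⟨k.val - 1, by omega⟩, by simp; omega⟩
    have hi' : ∀ (hk : k.val < n + 1), ∃ t : Fin (n + 1), t.val = k.val :=
      fun hk ↦ ⟨⟨k.val, hk⟩, rfl⟩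
    by_cases h0 : 0 < k.val
    · obtain ⟨s, hs⟩ := lo h0
      have s1 := hk1 s (by omega)
      have s2 := hr s
      have sb := (e.1 s).2.isLt
      by_cases h1 : k.val < n + 1
      · obtain ⟨t, ht⟩ := hi' h1
        have t1 := hk2 t (by omega)
        have t2 := hr t
        have tb := (e.1 t).2.isLt
        have st := shuffle_mono e (show s ≤ t by rw [Fin.le_def]; omega)
        refine ⟨by omega, by omega, fun m hm ↦ ?_, fun m hm ↦ ?_⟩
        · have := shuffle_mono e (show m ≤ s by rw [Fin.le_def]; omega)
          omega
        · have := shuffle_mono e (show t ≤ m by rw [Fin.le_def]; omega)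
          omega
      · refine ⟨by omega, by omega, fun m hm ↦ ?_, fun m hm ↦ ?_⟩
        · have := shuffle_mono e (show m ≤ s by rw [Fin.le_def]; omega)
          omega
        · have := m.isLt
          omega
    · obtain ⟨t, ht⟩ := hi' (by omega)
      have t1 := hk2 t (by omega)
      have t2 := hr t
      exact ⟨by omega, by omega, fun m hm ↦ by omega, fun m hm ↦ by omega⟩
  obtain ⟨b1, b2, b3, b4⟩ := hb
  let z : Fin (p + 1) × Fin (q + 1) := (i, ⟨k.val - i.val, by omega⟩)
  have z1 : z.1.val = i.val := rfl
  have z2 : z.2.val = k.val - i.val := rfl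
  have hdel : ∀ m : Fin (n + 1), (k.insertNth (α := fun _ ↦ Fin (p + 1) × Fin (q + 1)) z e.1)
      (k.succAbove m) = e.1 m := fun m ↦ Fin.insertNth_apply_succAbove ..
  have hself : (k.insertNth (α := fun _ ↦ Fin (p + 1) × Fin (q + 1)) z e.1) k = z :=
    Fin.insertNth_apply_same ..
  refine ⟨⟨k.insertNth (α := fun _ ↦ Fin (p + 1) × Fin (q + 1)) z e.1, ?_⟩, k, ?_, ?_, ?_⟩
  · intro a b hab
    rcases Fin.eq_self_or_eq_succAbove k a with rfl | ⟨m, rfl⟩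
    · rcases Fin.eq_self_or_eq_succAbove a b with rfl | ⟨l, rfl⟩
      · exact absurd hab (lt_irrefl _)
      · rw [hself, hdel, prod_lt]
        have hl : a.val ≤ l.val := by
          by_contra hc
          rw [Fin.succAbove_of_castSucc_lt a l (by rw [Fin.lt_def]; simp; omega), Fin.lt_def] at hab
          simp at hab
          omega
        have := hk2 l hl
        have := b4 l hl
        omega
    · rcases Fin.eq_self_or_eq_succAbove k b with rfl | ⟨l, rfl⟩
      · rw [hself, hdel, prod_lt]
        have hl : m.val < b.val := by
          by_contra hc
          rw [Fin.succAbove_of_le_castSucc b m (by rw [Fin.le_def]; simp; omega), Fin.lt_def] at hab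
          simp at hab
          omega
        have := hk1 m hl
        have := b3 m hl
        omega
      · rw [hdel, hdel]
        exact e.2 ((Fin.strictMono_succAbove k).lt_iff_lt.1 hab)
  · exact Subtype.ext (funext hdel)
  · change (k.insertNth (α := fun _ ↦ Fin (p + 1) × Fin (q + 1)) z e.1 k).1 = i
    rw [hself]
  · intro m hm
    rcases Fin.eq_self_or_eq_succAbove k m with rfl | ⟨l, rfl⟩
    · rfl
    · exfalso
      change (k.insertNth (α := fun _ ↦ Fin (p + 1) × Fin (q + 1)) z e.1 (k.succAbove l)).1 =
        (k.insertNth (α := fun _ ↦ Fin (p + 1) × Fin (q + 1)) z e.1 k).1 at hm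
      rw [hdel, hself] at hm
      exact hi l hm

section Sum'

variable {M : Type*} [AddCommGroup M] [Module (ZMod 2) M]

open Classical in
lemma sum_onlyFst {M : Type*} [AddCommGroup M] {p q n : ℕ} (h : p + q = n + 1) (g : Shuffle p q n → M) :
    ∑ x : Shuffle p q (n + 1) × Fin (n + 2) with x.1.OnlyFst x.2, g (x.1.del x.2) =
      ∑ i : Fin (p + 1), ∑ e : Shuffle p q n with (∀ m, (e.1 m).1 ≠ i), g e := by
  rw [Finset.sum_sigma']
  refine Finset.sum_bij (fun x _ ↦ ⟨(x.1.1 x.2).1, x.1.del x.2⟩) ?_ ?_ ?_ ?_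
  · rintro ⟨c, k⟩ hx
    rw [Finset.mem_filter] at hx
    rw [Finset.mem_sigma, Finset.mem_filter]
    exact ⟨Finset.mem_univ _, Finset.mem_univ _, fun m hm ↦ Fin.succAbove_ne k m (hx.2 _ hm)⟩
  · rintro ⟨c, k⟩ hx ⟨c', k'⟩ hx' he
    rw [Finset.mem_filter] at hx hx'
    have h1 := congrArg Sigma.fst he
    have h2 : c.del k = c'.del k' := eq_of_heq (Sigma.mk.inj he).2
    obtain ⟨h3, h4⟩ := insert_unique h c c' k k' hx.2 hx'.2 h2 h1
    exact Prod.ext h3 h4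
  · rintro ⟨i, e⟩ hx
    rw [Finset.mem_sigma, Finset.mem_filter] at hx
    obtain ⟨c, k, h1, h2, h3⟩ := exists_insert h e i hx.2.2
    refine ⟨(c, k), by rw [Finset.mem_filter]; exact ⟨Finset.mem_univ _, h3⟩, ?_⟩
    dsimp only
    rw [h1, h2]
  · intro x _
    rfl

open Classical in
lemma sum_onlySnd {M : Type*} [AddCommGroup M] {p q n : ℕ} (h : p + q = n + 1) (g : Shuffle p q n → M) :
    ∑ x : Shuffle p q (n + 1) × Fin (n + 2) with (Shuffle.swap x.1).OnlyFst x.2, g (x.1.del x.2) =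
      ∑ i : Fin (q + 1), ∑ e : Shuffle p q n with (∀ m, (e.1 m).2 ≠ i), g e := by
  have := sum_onlyFst (show q + p = n + 1 by omega) (fun e ↦ g (Shuffle.swap e))
  refine Eq.trans ?_ (this.trans ?_)
  · refine Finset.sum_equiv (Shuffle.swap.prodCongr (Equiv.refl _)) ?_ ?_
    · intro x
      simp
    · intro x _
      rfl
  · refine Finset.sum_congr rfl fun i _ ↦ Finset.sum_equiv Shuffle.swap ?_ ?_
    · intro x
      simp only [Finset.mem_filter, Finset.mem_univ, true_and]
      rfl
    · intro x _
      rfl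

open Classical in
lemma sum_del {p q n : ℕ} (h : p + q = n + 1) (g : Shuffle p q n → M) :
    ∑ c : Shuffle p q (n + 1), ∑ k : Fin (n + 2), g (c.del k) =
      (∑ i : Fin (p + 1), ∑ e : Shuffle p q n with (∀ m, (e.1 m).1 ≠ i), g e) +
      ∑ i : Fin (q + 1), ∑ e : Shuffle p q n with (∀ m, (e.1 m).2 ≠ i), g e := by
  rw [← sum_onlyFst h, ← sum_onlySnd h, ← Fintype.sum_prod_type',
    ← Finset.sum_filter_add_sum_filter_not Finset.univ
      (fun x : Shuffle p q (n + 1) × Fin (n + 2) ↦ x.1.OnlyFst x.2)]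
  congr 1
  rw [← Finset.sum_filter_add_sum_filter_not _
    (fun x : Shuffle p q (n + 1) × Fin (n + 2) ↦ (Shuffle.swap x.1).OnlyFst x.2),
    Finset.filter_filter, Finset.filter_filter, sum_corner h, add_zero]
  refine Finset.sum_congr (Finset.filter_congr fun x _ ↦ ?_) fun _ _ ↦ rfl
  refine ⟨fun h ↦ h.2, fun h2 ↦ ⟨fun h1 ↦ ?_, h2⟩⟩
  -- an element cannot be alone in both coordinates
  obtain ⟨c, k⟩ := x
  rw [onlyFst_swap] at h2
  have hr := shuffle_rank h c
  have rk := hr k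
  have hkl := k.isLt
  by_cases hk : 0 < k.val
  · let s : Fin (n + 2) := ⟨k.val - 1, by omega⟩
    have hs : s.val = k.val - 1 := rfl
    have hsk : s ≠ k := fun hh ↦ by rw [Fin.ext_iff] at hh; omega
    have m1 := shuffle_mono c (show s ≤ k by rw [Fin.le_def]; omega)
    have rs := hr s
    have n1 : (c.1 s).1.val ≠ (c.1 k).1.val := fun hh ↦ hsk (h1 s (Fin.ext hh))
    have n2 : (c.1 s).2.val ≠ (c.1 k).2.val := fun hh ↦ hsk (h2 s (Fin.ext hh))
    omega
  · let s : Fin (n + 2) := ⟨k.val + 1, by omega⟩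
    have hs : s.val = k.val + 1 := rfl
    have hsk : s ≠ k := fun hh ↦ by rw [Fin.ext_iff] at hh; omega
    have m1 := shuffle_mono c (show k ≤ s by rw [Fin.le_def]; omega)
    have rs := hr s
    have n1 : (c.1 s).1.val ≠ (c.1 k).1.val := fun hh ↦ hsk (h1 s (Fin.ext hh))
    have n2 : (c.1 s).2.val ≠ (c.1 k).2.val := fun hh ↦ hsk (h2 s (Fin.ext hh))
    omega

end Sum'

/-- The chain obtained by shifting the first coordinate past the value `i`. -/
def Shuffle.faceFst {p q n : ℕ} (i : Fin (p + 2)) (e : Shuffle p q n) : Shuffle (p + 1) q n :=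
  ⟨fun m ↦ (i.succAbove (e.1 m).1, (e.1 m).2), fun a b h ↦ by
    have := e.2 h
    rw [Prod.lt_iff] at this ⊢
    rcases this with ⟨h1, h2⟩ | ⟨h1, h2⟩
    · exact Or.inl ⟨Fin.strictMono_succAbove i h1, h2⟩
    · exact Or.inr ⟨(Fin.strictMono_succAbove i).monotone h1, h2⟩⟩

/-- The chain obtained by shifting the second coordinate past the value `i`. -/
def Shuffle.faceSnd {p q n : ℕ} (i : Fin (q + 2)) (e : Shuffle p q n) : Shuffle p (q + 1) n :=
  Shuffle.swap (Shuffle.faceFst i (Shuffle.swap e))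

open Classical in
lemma sum_avoidFst {M : Type*} [AddCommGroup M] {p q n : ℕ} (i : Fin (p + 2))
    (g : Shuffle (p + 1) q n → M) :
    ∑ e : Shuffle (p + 1) q n with (∀ m, (e.1 m).1 ≠ i), g e =
      ∑ e : Shuffle p q n, g (e.faceFst i) := by
  symm
  refine Finset.sum_bij (fun e _ ↦ e.faceFst i) ?_ ?_ ?_ (fun _ _ ↦ rfl)
  · intro e _
    rw [Finset.mem_filter]
    exact ⟨Finset.mem_univ _, fun m ↦ Fin.succAbove_ne i _⟩
  · intro e _ e' _ h
    apply Subtype.ext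
    funext m
    have := congrFun (congrArg Subtype.val h) m
    have h1 : ((e.faceFst i).1 m).1 = ((e'.faceFst i).1 m).1 := by rw [this]
    have h2 : ((e.faceFst i).1 m).2 = ((e'.faceFst i).1 m).2 := by rw [this]
    exact Prod.ext (Fin.succAbove_right_injective h1) h2
  · intro e he
    rw [Finset.mem_filter] at he
    have : ∀ m, ∃ l, i.succAbove l = (e.1 m).1 := fun m ↦ Fin.exists_succAbove_eq (he.2 m)
    choose l hl using this
    refine ⟨⟨fun m ↦ (l m, (e.1 m).2), fun a b h ↦ ?_⟩, Finset.mem_univ _, ?_⟩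
    · have := e.2 h
      rw [Prod.lt_iff, ← hl, ← hl] at this
      rw [Prod.lt_iff]
      rcases this with ⟨h1, h2⟩ | ⟨h1, h2⟩
      · exact Or.inl ⟨(Fin.strictMono_succAbove i).lt_iff_lt.1 h1, h2⟩
      · exact Or.inr ⟨(Fin.strictMono_succAbove i).le_iff_le.1 h1, h2⟩
    · exact Subtype.ext (funext fun m ↦ Prod.ext (hl m) rfl)

open Classical in
lemma sum_avoidSnd {M : Type*} [AddCommGroup M] {p q n : ℕ} (i : Fin (q + 2))
    (g : Shuffle p (q + 1) n → M) :
    ∑ e : Shuffle p (q + 1) n with (∀ m, (e.1 m).2 ≠ i), g e =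
      ∑ e : Shuffle p q n, g (e.faceSnd i) := by
  have := sum_avoidFst i (fun e : Shuffle (q + 1) p n ↦ g (Shuffle.swap e))
  refine Eq.trans ?_ (this.trans ?_)
  · refine Finset.sum_equiv Shuffle.swap ?_ ?_
    · intro x
      simp only [Finset.mem_filter, Finset.mem_univ, true_and]
      rfl
    · intro x _
      rfl
  · refine Finset.sum_equiv Shuffle.swap (by simp) ?_
    intro x _
    rfl

open Classical in
lemma sum_avoidFst_zero {M : Type*} [AddCommGroup M] {q n : ℕ} (i : Fin 1)
    (g : Shuffle 0 q n → M) : ∑ e : Shuffle 0 q n with (∀ m, (e.1 m).1 ≠ i), g e = 0 := by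
  refine Finset.sum_eq_zero fun e he ↦ ?_
  rw [Finset.mem_filter] at he
  exact absurd (Subsingleton.elim _ _) (he.2 0)

open Classical in
lemma sum_avoidSnd_zero {M : Type*} [AddCommGroup M] {p n : ℕ} (i : Fin 1)
    (g : Shuffle p 0 n → M) : ∑ e : Shuffle p 0 n with (∀ m, (e.1 m).2 ≠ i), g e = 0 := by
  refine Finset.sum_eq_zero fun e he ↦ ?_
  rw [Finset.mem_filter] at he
  exact absurd (Subsingleton.elim _ _) (he.2 0)


/-! ### The cross product -/

/-- The first coordinate of a chain, as a map `⦋n⦌ ⟶ ⦋p⦌`. -/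
def Shuffle.fst {p q n : ℕ} (c : Shuffle p q n) : ⦋n⦌ ⟶ ⦋p⦌ :=
  SimplexCategory.Hom.mk ⟨fun m ↦ (c.1 m).1, fun _ _ h ↦ (c.2.monotone h).1⟩

/-- The second coordinate of a chain, as a map `⦋n⦌ ⟶ ⦋q⦌`. -/
def Shuffle.snd {p q n : ℕ} (c : Shuffle p q n) : ⦋n⦌ ⟶ ⦋q⦌ :=
  SimplexCategory.Hom.mk ⟨fun m ↦ (c.1 m).2, fun _ _ h ↦ (c.2.monotone h).2⟩

lemma fst_del {p q n : ℕ} (c : Shuffle p q (n + 1)) (k : Fin (n + 2)) :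
    (c.del k).fst = SimplexCategory.δ k ≫ c.fst := rfl

lemma snd_del {p q n : ℕ} (c : Shuffle p q (n + 1)) (k : Fin (n + 2)) :
    (c.del k).snd = SimplexCategory.δ k ≫ c.snd := rfl

lemma fst_faceFst {p q n : ℕ} (c : Shuffle p q n) (i : Fin (p + 2)) :
    (c.faceFst i).fst = c.fst ≫ SimplexCategory.δ i := rfl

lemma snd_faceSnd {p q n : ℕ} (c : Shuffle p q n) (i : Fin (q + 2)) :
    (c.faceSnd i).snd = c.snd ≫ SimplexCategory.δ i := rfl

/-- The singular simplex `(σ, τ)` of `X × Y` with components `σ` and `τ`. -/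
def pairSimplex {X Y : Type u} [TopologicalSpace X] [TopologicalSpace Y] {n : SimplexCategoryᵒᵖ}
    (σ : (TopCat.toSSet.obj (TopCat.of X)).obj n) (τ : (TopCat.toSSet.obj (TopCat.of Y)).obj n) :
    (TopCat.toSSet.obj (TopCat.of (X × Y))).obj n :=
  (TopCat.toSSetObjEquiv _ n).symm
    ((TopCat.toSSetObjEquiv _ n σ).prodMk (TopCat.toSSetObjEquiv _ n τ))

lemma pairSimplex_map {X Y : Type u} [TopologicalSpace X] [TopologicalSpace Y]
    {m n : SimplexCategoryᵒᵖ} (f : m ⟶ n)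
    (σ : (TopCat.toSSet.obj (TopCat.of X)).obj m) (τ : (TopCat.toSSet.obj (TopCat.of Y)).obj m) :
    (TopCat.toSSet.obj (TopCat.of (X × Y))).map f (pairSimplex σ τ) =
      pairSimplex ((TopCat.toSSet.obj (TopCat.of X)).map f σ)
        ((TopCat.toSSet.obj (TopCat.of Y)).map f τ) := by
  rfl

/-- The product `σ × τ` of singular simplices: the sum over the `(p, q)`-shuffles (for `n = p + q`)
of the corresponding simplices of `X × Y`. Signs play no role with coefficients in `ℤ/2`. -/
def crossSimplex {X Y : Type u} [TopologicalSpace X] [TopologicalSpace Y] (p q n : ℕ)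
    (σ : TopCat.toSSet.obj (TopCat.of X) _⦋p⦌) (τ : TopCat.toSSet.obj (TopCat.of Y) _⦋q⦌) :
    Chn (TopCat.toSSet.obj (TopCat.of (X × Y))) n :=
  ∑ c : Shuffle p q n, single (pairSimplex ((TopCat.toSSet.obj (TopCat.of X)).map c.fst.op σ)
    ((TopCat.toSSet.obj (TopCat.of Y)).map c.snd.op τ))

/-- The product of singular chains. -/
def crossChain {X Y : Type u} [TopologicalSpace X] [TopologicalSpace Y] (p q n : ℕ) :
    (singChains X).X p →ₗ[ZMod 2] (singChains Y).X q →ₗ[ZMod 2] (singChains (X × Y)).X n :=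
  chainLift fun σ ↦ chainLift fun τ ↦ crossSimplex p q n σ τ

lemma crossChain_single {X Y : Type u} [TopologicalSpace X] [TopologicalSpace Y] (p q n : ℕ)
    (σ : TopCat.toSSet.obj (TopCat.of X) _⦋p⦌) (τ : TopCat.toSSet.obj (TopCat.of Y) _⦋q⦌) :
    crossChain p q n (single σ) (single τ) = crossSimplex p q n σ τ := by
  unfold crossChain
  rw [chainLift_single, chainLift_single]

lemma d_crossSimplex {X Y : Type u} [TopologicalSpace X] [TopologicalSpace Y] {p q n : ℕ}
    (h : p + q = n + 1)
    (σ : TopCat.toSSet.obj (TopCat.of X) _⦋p⦌) (τ : TopCat.toSSet.obj (TopCat.of Y) _⦋q⦌) :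
    ((singChains (X × Y)).d (n + 1) n).hom (crossSimplex p q (n + 1) σ τ) =
      crossChain (p - 1) q n (((singChains X).d p (p - 1)).hom (single σ)) (single τ) +
      crossChain p (q - 1) n (single σ) (((singChains Y).d q (q - 1)).hom (single τ)) := by
  let g : Shuffle p q n → Chn (TopCat.toSSet.obj (TopCat.of (X × Y))) n := fun c ↦
    single (pairSimplex ((TopCat.toSSet.obj (TopCat.of X)).map c.fst.op σ)
      ((TopCat.toSSet.obj (TopCat.of Y)).map c.snd.op τ))
  have h1 : ((singChains (X × Y)).d (n + 1) n).hom (crossSimplex p q (n + 1) σ τ) =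
      ∑ c : Shuffle p q (n + 1), ∑ k : Fin (n + 2), g (c.del k) := by
    unfold crossSimplex
    rw [map_sum]
    refine Finset.sum_congr rfl fun c _ ↦ ?_
    rw [d_single]
    refine Finset.sum_congr rfl fun k _ ↦ ?_
    congr 1
    refine (pairSimplex_map _ _ _).trans ?_
    rw [fst_del, snd_del, op_comp, op_comp, Functor.map_comp, Functor.map_comp]
    rfl
  rw [h1, sum_del h]
  congr 1
  · rcases p with _ | p
    · rw [(singChains X).shape 0 (0 - 1) (by simp)]
      simp only [sum_avoidFst_zero, Finset.sum_const_zero]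
      simp
    · simp only [sum_avoidFst]
      change _ = crossChain p q n (((singChains X).d (p + 1) p).hom (single σ)) (single τ)
      rw [d_single, map_sum, LinearMap.sum_apply]
      refine Finset.sum_congr rfl fun i _ ↦ ?_
      rw [crossChain_single]
      refine Finset.sum_congr rfl fun c _ ↦ ?_
      simp only [g]
      rw [fst_faceFst, op_comp, Functor.map_comp]
      rfl
  · rcases q with _ | q
    · rw [(singChains Y).shape 0 (0 - 1) (by simp)]
      simp only [sum_avoidSnd_zero, Finset.sum_const_zero]
      simp
    · simp only [sum_avoidSnd]
      change _ = crossChain p q n (single σ) (((singChains Y).d (q + 1) q).hom (single τ))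
      rw [d_single, map_sum]
      refine Finset.sum_congr rfl fun i _ ↦ ?_
      rw [crossChain_single]
      refine Finset.sum_congr rfl fun c _ ↦ ?_
      simp only [g]
      rw [snd_faceSnd, op_comp, Functor.map_comp]
      rfl

/-- The Leibniz rule. -/
lemma d_crossChain {X Y : Type u} [TopologicalSpace X] [TopologicalSpace Y] {p q n : ℕ}
    (h : p + q = n + 1) (a : (singChains X).X p) (b : (singChains Y).X q) :
    ((singChains (X × Y)).d (n + 1) n).hom (crossChain p q (n + 1) a b) =
      crossChain (p - 1) q n (((singChains X).d p (p - 1)).hom a) b +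
      crossChain p (q - 1) n a (((singChains Y).d q (q - 1)).hom b) := by
  have : (crossChain p q (n + 1)).compr₂ ((singChains (X × Y)).d (n + 1) n).hom =
      (crossChain (X := X) (Y := Y) (p - 1) q n) ∘ₗ ((singChains X).d p (p - 1)).hom +
      (crossChain (X := X) (Y := Y) p (q - 1) n).compl₂ ((singChains Y).d q (q - 1)).hom := by
    apply chain_ext
    intro σ
    apply chain_ext
    intro τ
    simp only [LinearMap.compr₂_apply, LinearMap.add_apply, LinearMap.comp_apply,
      LinearMap.compl₂_apply]
    rw [crossChain_single]
    exact d_crossSimplex h σ τ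
  exact congrArg (fun f ↦ f a b) this


section Homology

variable (K : ChainComplex (ModuleCat.{u} (ZMod 2)) ℕ)

lemma iCycles_injective (n : ℕ) : Function.Injective (K.iCycles n).hom :=
  (ModuleCat.mono_iff_injective _).1 inferInstance

lemma homologyπ_surjective (n : ℕ) : Function.Surjective (K.homologyπ n).hom :=
  (ModuleCat.epi_iff_surjective _).1 inferInstance

lemma d_iCycles (n j : ℕ) (z : K.cycles n) : (K.d n j).hom ((K.iCycles n).hom z) = 0 :=
  congrArg (fun f ↦ f.hom z) (K.iCycles_d n j)

lemma mem_range_iCycles (n : ℕ) (x : K.X n) (hx : (K.d n (n - 1)).hom x = 0) :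
    x ∈ LinearMap.range (K.iCycles n).hom := by
  let k : F2.{u} ⟶ K.X n := ModuleCat.ofHom ((LinearMap.toSpanSingleton (ZMod 2) (K.X n) x) ∘ₗ
    (ULift.moduleEquiv (R := ZMod 2) (M := ZMod 2)).toLinearMap)
  have hn : (ComplexShape.down ℕ).next n = n - 1 := by
    rcases n with _ | n
    · exact ChainComplex.next_nat_zero
    · exact ChainComplex.next_nat_succ n
  have hk : k ≫ K.d n (n - 1) = 0 := by
    ext r
    simp [k, hx]
  refine ⟨(K.liftCycles k (n - 1) hn hk).hom (ULift.up 1), ?_⟩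
  have := congrArg (fun f ↦ f.hom (ULift.up 1)) (K.liftCycles_i k (n - 1) hn hk)
  refine Eq.trans this ?_
  simp [k]

lemma homologyπ_eq_zero (n : ℕ) (z : K.cycles n) :
    (K.homologyπ n).hom z = 0 ↔ ∃ y : K.X (n + 1), (K.d (n + 1) n).hom y = (K.iCycles n).hom z := by
  have hi : ∀ y : K.X (n + 1), (K.iCycles n).hom ((K.toCycles (n + 1) n).hom y) =
      (K.d (n + 1) n).hom y := fun y ↦ congrArg (fun f ↦ f.hom y) (K.toCycles_i (n + 1) n)
  constructor
  · intro h
    have ex : (ShortComplex.mk (K.toCycles (n + 1) n) (K.homologyπ n)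
        (K.toCycles_comp_homologyπ (n + 1) n)).Exact :=
      ShortComplex.exact_of_g_is_cokernel _
        (K.homologyIsCokernel (n + 1) n (ChainComplex.prev ℕ n))
    obtain ⟨y, hy⟩ := (ShortComplex.moduleCat_exact_iff _).1 ex z h
    refine ⟨y, ?_⟩
    rw [← hi]
    exact congrArg _ hy
  · rintro ⟨y, hy⟩
    have : z = (K.toCycles (n + 1) n).hom y := iCycles_injective K n (by rw [hi, hy])
    rw [this]
    exact congrArg (fun f ↦ f.hom y) (K.toCycles_comp_homologyπ (n + 1) n)

/-- Descent of a linear map along a surjection. -/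
def descSurj {Z H M : Type*} [AddCommGroup Z] [Module (ZMod 2) Z] [AddCommGroup H]
    [Module (ZMod 2) H] [AddCommGroup M] [Module (ZMod 2) M] (pr : Z →ₗ[ZMod 2] H)
    (hpr : Function.Surjective pr) (f : Z →ₗ[ZMod 2] M) (h : ∀ z, pr z = 0 → f z = 0) :
    H →ₗ[ZMod 2] M :=
  (LinearMap.ker pr).liftQ f (fun z hz ↦ h z hz) ∘ₗ
    (LinearMap.quotKerEquivOfSurjective pr hpr).symm.toLinearMap

lemma descSurj_apply {Z H M : Type*} [AddCommGroup Z] [Module (ZMod 2) Z] [AddCommGroup H]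
    [Module (ZMod 2) H] [AddCommGroup M] [Module (ZMod 2) M] (pr : Z →ₗ[ZMod 2] H)
    (hpr : Function.Surjective pr) (f : Z →ₗ[ZMod 2] M) (h : ∀ z, pr z = 0 → f z = 0) (z : Z) :
    descSurj pr hpr f h (pr z) = f z := by
  have : (LinearMap.quotKerEquivOfSurjective pr hpr).symm (pr z) = (LinearMap.ker pr).mkQ z := by
    rw [LinearEquiv.symm_apply_eq]
    rfl
  simp only [descSurj, LinearMap.comp_apply, LinearEquiv.coe_coe, this]
  rfl

end Homology

lemma crossChain_cycle {X Y : Type u} [TopologicalSpace X] [TopologicalSpace Y] (p q : ℕ)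
    (a : (singChains X).cycles p) (b : (singChains Y).cycles q) :
    crossChain p q (p + q) (((singChains X).iCycles p).hom a) (((singChains Y).iCycles q).hom b) ∈
      LinearMap.range ((singChains (X × Y)).iCycles (p + q)).hom := by
  apply mem_range_iCycles
  rcases h : p + q with _ | n
  · rw [(singChains (X × Y)).shape 0 (0 - 1) (by simp)]
    rfl
  · change ((singChains (X × Y)).d (n + 1) n).hom _ = 0
    rw [d_crossChain h, d_iCycles, d_iCycles]
    simp

/-- The cross product of cycles. -/
def crossCycles {X Y : Type u} [TopologicalSpace X] [TopologicalSpace Y] (p q : ℕ) :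
    (singChains X).cycles p →ₗ[ZMod 2] (singChains Y).cycles q →ₗ[ZMod 2]
      (singChains (X × Y)).cycles (p + q) :=
  LinearMap.codRestrict₂ ((crossChain p q (p + q)).compl₁₂ ((singChains X).iCycles p).hom
    ((singChains Y).iCycles q).hom) ((singChains (X × Y)).iCycles (p + q)).hom
    (iCycles_injective _ _) (fun a b ↦ crossChain_cycle p q a b)

lemma iCycles_crossCycles {X Y : Type u} [TopologicalSpace X] [TopologicalSpace Y] (p q : ℕ)
    (a : (singChains X).cycles p) (b : (singChains Y).cycles q) :
    ((singChains (X × Y)).iCycles (p + q)).hom (crossCycles p q a b) =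
      crossChain p q (p + q) (((singChains X).iCycles p).hom a)
        (((singChains Y).iCycles q).hom b) :=
  LinearMap.codRestrict₂_apply ..

lemma crossCycles_left {X Y : Type u} [TopologicalSpace X] [TopologicalSpace Y] (p q : ℕ)
    (a : (singChains X).cycles p) (b : (singChains Y).cycles q)
    (ha : ((singChains X).homologyπ p).hom a = 0) :
    ((singChains (X × Y)).homologyπ (p + q)).hom (crossCycles p q a b) = 0 := by
  rw [homologyπ_eq_zero] at ha ⊢
  obtain ⟨y, hy⟩ := ha
  refine ⟨crossChain (p + 1) q (p + q + 1) y (((singChains Y).iCycles q).hom b), ?_⟩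
  rw [iCycles_crossCycles, d_crossChain (by omega), d_iCycles, map_zero, add_zero, ← hy]
  rfl

lemma crossCycles_right {X Y : Type u} [TopologicalSpace X] [TopologicalSpace Y] (p q : ℕ)
    (a : (singChains X).cycles p) (b : (singChains Y).cycles q)
    (hb : ((singChains Y).homologyπ q).hom b = 0) :
    ((singChains (X × Y)).homologyπ (p + q)).hom (crossCycles p q a b) = 0 := by
  rw [homologyπ_eq_zero] at hb ⊢
  obtain ⟨y, hy⟩ := hb
  refine ⟨crossChain p (q + 1) (p + q + 1) (((singChains X).iCycles p).hom a) y, ?_⟩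
  rw [iCycles_crossCycles, d_crossChain (by omega), d_iCycles, map_zero, LinearMap.zero_apply,
    zero_add, ← hy]
  rfl

/-- The homology cross product `H_p(X) × H_q(Y) → H_{p+q}(X × Y)`, for a fixed cycle on `X`. -/
def crossAux {X Y : Type u} [TopologicalSpace X] [TopologicalSpace Y] (p q : ℕ) :
    Hlg X p →ₗ[ZMod 2] (singChains Y).cycles q →ₗ[ZMod 2] Hlg (X × Y) (p + q) :=
  descSurj ((singChains X).homologyπ p).hom (homologyπ_surjective _ _)
    ((crossCycles p q).compr₂ ((singChains (X × Y)).homologyπ (p + q)).hom)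
    (fun a ha ↦ LinearMap.ext fun b ↦ crossCycles_left p q a b ha)

/-- The homology cross product `H_p(X) × H_q(Y) → H_{p+q}(X × Y)`: the class of the product of
representing cycles. -/
def cross {X Y : Type u} [TopologicalSpace X] [TopologicalSpace Y] (p q : ℕ) :
    Hlg X p →ₗ[ZMod 2] Hlg Y q →ₗ[ZMod 2] Hlg (X × Y) (p + q) :=
  (descSurj ((singChains Y).homologyπ q).hom (homologyπ_surjective _ _) (crossAux p q).flip
    (fun b hb ↦ LinearMap.ext fun x ↦ by
      obtain ⟨a, rfl⟩ := homologyπ_surjective (singChains X) p x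
      exact (LinearMap.congr_fun (descSurj_apply _ _ _ _ a) b).trans
        (crossCycles_right p q a b hb))).flip

lemma cross_homologyπ {X Y : Type u} [TopologicalSpace X] [TopologicalSpace Y] (p q : ℕ)
    (a : (singChains X).cycles p) (b : (singChains Y).cycles q) :
    cross p q (((singChains X).homologyπ p).hom a) (((singChains Y).homologyπ q).hom b) =
      ((singChains (X × Y)).homologyπ (p + q)).hom (crossCycles p q a b) :=
  (LinearMap.congr_fun (descSurj_apply (H := Hlg Y q)
    (M := Hlg X p →ₗ[ZMod 2] Hlg (X × Y) (p + q)) _ _ _ _ b) _).trans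
    (LinearMap.congr_fun (descSurj_apply (H := Hlg X p) _ _ _ _ a) b)

end HomologyPart

section BundlePart

open Bundle

/-! ### Complex line bundles -/

section TensorBundle

variable {X : Type u} [TopologicalSpace X]
  (E₁ : X → Type v) [∀ x, AddCommGroup (E₁ x)] [∀ x, Module ℂ (E₁ x)]
  [TopologicalSpace (TotalSpace ℂ E₁)]
  (E₂ : X → Type v) [∀ x, AddCommGroup (E₂ x)] [∀ x, Module ℂ (E₂ x)]
  [TopologicalSpace (TotalSpace ℂ E₂)]

/-- The linear coordinate on `E₁ x ⊗ E₂ x` determined by linear coordinates on `E₁ x`, `E₂ x`: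
it sends `a ⊗ b` to the product of the coordinates of `a` and `b`. -/
def tensorCoord (e₁ : Trivialization ℂ (π ℂ E₁)) (e₂ : Trivialization ℂ (π ℂ E₂))
    [e₁.IsLinear ℂ] [e₂.IsLinear ℂ] (x : X) : E₁ x ⊗[ℂ] E₂ x →ₗ[ℂ] ℂ :=
  LinearMap.mul' ℂ ℂ ∘ₗ TensorProduct.map (e₁.linearMapAt ℂ x) (e₂.linearMapAt ℂ x)

/-- The pretrivialization of the tensor product of two line bundles induced by trivializations
of the factors. -/
def tensorPretriv (e₁ : Trivialization ℂ (π ℂ E₁)) (e₂ : Trivialization ℂ (π ℂ E₂))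
    [e₁.IsLinear ℂ] [e₂.IsLinear ℂ] :
    Pretrivialization ℂ (π ℂ (fun x ↦ E₁ x ⊗[ℂ] E₂ x)) where
  toFun p := ⟨p.1, tensorCoord E₁ E₂ e₁ e₂ p.1 p.2⟩
  invFun p := ⟨p.1, p.2 • (e₁.symmₗ ℂ p.1 1 ⊗ₜ[ℂ] e₂.symmₗ ℂ p.1 1)⟩
  source := TotalSpace.proj ⁻¹' (e₁.baseSet ∩ e₂.baseSet)
  target := (e₁.baseSet ∩ e₂.baseSet) ×ˢ Set.univ
  map_source' := fun ⟨_, _⟩ h ↦ ⟨h, Set.mem_univ _⟩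
  map_target' := fun ⟨_, _⟩ h ↦ h.1
  left_inv' := fun ⟨x, t⟩ ⟨h₁, h₂⟩ ↦ by
    have key : ∀ t : E₁ x ⊗[ℂ] E₂ x,
        tensorCoord E₁ E₂ e₁ e₂ x t • (e₁.symmₗ ℂ x 1 ⊗ₜ[ℂ] e₂.symmₗ ℂ x 1) = t := by
      intro t
      induction t using TensorProduct.induction_on with
      | zero => simp
      | add a b ha hb => rw [map_add, add_smul, ha, hb]
      | tmul a b =>
        have ha : (e₁.linearMapAt ℂ x a) • e₁.symmₗ ℂ x 1 = a := by
          rw [← map_smul, smul_eq_mul, mul_one]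
          exact e₁.symmₗ_linearMapAt h₁ a
        have hb : (e₂.linearMapAt ℂ x b) • e₂.symmₗ ℂ x 1 = b := by
          rw [← map_smul, smul_eq_mul, mul_one]
          exact e₂.symmₗ_linearMapAt h₂ b
        conv_rhs => rw [← ha, ← hb, TensorProduct.smul_tmul_smul]
        simp [tensorCoord]
    simp only [TotalSpace.mk_inj]
    exact key t
  right_inv' := fun ⟨x, c⟩ ⟨⟨h₁, h₂⟩, _⟩ ↦ by
    simp [tensorCoord, e₁.linearMapAt_symmₗ h₁, e₂.linearMapAt_symmₗ h₂]
  open_target := (e₁.open_baseSet.inter e₂.open_baseSet).prod isOpen_univ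
  baseSet := e₁.baseSet ∩ e₂.baseSet
  open_baseSet := e₁.open_baseSet.inter e₂.open_baseSet
  source_eq := rfl
  target_eq := rfl
  proj_toFun _ _ := rfl

instance (e₁ : Trivialization ℂ (π ℂ E₁)) (e₂ : Trivialization ℂ (π ℂ E₂))
    [e₁.IsLinear ℂ] [e₂.IsLinear ℂ] : (tensorPretriv E₁ E₂ e₁ e₂).IsLinear ℂ where
  linear x _ :=
    { map_add := fun a b ↦ (tensorCoord E₁ E₂ e₁ e₂ x).map_add a b
      map_smul := fun c a ↦ (tensorCoord E₁ E₂ e₁ e₂ x).map_smul c a }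

variable [∀ x, TopologicalSpace (E₁ x)] [FiberBundle ℂ E₁] [VectorBundle ℂ ℂ E₁]
  [∀ x, TopologicalSpace (E₂ x)] [FiberBundle ℂ E₂] [VectorBundle ℂ ℂ E₂]

/-- The topology on `E₁ x ⊗ E₂ x` that makes its linear coordinate an isomorphism with `ℂ`. -/
@[reducible]
def tensorFiberTopology (x : X) : TopologicalSpace (E₁ x ⊗[ℂ] E₂ x) :=
  TopologicalSpace.induced
    (tensorPretriv E₁ E₂ (trivializationAt ℂ E₁ x) (trivializationAt ℂ E₂ x) ∘
      TotalSpace.mk (F := ℂ) (E := fun x ↦ E₁ x ⊗[ℂ] E₂ x) x)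
    inferInstance

/-- The tensor product of two line bundles, as a vector prebundle. -/
def tensorPrebundle :
    letI := tensorFiberTopology E₁ E₂
    VectorPrebundle ℂ ℂ (fun x ↦ E₁ x ⊗[ℂ] E₂ x) :=
  letI := tensorFiberTopology E₁ E₂
  { pretrivializationAtlas :=
      {e | ∃ (e₁ : Trivialization ℂ (π ℂ E₁)) (e₂ : Trivialization ℂ (π ℂ E₂))
        (_ : MemTrivializationAtlas e₁) (_ : MemTrivializationAtlas e₂),
          e = tensorPretriv E₁ E₂ e₁ e₂}
    pretrivialization_linear' := by
      rintro _ ⟨e₁, e₂, he₁, he₂, rfl⟩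
      infer_instance
    pretrivializationAt := fun x ↦
      tensorPretriv E₁ E₂ (trivializationAt ℂ E₁ x) (trivializationAt ℂ E₂ x)
    mem_base_pretrivializationAt := fun x ↦
      ⟨mem_baseSet_trivializationAt ℂ E₁ x, mem_baseSet_trivializationAt ℂ E₂ x⟩
    pretrivialization_mem_atlas := fun x ↦
      ⟨trivializationAt ℂ E₁ x, trivializationAt ℂ E₂ x, inferInstance, inferInstance, rfl⟩
    exists_coordChange := by
      rintro _ ⟨e₁, e₂, he₁, he₂, rfl⟩ _ ⟨e₁', e₂', he₁', he₂', rfl⟩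
      refine ⟨fun x ↦ (e₁.coordChangeL ℂ e₁' x (1 : ℂ) * e₂.coordChangeL ℂ e₂' x (1 : ℂ)) •
        ContinuousLinearMap.id ℂ ℂ, ?_, ?_⟩
      · have h₁ := (continuousOn_coordChange ℂ e₁ e₁').clm_apply
          (continuousOn_const (c := (1 : ℂ)))
        have h₂ := (continuousOn_coordChange ℂ e₂ e₂').clm_apply
          (continuousOn_const (c := (1 : ℂ)))
        refine ContinuousOn.smul ((h₁.mono ?_).mul (h₂.mono ?_)) continuousOn_const
        · rintro x ⟨hx, hx'⟩
          exact ⟨hx.1, hx'.1⟩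
        · rintro x ⟨hx, hx'⟩
          exact ⟨hx.2, hx'.2⟩
      · rintro x ⟨hx, hx'⟩ c
        rw [Pretrivialization.symm_apply _ hx]
        have h₁ := e₁.coordChangeL_apply (R := ℂ) e₁' ⟨hx.1, hx'.1⟩ (1 : ℂ)
        have h₂ := e₂.coordChangeL_apply (R := ℂ) e₂' ⟨hx.2, hx'.2⟩ (1 : ℂ)
        change _ = tensorCoord E₁ E₂ e₁' e₂' x
          (c • (e₁.symmₗ ℂ x 1 ⊗ₜ[ℂ] e₂.symmₗ ℂ x 1))
        change (e₁.coordChangeL ℂ e₁' x (1 : ℂ) * e₂.coordChangeL ℂ e₂' x (1 : ℂ)) • c = _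
        rw [map_smul, h₁, h₂]
        simp [tensorCoord, e₁'.coe_linearMapAt_of_mem hx'.1, e₂'.coe_linearMapAt_of_mem hx'.2,
          mul_comm]
        exact Or.inl (by rw [e₁.coe_symmₗ hx.1, e₂.coe_symmₗ hx.2])
    totalSpaceMk_isInducing := fun _ ↦ ⟨rfl⟩ }

end TensorBundle

/-- A (topological) complex line bundle on `X`: a complex vector bundle with model fibre `ℂ`. -/
structure LineBundle (X : Type u) [TopologicalSpace X] where
  /-- the fibre over a point -/
  fiber : X → Type v
  [addCommGroup : ∀ x, AddCommGroup (fiber x)]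
  [module : ∀ x, Module ℂ (fiber x)]
  [topTotal : TopologicalSpace (TotalSpace ℂ fiber)]
  [topFiber : ∀ x, TopologicalSpace (fiber x)]
  [fiberBundle : FiberBundle ℂ fiber]
  [vectorBundle : VectorBundle ℂ ℂ fiber]

namespace LineBundle

attribute [instance] addCommGroup module topTotal topFiber fiberBundle vectorBundle

variable {X : Type u} [TopologicalSpace X] {Y : Type u} [TopologicalSpace Y]

/-- The fibre of a line bundle is linearly homeomorphic to `ℂ`. -/
def fiberEquiv (A : LineBundle.{u, v} X) (x : X) : A.fiber x ≃L[ℂ] ℂ :=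
  (trivializationAt ℂ A.fiber x).continuousLinearEquivAt ℂ x
    (mem_baseSet_trivializationAt ℂ A.fiber x)

instance (A : LineBundle.{u, v} X) (x : X) : IsTopologicalAddGroup (A.fiber x) :=
  (A.fiberEquiv x).toHomeomorph.isInducing.topologicalAddGroup (A.fiberEquiv x)

instance (A : LineBundle.{u, v} X) (x : X) : ContinuousSMul ℂ (A.fiber x) :=
  (A.fiberEquiv x).toHomeomorph.isInducing.continuousSMul continuous_id
    (fun {c a} ↦ map_smul (A.fiberEquiv x) c a)

/-- The pullback of a line bundle along a continuous map. -/
def pullback (A : LineBundle.{u, v} Y) (f : C(X, Y)) : LineBundle.{u, v} X where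
  fiber := f *ᵖ A.fiber
  addCommGroup := fun x ↦ inferInstanceAs (AddCommGroup (A.fiber (f x)))
  module := fun x ↦ inferInstanceAs (Module ℂ (A.fiber (f x)))

/-- The tensor product (over `ℂ`) of two line bundles. -/
def tensor (A B : LineBundle.{u, v} X) : LineBundle.{u, v} X :=
  letI := tensorFiberTopology A.fiber B.fiber
  letI := (tensorPrebundle A.fiber B.fiber).totalSpaceTopology
  letI := (tensorPrebundle A.fiber B.fiber).toFiberBundle
  { fiber := fun x ↦ A.fiber x ⊗[ℂ] B.fiber x
    vectorBundle := (tensorPrebundle A.fiber B.fiber).toVectorBundle }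

/-- The element `a ⊗ b` of the fibre of `A ⊗ B`. -/
def tmul {A B : LineBundle.{u, v} X} {x : X} (a : A.fiber x) (b : B.fiber x) :
    (A.tensor B).fiber x :=
  TensorProduct.tmul ℂ a b

/-- Isomorphisms of line bundles over `X`: fibrewise linear isomorphisms that are continuous in
both directions on total spaces. -/
structure Iso (A B : LineBundle.{u, v} X) where
  /-- the linear isomorphism on each fibre -/
  equiv : ∀ x, A.fiber x ≃ₗ[ℂ] B.fiber x
  continuous_equiv :
    Continuous fun p : TotalSpace ℂ A.fiber ↦ (⟨p.1, equiv p.1 p.2⟩ : TotalSpace ℂ B.fiber)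
  continuous_symm :
    Continuous fun p : TotalSpace ℂ B.fiber ↦ (⟨p.1, (equiv p.1).symm p.2⟩ : TotalSpace ℂ A.fiber)

namespace Iso

/-- The identity. -/
def refl (A : LineBundle.{u, v} X) : Iso A A :=
  ⟨fun _ ↦ LinearEquiv.refl ℂ _, continuous_id, continuous_id⟩

/-- The inverse isomorphism. -/
def symm {A B : LineBundle.{u, v} X} (f : Iso A B) : Iso B A :=
  ⟨fun x ↦ (f.equiv x).symm, f.continuous_symm, f.continuous_equiv⟩

/-- Composition of isomorphisms. -/
def trans {A B C : LineBundle.{u, v} X} (f : Iso A B) (g : Iso B C) : Iso A C :=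
  ⟨fun x ↦ (f.equiv x).trans (g.equiv x), g.continuous_equiv.comp f.continuous_equiv,
    f.continuous_symm.comp g.continuous_symm⟩

end Iso

end LineBundle

open LineBundle

/-! ### Square roots of a line bundle -/

section SquareRoots

variable {X : Type u} [TopologicalSpace X]

/-- A pair `(J, j)` of a line bundle `J` and an isomorphism `j : J ⊗ J → K`. -/
structure RootPair (K : LineBundle.{u, v} X) where
  J : LineBundle.{u, v} X
  j : Iso (J.tensor J) K

/-- Two pairs `(J, j)`, `(J', j')` are isomorphic if there is `ι : J → J'` with
`j = j' ∘ (ι ⊗ ι)`. -/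
def rootSetoid (K : LineBundle.{u, v} X) : Setoid (RootPair K) where
  r p q := ∃ i : Iso p.J q.J, ∀ (x : X) (a b : p.J.fiber x),
    p.j.equiv x (tmul a b) = q.j.equiv x (tmul (i.equiv x a) (i.equiv x b))
  iseqv :=
    { refl := fun p ↦ ⟨Iso.refl p.J, fun _ _ _ ↦ rfl⟩
      symm := by
        rintro p q ⟨i, hi⟩
        refine ⟨i.symm, fun x a b ↦ ?_⟩
        rw [hi]
        change _ = q.j.equiv x (tmul (i.equiv x ((i.equiv x).symm a))
          (i.equiv x ((i.equiv x).symm b)))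
        rw [LinearEquiv.apply_symm_apply, LinearEquiv.apply_symm_apply]
      trans := by
        rintro p q r ⟨i, hi⟩ ⟨k, hk⟩
        exact ⟨i.trans k, fun x a b ↦ (hi x a b).trans (hk x _ _)⟩ }

/-- `S_K`: the set of square roots of `K`, i.e. of isomorphism classes `[J, j]`. -/
def SquareRoot (K : LineBundle.{u, v} X) : Type (max u (v + 1)) := Quotient (rootSetoid K)

/-- The isomorphism class of a pair. -/
def RootPair.toRoot {K : LineBundle.{u, v} X} (r : RootPair K) : SquareRoot K :=
  Quotient.mk (rootSetoid K) r

/-- Given a family of conditions `P y` on linear maps `A_y → B_y`, the space of pairs `(y, ξ)`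
with `ξ : A_y → B_y` satisfying `P y`, with the subspace topology from the total space of the
bundle `Hom(A, B)`. -/
def HomSubspace {Y : Type u} [TopologicalSpace Y] (A B : LineBundle.{u, v} Y)
    (P : ∀ y, (A.fiber y →ₗ[ℂ] B.fiber y) → Prop) : Type (max u v) :=
  {p : TotalSpace (ℂ →L[ℂ] ℂ) (fun y ↦ A.fiber y →L[ℂ] B.fiber y) // P p.1 p.2}

instance {Y : Type u} [TopologicalSpace Y] (A B : LineBundle.{u, v} Y)
    (P : ∀ y, (A.fiber y →ₗ[ℂ] B.fiber y) → Prop) : TopologicalSpace (HomSubspace A B P) :=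
  inferInstanceAs (TopologicalSpace {p : TotalSpace (ℂ →L[ℂ] ℂ)
    (fun y ↦ A.fiber y →L[ℂ] B.fiber y) // P p.1 p.2})

/-- The projection of `HomSubspace` to the base. -/
def HomSubspace.proj {Y : Type u} [TopologicalSpace Y] (A B : LineBundle.{u, v} Y)
    (P : ∀ y, (A.fiber y →ₗ[ℂ] B.fiber y) → Prop) (q : HomSubspace A B P) : Y :=
  q.1.1

end SquareRoots

end BundlePart

/-! ### The Pontryagin product -/

section Pontryagin

open DirectSum

/-- The total homology `H_*(X, ℤ/2)`. -/
abbrev TotalHlg (X : Type u) [TopologicalSpace X] : Type u := ⨁ n, Hlg X n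

variable {X Y : Type u} [TopologicalSpace X] [TopologicalSpace Y]

/-- A homology class of degree `n` as an element of the total homology. -/
abbrev TotalHlg.of (n : ℕ) : Hlg X n →ₗ[ZMod 2] TotalHlg X :=
  DirectSum.lof (ZMod 2) ℕ (fun n ↦ Hlg X n) n

/-- The component of degree `n`. -/
abbrev TotalHlg.component (n : ℕ) : TotalHlg X →ₗ[ZMod 2] Hlg X n :=
  DirectSum.component (ZMod 2) ℕ (fun n ↦ Hlg X n) n

/-- The map induced by a continuous map on total homology. -/
def TotalHlg.map (f : C(X, Y)) : TotalHlg X →ₗ[ZMod 2] TotalHlg Y :=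
  DirectSum.toModule (ZMod 2) ℕ _ fun n ↦ TotalHlg.of n ∘ₗ Hlg.map f n

/-- The cross product on total homology. -/
def TotalHlg.cross : TotalHlg X →ₗ[ZMod 2] TotalHlg Y →ₗ[ZMod 2] TotalHlg (X × Y) :=
  DirectSum.toModule (ZMod 2) ℕ _ fun p ↦
    (DirectSum.toModule (ZMod 2) ℕ (Hlg X p →ₗ[ZMod 2] TotalHlg (X × Y)) fun q ↦
      ((HPSqrt.cross (X := X) (Y := Y) p q).compr₂ (TotalHlg.of (p + q))).flip).flip

/-- The Pontryagin product `H_p(X) ⊗ H_q(X) → H_{p+q}(X × X) → H_{p+q}(X)`. -/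
def pontryagin (m : C(X × X, X)) : TotalHlg X →ₗ[ZMod 2] TotalHlg X →ₗ[ZMod 2] TotalHlg X :=
  TotalHlg.cross.compr₂ (TotalHlg.map m)

/-- The augmentation `ε : H_*(X, ℤ/2) → H_0(X, ℤ/2) = ⨁_{π₀ X} ℤ/2 → ℤ/2`. -/
def augmentation : TotalHlg X →ₗ[ZMod 2] ZMod 2 :=
  (ULift.moduleEquiv (R := ZMod 2) (M := ZMod 2)).toLinearMap ∘ₗ
    (TopCat.singularHomology₀ε (TopCat.of X) F2).hom ∘ₗ TotalHlg.component 0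

end Pontryagin

/-! ### Hochschild–Pontryagin cohomology -/

section Hochschild

variable (X : Type u) [TopologicalSpace X]

/-- The cochains `Hom(R^{⊗n}, ℤ/2)` for `R = H_*(X, ℤ/2)`, as multilinear maps. -/
abbrev Cochain (n : ℕ) : Type u :=
  MultilinearMap (ZMod 2) (fun _ : Fin n ↦ TotalHlg X) (ZMod 2)

variable {X}

lemma contractNth_update {n : ℕ} (m : C(X × X, X)) (i : Fin n) (g : Fin (n + 1) → TotalHlg X)
    (a : Fin (n + 1)) : ∃ (k : Fin n) (l : TotalHlg X →ₗ[ZMod 2] TotalHlg X), ∀ x,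
      Fin.contractNth i.castSucc (fun r s ↦ pontryagin m r s) (Function.update g a x) =
        Function.update (Fin.contractNth i.castSucc (fun r s ↦ pontryagin m r s) g) k (l x) := by
  have hk : ∀ (z : TotalHlg X) (k : Fin n),
      Fin.contractNth i.castSucc (fun r s ↦ pontryagin m r s) (Function.update g a z) k =
        if k.val < i.val then Function.update g a z k.castSucc
        else if k.val = i.val then
          pontryagin m (Function.update g a z k.castSucc) (Function.update g a z k.succ)
        else Function.update g a z k.succ := fun _ _ ↦ rfl
  have hk' : ∀ k : Fin n,
      Fin.contractNth i.castSucc (fun r s ↦ pontryagin m r s) g k =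
        if k.val < i.val then g k.castSucc
        else if k.val = i.val then pontryagin m (g k.castSucc) (g k.succ)
        else g k.succ := fun _ ↦ rfl
  have ha := a.isLt
  have hi := i.isLt
  rcases lt_trichotomy a.val i.val with h | h | h
  · refine ⟨⟨a.val, by omega⟩, LinearMap.id, fun x ↦ funext fun k ↦ ?_⟩
    simp only [hk, hk', Function.update_apply, Fin.ext_iff, Fin.val_castSucc, Fin.val_succ,
      LinearMap.id_apply]
    split_ifs <;> first | rfl | omega
  · refine ⟨i, (pontryagin m).flip (g i.succ), fun x ↦ funext fun k ↦ ?_⟩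
    by_cases hki : k = i
    · subst hki
      rw [hk]
      simp [Function.update_apply, Fin.ext_iff, h]
    · have : k.val ≠ i.val := fun h ↦ hki (Fin.ext h)
      simp only [hk, hk', Function.update_apply, Fin.ext_iff, Fin.val_castSucc, Fin.val_succ]
      split_ifs <;> first | rfl | omega
  · by_cases h' : a.val = i.val + 1
    · refine ⟨i, pontryagin m (g i.castSucc), fun x ↦ funext fun k ↦ ?_⟩
      by_cases hki : k = i
      · subst hki
        rw [hk]
        simp [Function.update_apply, Fin.ext_iff, h']
      · have : k.val ≠ i.val := fun h ↦ hki (Fin.ext h)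
        simp only [hk, hk', Function.update_apply, Fin.ext_iff, Fin.val_castSucc, Fin.val_succ]
        split_ifs <;> first | rfl | omega
    · refine ⟨⟨a.val - 1, by omega⟩, LinearMap.id, fun x ↦ funext fun k ↦ ?_⟩
      simp only [hk, hk', Function.update_apply, Fin.ext_iff, Fin.val_castSucc, Fin.val_succ,
        LinearMap.id_apply]
      split_ifs <;> first | rfl | omega

/-- The summand `(r_0, …, r_n) ↦ f(…, r_i r_{i+1}, …)` of the codifferential. -/
def contractCochain {n : ℕ} (m : C(X × X, X)) (i : Fin n) (f : Cochain X n) :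
    Cochain X (n + 1) where
  toFun r := f (Fin.contractNth i.castSucc (fun r s ↦ pontryagin m r s) r)
  map_update_add' := by
    intro inst g a x y
    obtain rfl : inst = instDecidableEqFin (n + 1) := Subsingleton.elim _ _
    obtain ⟨k, l, h⟩ := contractNth_update m i g a
    rw [h, h, h, map_add, f.map_update_add]
  map_update_smul' := by
    intro inst g a c x
    obtain rfl : inst = instDecidableEqFin (n + 1) := Subsingleton.elim _ _
    obtain ⟨k, l, h⟩ := contractNth_update m i g a
    rw [h, h, map_smul, f.map_update_smul]

/-- The summand `(r_0, …, r_n) ↦ ε(r_0) f(r_1, …, r_n)` of the codifferential. -/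
def firstCochain {n : ℕ} (f : Cochain X n) : Cochain X (n + 1) where
  toFun r := augmentation (r 0) * f (Fin.tail r)
  map_update_add' := by
    intro inst g a x y
    obtain rfl : inst = instDecidableEqFin (n + 1) := Subsingleton.elim _ _
    refine Fin.cases ?_ (fun a ↦ ?_) a
    · simp [add_mul]
    · simp [Fin.tail_update_succ, mul_add, Function.update_of_ne (Fin.succ_ne_zero a).symm]
  map_update_smul' := by
    intro inst g a c x
    obtain rfl : inst = instDecidableEqFin (n + 1) := Subsingleton.elim _ _
    refine Fin.cases ?_ (fun a ↦ ?_) a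
    · simp [mul_assoc]
    · simp [Fin.tail_update_succ, mul_left_comm, Function.update_of_ne (Fin.succ_ne_zero a).symm]

/-- The summand `(r_0, …, r_n) ↦ f(r_0, …, r_{n-1}) ε(r_n)` of the codifferential. -/
def lastCochain {n : ℕ} (f : Cochain X n) : Cochain X (n + 1) where
  toFun r := f (Fin.init r) * augmentation (r (Fin.last n))
  map_update_add' := by
    intro inst g a x y
    obtain rfl : inst = instDecidableEqFin (n + 1) := Subsingleton.elim _ _
    refine Fin.lastCases ?_ (fun a ↦ ?_) a
    · simp [mul_add]
    · simp [Fin.init_update_castSucc, add_mul,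
        Function.update_of_ne (Fin.castSucc_lt_last a).ne']
  map_update_smul' := by
    intro inst g a c x
    obtain rfl : inst = instDecidableEqFin (n + 1) := Subsingleton.elim _ _
    refine Fin.lastCases ?_ (fun a ↦ ?_) a
    · simp [mul_left_comm]
    · simp [Fin.init_update_castSucc, mul_assoc,
        Function.update_of_ne (Fin.castSucc_lt_last a).ne']

/-- The codifferential
`(df)(r_0, …, r_n) = ε(r_0) f(r_1, …, r_n) + ∑_i f(…, r_{i-1} r_i, …) + f(r_0, …, r_{n-1}) ε(r_n)`;
there are no signs modulo `2`. -/
def codiff (m : C(X × X, X)) (n : ℕ) : Cochain X n →+ Cochain X (n + 1) where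
  toFun f := firstCochain f + ∑ i : Fin n, contractCochain m i f + lastCochain f
  map_add' f g := by
    ext r
    simp [firstCochain, contractCochain, lastCochain, mul_add, add_mul, Finset.sum_add_distrib]
    ring
  map_zero' := by
    ext r
    simp [firstCochain, contractCochain, lastCochain]

variable (X) in
/-- The cochains that lower degree by `j`: since `ℤ/2` is concentrated in degree `0`, these are
the cochains vanishing on homogeneous elements whose degrees do not add up to `j`. -/
def cochainDeg (n j : ℕ) : AddSubgroup (Cochain X n) where
  carrier := {f | ∀ (d : Fin n → ℕ) (x : ∀ k, Hlg X (d k)), ∑ k, d k ≠ j →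
    f (fun k ↦ TotalHlg.of (d k) (x k)) = 0}
  add_mem' hf hg d x h := by
    rw [add_apply, hf d x h, hg d x h, add_zero]
  zero_mem' _ _ _ := rfl
  neg_mem' hf d x h := by
    rw [neg_apply, hf d x h, neg_zero]

/-- The cocycles of bidegree `(i, j)`. -/
def cocycles (m : C(X × X, X)) (i j : ℕ) : AddSubgroup (Cochain X i) :=
  (codiff m i).ker ⊓ cochainDeg X i j

/-- The coboundaries of bidegree `(i, j)`. -/
def coboundaries (m : C(X × X, X)) (i j : ℕ) : AddSubgroup (Cochain X i) :=
  match i with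
  | 0 => ⊥
  | i + 1 => (cochainDeg X i j).map (codiff m i)

/-- The Hochschild–Pontryagin cohomology group `HP^{i,j}(X, ℤ/2)`: the quotient of the cocycles of
bidegree `(i, j)` by the coboundaries. -/
abbrev HP (m : C(X × X, X)) (i j : ℕ) : Type u :=
  ↥(cocycles m i j) ⧸ (coboundaries m i j).addSubgroupOf (cocycles m i j)

/-- The class of a cocycle. -/
def HP.mk (m : C(X × X, X)) {i j : ℕ} (f : cocycles m i j) : HP m i j :=
  QuotientAddGroup.mk f

end Hochschild

/-! ### The first Stiefel–Whitney class of a double cover -/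

section StiefelWhitney

variable {Y : Type u} [TopologicalSpace Y]

/-- A path, viewed as a singular `1`-simplex. -/
def pathSimplex {y z : Y} (γ : Path y z) : TopCat.toSSet.obj (TopCat.of Y) _⦋1⦌ :=
  (TopCat.toSSetObjEquiv (TopCat.of Y) _).symm
    (γ.toContinuousMap.comp ⟨stdSimplexHomeomorphUnitInterval,
      stdSimplexHomeomorphUnitInterval.continuous⟩)

lemma pathSimplex_faces {y : Y} (γ : Path y y) :
    (TopCat.toSSet.obj (TopCat.of Y)).δ 0 (pathSimplex γ) =
      (TopCat.toSSet.obj (TopCat.of Y)).δ 1 (pathSimplex γ) := by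
  apply (TopCat.toSSetObjEquiv (TopCat.of Y) _).injective
  ext p
  have key : ∀ i : Fin 2, TopCat.toSSetObjEquiv (TopCat.of Y) _
      ((TopCat.toSSet.obj (TopCat.of Y)).δ i (pathSimplex γ)) p = y := by
    intro i
    change γ (stdSimplexHomeomorphUnitInterval
      (stdSimplex.map (SimplexCategory.δ i).toOrderHom p)) = y
    obtain rfl : p = stdSimplex.vertex 0 := Subsingleton.elim _ _
    rw [stdSimplex.map_vertex]
    fin_cases i
    · exact γ.target
    · exact γ.source
  exact (key 0).trans (key 1).symm

/-- A loop is a cycle. -/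
lemma d_pathSimplex {y : Y} (γ : Path y y) :
    (TopCat.toSSet.obj (TopCat.of Y)).ιChainComplex (R := F2.{u}) (pathSimplex γ) ≫
      (singChains Y).d 1 0 = 0 := by
  have h := SSet.ιChainComplex_d (R := F2.{u}) (TopCat.toSSet.obj (TopCat.of Y)) (pathSimplex γ)
  refine h.trans ?_
  rw [Fin.sum_univ_two, pathSimplex_faces]
  simp

/-- The class in `H_1(Y, ℤ/2)` of a loop. -/
def loopClass {y : Y} (γ : Path y y) : Hlg Y 1 :=
  ((singChains Y).homologyπ 1).hom
    (((singChains Y).liftCycles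
      ((TopCat.toSSet.obj (TopCat.of Y)).ιChainComplex (R := F2.{u}) (pathSimplex γ)) 0
      (ChainComplex.next_nat_succ 0) (d_pathSimplex γ)).hom (ULift.up 1))

/-- `w ∈ Hom(H_1(Y, ℤ/2), ℤ/2) = H¹(Y, ℤ/2)` is the first Stiefel–Whitney class of the double
cover `p : E → Y`: its value on a loop is zero if and only if the loop lifts to a loop in `E`,
i.e. if and only if `E` has trivial monodromy along the loop. -/
def IsFirstStiefelWhitney {E : Type*} [TopologicalSpace E] (p : E → Y)
    (w : Hlg Y 1 →ₗ[ZMod 2] ZMod 2) : Prop :=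
  ∀ (y : Y) (γ : Path y y), w (loopClass γ) = 0 ↔
    ∃ (e : E) (γ' : Path e e), ∀ t, p (γ' t) = γ t

end StiefelWhitney

/-! ### Compatible square roots -/

section Setup

open Bundle LineBundle

/-- The diagonal map. -/
def diag (X : Type u) [TopologicalSpace X] : C(X, X × X) :=
  (ContinuousMap.id X).prodMk (ContinuousMap.id X)

variable {X : Type u} [TopologicalSpace X]

/-- The first projection of `X × X`. -/
def pr1 : C(X × X, X) := ⟨fun p ↦ p.1, by fun_prop⟩

/-- The second projection of `X × X`. -/
def pr2 : C(X × X, X) := ⟨fun p ↦ p.2, by fun_prop⟩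

/-- `(x, y, z) ↦ x` -/
def pr1' : C(X × X × X, X) := ⟨fun p ↦ p.1, by fun_prop⟩

/-- `(x, y, z) ↦ y` -/
def pr2' : C(X × X × X, X) := ⟨fun p ↦ p.2.1, by fun_prop⟩

/-- `(x, y, z) ↦ z` -/
def pr3' : C(X × X × X, X) := ⟨fun p ↦ p.2.2, by fun_prop⟩

/-- `(x, y, z) ↦ (x, y)` -/
def pr12 : C(X × X × X, X × X) := ⟨fun p ↦ (p.1, p.2.1), by fun_prop⟩

/-- `(x, y, z) ↦ (x, z)` -/
def pr13 : C(X × X × X, X × X) := ⟨fun p ↦ (p.1, p.2.2), by fun_prop⟩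

/-- `(x, y, z) ↦ (y, z)` -/
def pr23 : C(X × X × X, X × X) := ⟨fun p ↦ (p.2.1, p.2.2), by fun_prop⟩

/-- `(x, y, z) ↦ (m (x, y), z)` -/
def mulId (m : C(X × X, X)) : C(X × X × X, X × X) := (m.comp pr12).prodMk pr3'

/-- `(x, y, z) ↦ (x, m (y, z))` -/
def idMul (m : C(X × X, X)) : C(X × X × X, X × X) := pr1'.prodMk (m.comp pr23)

/-- An H-space structure on `X`: a multiplication `m` with a unit `e`, associative and commutative,
all up to homotopy. -/
structure HSpaceStructure (X : Type u) [TopologicalSpace X] where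
  e : X
  m : C(X × X, X)
  left_unit : (m.comp ((ContinuousMap.const X e).prodMk (ContinuousMap.id X))).Homotopic
    (ContinuousMap.id X)
  right_unit : (m.comp ((ContinuousMap.id X).prodMk (ContinuousMap.const X e))).Homotopic
    (ContinuousMap.id X)
  assoc : (m.comp (mulId m)).Homotopic (m.comp (idMul m))
  comm : (m.comp (pr2.prodMk pr1)).Homotopic m

/-- The line bundle `K = Δ^* L`. -/
abbrev diagBundle (L : LineBundle.{u, v} (X × X)) : LineBundle.{u, v} X :=
  L.pullback (diag X)

variable (m : C(X × X, X)) (L : LineBundle.{u, v} (X × X))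

/-- Isomorphisms `φ : π₁^* K ⊗ π₂^* K ⊗ L² → m^* K` over `X × X`, for `K = Δ^* L`. -/
abbrev PhiIso : Type (max u v) :=
  LineBundle.Iso
    ((((diagBundle L).pullback pr1).tensor ((diagBundle L).pullback pr2)).tensor (L.tensor L))
    ((diagBundle L).pullback m)

/-- Isomorphisms `χ : π₁₃^* L ⊗ π₂₃^* L → (m × id)^* L` over `X × X × X`. -/
abbrev ChiIso : Type (max u v) :=
  LineBundle.Iso ((L.pullback pr13).tensor (L.pullback pr23)) (L.pullback (mulId m))

/-- Isomorphisms `ψ : π₁₂^* L ⊗ π₁₃^* L → (id × m)^* L` over `X × X × X`. -/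
abbrev PsiIso : Type (max u v) :=
  LineBundle.Iso ((L.pullback pr12).tensor (L.pullback pr13)) (L.pullback (idMul m))

variable {m L}

/-- The element `φ (k ⊗ k' ⊗ (l ⊗ l'))`. -/
def PhiIso.app (φ : PhiIso m L) {x y : X} (k : (diagBundle L).fiber x)
    (k' : (diagBundle L).fiber y) (l l' : L.fiber (x, y)) : (diagBundle L).fiber (m (x, y)) :=
  φ.equiv (x, y)
    (tmul (tmul (A := (diagBundle L).pullback pr1) (B := (diagBundle L).pullback pr2)
      (x := (x, y)) k k') (tmul l l'))

/-- The element `χ (b ⊗ c)`. -/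
def ChiIso.app (χ : ChiIso m L) {x y z : X} (b : L.fiber (x, z)) (c : L.fiber (y, z)) :
    L.fiber (m (x, y), z) :=
  χ.equiv (x, y, z) (tmul (A := L.pullback pr13) (B := L.pullback pr23) (x := (x, y, z)) b c)

/-- The element `ψ (a ⊗ b)`. -/
def PsiIso.app (ψ : PsiIso m L) {x y z : X} (a : L.fiber (x, y)) (b : L.fiber (x, z)) :
    L.fiber (x, m (y, z)) :=
  ψ.equiv (x, y, z) (tmul (A := L.pullback pr12) (B := L.pullback pr13) (x := (x, y, z)) a b)

/-- Projection of `[0, 1] × X × X × X` to `X × X × X`. -/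
def prX : C(unitInterval × X × X × X, X × X × X) := ⟨fun p ↦ p.2, by fun_prop⟩

variable (L) in
/-- The line bundle `π₁^* K ⊗ π₂^* K ⊗ π₃^* K ⊗ π₁₂^* L² ⊗ π₁₃^* L² ⊗ π₂₃^* L²` over
`[0, 1] × X × X × X`. -/
def assocSource : LineBundle.{u, v} (unitInterval × X × X × X) :=
  ((((((diagBundle L).pullback (pr1'.comp prX)).tensor
    ((diagBundle L).pullback (pr2'.comp prX))).tensor
    ((diagBundle L).pullback (pr3'.comp prX))).tensor
    ((L.tensor L).pullback (pr12.comp prX))).tensor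
    ((L.tensor L).pullback (pr13.comp prX))).tensor
    ((L.tensor L).pullback (pr23.comp prX))

/-- The element `k₁ ⊗ k₂ ⊗ k₃ ⊗ (a ⊗ a') ⊗ (b ⊗ b') ⊗ (c ⊗ c')` of a fibre of `assocSource L`. -/
def assocElem (t : unitInterval) {x y z : X} (k₁ : (diagBundle L).fiber x)
    (k₂ : (diagBundle L).fiber y) (k₃ : (diagBundle L).fiber z) (a a' : L.fiber (x, y))
    (b b' : L.fiber (x, z)) (c c' : L.fiber (y, z)) : (assocSource L).fiber (t, x, y, z) :=
  tmul (B := (L.tensor L).pullback (pr23.comp prX)) (x := (t, x, y, z))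
    (tmul (B := (L.tensor L).pullback (pr13.comp prX))
      (tmul (B := (L.tensor L).pullback (pr12.comp prX))
        (tmul (B := (diagBundle L).pullback (pr3'.comp prX))
          (tmul (A := (diagBundle L).pullback (pr1'.comp prX))
            (B := (diagBundle L).pullback (pr2'.comp prX)) k₁ k₂) k₃)
        (tmul (A := L) (B := L) (x := (x, y)) a a'))
      (tmul (A := L) (B := L) (x := (x, z)) b b'))
    (tmul (A := L) (B := L) (x := (y, z)) c c')

/-- The associativity condition on `φ, χ, ψ`: for some homotopy `h` from `m ∘ (m × id)` to
`m ∘ (id × m)` there is an isomorphism `ζ` from `assocSource L` to `h^* K`, which restricts to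
`(m × id)^* φ ∘ (π₁₂^* φ ⊗ id ⊗ χ²)` over `{0} × X × X × X` and to
`(id × m)^* φ ∘ (id ⊗ π₂₃^* φ ⊗ ψ²)` over `{1} × X × X × X`. -/
def IsAssociative (φ : PhiIso m L) (χ : ChiIso m L) (ψ : PsiIso m L) : Prop :=
  ∃ (h : ContinuousMap.Homotopy (m.comp (mulId m)) (m.comp (idMul m)))
    (ζ : LineBundle.Iso (assocSource L) ((diagBundle L).pullback h.toContinuousMap)),
    ∀ (x y z : X) (k₁ : (diagBundle L).fiber x) (k₂ : (diagBundle L).fiber y)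
      (k₃ : (diagBundle L).fiber z) (a a' : L.fiber (x, y)) (b b' : L.fiber (x, z))
      (c c' : L.fiber (y, z)),
      (⟨h (0, x, y, z), ζ.equiv (0, x, y, z) (assocElem 0 k₁ k₂ k₃ a a' b b' c c')⟩ :
          TotalSpace ℂ (diagBundle L).fiber) =
        ⟨m (m (x, y), z), φ.app (φ.app k₁ k₂ a a') k₃ (χ.app b c) (χ.app b' c')⟩ ∧
      (⟨h (1, x, y, z), ζ.equiv (1, x, y, z) (assocElem 1 k₁ k₂ k₃ a a' b b' c c')⟩ :
          TotalSpace ℂ (diagBundle L).fiber) =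
        ⟨m (x, m (y, z)), φ.app k₁ (φ.app k₂ k₃ c c') (ψ.app a b) (ψ.app a' b')⟩

/-- The line bundle `π₁^* J ⊗ π₂^* J ⊗ L` over `X × X`. -/
abbrev rootSource (L : LineBundle.{u, v} (X × X)) (J : LineBundle.{u, v} X) :
    LineBundle.{u, v} (X × X) :=
  ((J.pullback pr1).tensor (J.pullback pr2)).tensor L

/-- For a linear map `ξ : J_x ⊗ J_y ⊗ L_{x,y} → J_{m(x,y)}`, the condition
`j ∘ (ξ ⊗ ξ) = φ ∘ (j ⊗ j ⊗ id)`. -/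
def SquaresTo (φ : PhiIso m L) (r : RootPair (diagBundle L)) (p : X × X)
    (ξ : (rootSource L r.J).fiber p →ₗ[ℂ] (r.J.pullback m).fiber p) : Prop :=
  ∀ (a a' : r.J.fiber p.1) (b b' : r.J.fiber p.2) (l l' : L.fiber p),
    r.j.equiv (m p) (tmul (A := r.J) (B := r.J)
      (ξ (tmul (tmul (A := r.J.pullback pr1) (B := r.J.pullback pr2) a b) l))
      (ξ (tmul (tmul (A := r.J.pullback pr1) (B := r.J.pullback pr2) a' b') l'))) =
    φ.app (r.j.equiv p.1 (tmul a a')) (r.j.equiv p.2 (tmul b b')) l l'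

/-- `(J, j)` is compatible if there is an isomorphism `ξ : π₁^* J ⊗ π₂^* J ⊗ L → m^* J` with
`m^* j ∘ (ξ ⊗ ξ) = φ ∘ (π₁^* j ⊗ π₂^* j ⊗ id)`. -/
def IsCompatible (φ : PhiIso m L) (r : RootPair (diagBundle L)) : Prop :=
  ∃ ξ : LineBundle.Iso (rootSource L r.J) (r.J.pullback m),
    ∀ p, SquaresTo φ r p (ξ.equiv p).toLinearMap

/-- The set of compatible square roots. -/
def CompatibleRoot (φ : PhiIso m L) : Type (max u (v + 1)) :=
  {s : SquareRoot (diagBundle L) // ∃ r : RootPair (diagBundle L), r.toRoot = s ∧ IsCompatible φ r}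

/-- The compatible square root represented by a compatible pair. -/
def CompatibleRoot.mk {φ : PhiIso m L} (r : RootPair (diagBundle L)) (hr : IsCompatible φ r) :
    CompatibleRoot φ :=
  ⟨r.toRoot, r, rfl, hr⟩

/-- The double cover `Q_J` of `X × X`, whose fibre over `(x, y)` consists of the linear maps
`ξ : J_x ⊗ J_y ⊗ L_{x,y} → J_{m(x,y)}` with `j ∘ (ξ ⊗ ξ) = φ ∘ (j ⊗ j ⊗ id)`. -/
abbrev RootCover (φ : PhiIso m L) (r : RootPair (diagBundle L)) : Type (max u v) :=
  HomSubspace (rootSource L r.J) (r.J.pullback m) (SquaresTo φ r)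

/-- The projection of `Q_J` to `X × X`. -/
abbrev RootCover.proj (φ : PhiIso m L) (r : RootPair (diagBundle L)) (q : RootCover φ r) :
    X × X :=
  HomSubspace.proj _ _ _ q

/-- For linear maps `ξ : J₂ → J₁` on a fibre, the condition `j₁ ∘ (ξ ⊗ ξ) = j₂`. -/
def IsRootIsometry {K : LineBundle.{u, v} X} (r₁ r₂ : RootPair K) (x : X)
    (ξ : r₂.J.fiber x →ₗ[ℂ] r₁.J.fiber x) : Prop :=
  ∀ a b : r₂.J.fiber x, r₁.j.equiv x (tmul (ξ a) (ξ b)) = r₂.j.equiv x (tmul a b)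

/-- The double cover of `X` associated with the real line bundle `P` for which
`J₁ = J₂ ⊗_ℝ P` compatibly with `j₁, j₂`: its fibre over `x` consists of the linear maps
`ξ : J₂ → J₁` over `x` with `j₁ ∘ (ξ ⊗ ξ) = j₂`. -/
abbrev DifferenceCover {K : LineBundle.{u, v} X} (r₁ r₂ : RootPair K) : Type (max u v) :=
  HomSubspace r₂.J r₁.J (IsRootIsometry r₁ r₂)

/-- The projection of `DifferenceCover` to `X`. -/
abbrev DifferenceCover.proj {K : LineBundle.{u, v} X} (r₁ r₂ : RootPair K)
    (q : DifferenceCover r₁ r₂) : X :=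
  HomSubspace.proj _ _ _ q

/-- `o ∈ HP^{2,1}` is the class of the cocycle `(r, s) ↦ w ((r × s)₁)` defined by
`w ∈ Hom(H_1(X × X, ℤ/2), ℤ/2) = H¹(X × X, ℤ/2)`. -/
def RepresentsTwo (m : C(X × X, X)) (w : Hlg (X × X) 1 →ₗ[ZMod 2] ZMod 2) (o : HP m 2 1) : Prop :=
  ∃ f : cocycles m 2 1,
    (∀ r s : TotalHlg X, f.1 ![r, s] = w (TotalHlg.component 1 (TotalHlg.cross r s))) ∧
      HP.mk m f = o

/-- `o ∈ HP^{1,1}` is the class of the cocycle `r ↦ w (r₁)` defined by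
`w ∈ Hom(H_1(X, ℤ/2), ℤ/2) = H¹(X, ℤ/2)`. -/
def RepresentsOne (m : C(X × X, X)) (w : Hlg X 1 →ₗ[ZMod 2] ZMod 2) (o : HP m 1 1) : Prop :=
  ∃ f : cocycles m 1 1, (∀ r : TotalHlg X, f.1 ![r] = w (TotalHlg.component 1 r)) ∧
    HP.mk m f = o

end Setup

end HPSqrt

end

open HPSqrt

/-! A square root of an isomorphism between complex lines is unique up to sign. Hence `RootCover`,
`DifferenceCover` and an auxiliary cover of `[0, 1] × X³` are double covers
(`IsRootCondition.isDoubleCover`), and the proposition is about the signs that their lifts pick up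
along loops. A double cover gives a `1`-cocycle on singular simplices and so a functional `w` on
`H₁`, and functionals on `H₁` are determined by loops (`functional_ext`). Over a space with the
homotopy type of a locally path-connected one, `w = 0` forces a continuous section
(`IsDoubleCover.exists_section`). Thus a pair `(J, j)` is compatible exactly if `w₁(Q_J) = 0`, and
two pairs are isomorphic exactly if `w₁(P₁₂) = 0`.

Three facts about signs carry the obstruction theory. Closedness (`rootClass_assoc`): over the loop
`{0} × γ` a lift to the auxiliary cover is composed of lifts to `Q_J` along `(m × id) ∘ γ` and `π₁₂
∘ γ`, over `{1} × γ` of lifts along `(id × m) ∘ γ` and `π₂₃ ∘ γ`. The two loops are freely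
homotopic, so the two sums of signs agree. The isomorphisms `χ` and `ψ` are global and contribute no
sign. Change of root (`rootClass_change`): conjugating a lift to `Q_J` by isometries `J' → J` and `J
→ J'` gives a lift to `Q_{J'}`, so the cocycle changes by the coboundary of the difference class.
Realization (`RootPair.exists_differenceClass_eq`): every functional on `H₁(X)` is the difference
class of some pair from a given one, obtained by twisting `J` with signs. The signs are local
primitives of a cocycle, and local contractibility of the model of `X` supplies these.

So the class in `HP^{2,1}` does not depend on `J`. If it vanishes, say the cocycle is the coboundary
of `δ`, then the twist by `δ` has zero cocycle. A functional on `H₁(X × X)` that vanishes on loops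
in the slices is zero, because every loop in a product is homologous to a sum of two such loops
(`functional_prod_ext`); hence the twist is compatible. For (b), the same formula shows that the
difference class of two compatible roots is closed and that twisting by a closed class preserves
compatibility. Moreover `C^{0,1} = 0`, so an element of `HP^{1,1}` is the same as a closed
functional, and differences are additive, faithful and surjective.

On the algebraic side, a cochain of internal degree one is determined by its values on tuples of one
loop and otherwise points (`cochain_eq_zero`). Only products of points with points and loops have to
be computed, and for these there is a single shuffle. -/

noncomputable section

namespace HPSqrt

open CategoryTheory Topology
open scoped TensorProduct Simplicial

section ParityCocycles

/-! ### Functionals on homology in low degrees -/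

/-- The linear functional on chains with given values on simplices. -/
def chainFun {S : SSet.{u}} {n : ℕ} (c : S _⦋n⦌ → ZMod 2) : Chn S n →ₗ[ZMod 2] ZMod 2 :=
  (ULift.moduleEquiv (R := ZMod 2) (M := ZMod 2)).toLinearMap ∘ₗ
    chainLift (M := ULift.{u} (ZMod 2)) fun s ↦ ULift.up (c s)

lemma chainFun_single {S : SSet.{u}} {n : ℕ} (c : S _⦋n⦌ → ZMod 2) (s : S _⦋n⦌) :
    chainFun c (single s) = c s := by
  simp [chainFun, chainLift_single]

/-- Only a universe change: `chain_ext` takes values in `Type u`, so `ZMod 2` is lifted. -/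
lemma chainFun_ext {S : SSet.{u}} {n : ℕ} {f g : Chn S n →ₗ[ZMod 2] ZMod 2}
    (h : ∀ s : S _⦋n⦌, f (single s) = g (single s)) : f = g := by
  have := chain_ext (M := ULift.{u} (ZMod 2))
    (f := (ULift.moduleEquiv (R := ZMod 2) (M := ZMod 2)).symm.toLinearMap ∘ₗ f)
    (g := (ULift.moduleEquiv (R := ZMod 2) (M := ZMod 2)).symm.toLinearMap ∘ₗ g)
    (fun s ↦ by simp [h s])
  ext x
  exact congrArg ULift.down (LinearMap.congr_fun this x)

/-- Over a field the inclusion of the cycles into the chains splits. -/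
lemma exists_chain_extension {K : ChainComplex (ModuleCat.{u} (ZMod 2)) ℕ} {n : ℕ}
    (f : K.cycles n →ₗ[ZMod 2] ZMod 2) :
    ∃ g : K.X n →ₗ[ZMod 2] ZMod 2, ∀ z, g ((K.iCycles n).hom z) = f z := by
  obtain ⟨l, hl⟩ := (K.iCycles n).hom.exists_leftInverse_of_injective
    (LinearMap.ker_eq_bot.2 (iCycles_injective K n))
  exact ⟨f ∘ₗ l, fun z ↦ congrArg f (LinearMap.congr_fun hl z)⟩

variable {Y : Type u} [TopologicalSpace Y]

/-- A `ℤ/2`-valued `1`-cocycle on the singular simplices of `Y`. -/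
def IsCocycleOne (c : TopCat.toSSet.obj (TopCat.of Y) _⦋1⦌ → ZMod 2) : Prop :=
  ∀ s : TopCat.toSSet.obj (TopCat.of Y) _⦋2⦌,
    ∑ i : Fin 3, c ((TopCat.toSSet.obj (TopCat.of Y)).δ i s) = 0

lemma iCycles_loop {y : Y} (γ : Path y y) :
    ((singChains Y).iCycles 1).hom (((singChains Y).liftCycles
      ((TopCat.toSSet.obj (TopCat.of Y)).ιChainComplex (R := F2.{u}) (pathSimplex γ)) 0
      (ChainComplex.next_nat_succ 0) (d_pathSimplex γ)).hom (ULift.up 1)) =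
      single (pathSimplex γ) :=
  congrArg (fun f ↦ f.hom (ULift.up 1)) ((singChains Y).liftCycles_i
    ((TopCat.toSSet.obj (TopCat.of Y)).ιChainComplex (R := F2.{u}) (pathSimplex γ)) 0
      (ChainComplex.next_nat_succ 0) (d_pathSimplex γ))

/-- The face `δ 0` omits the initial vertex and leaves the end of the path. -/
lemma face_zero_pathSimplex {y z : Y} (γ : Path y z) (p) :
    TopCat.toSSetObjEquiv (TopCat.of Y) _
      ((TopCat.toSSet.obj (TopCat.of Y)).δ 0 (pathSimplex γ)) p = z := by
  change γ (stdSimplexHomeomorphUnitInterval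
    (stdSimplex.map (SimplexCategory.δ (n := 0) 0).toOrderHom p)) = z
  obtain rfl : p = stdSimplex.vertex 0 := Subsingleton.elim _ _
  rw [stdSimplex.map_vertex]
  exact γ.target

lemma face_one_pathSimplex {y z : Y} (γ : Path y z) (p) :
    TopCat.toSSetObjEquiv (TopCat.of Y) _
      ((TopCat.toSSet.obj (TopCat.of Y)).δ 1 (pathSimplex γ)) p = y := by
  change γ (stdSimplexHomeomorphUnitInterval
    (stdSimplex.map (SimplexCategory.δ (n := 0) 1).toOrderHom p)) = y
  obtain rfl : p = stdSimplex.vertex 0 := Subsingleton.elim _ _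
  rw [stdSimplex.map_vertex]
  exact γ.source

/-- A point, as a singular `0`-simplex. -/
def pointSimplex (y : Y) : TopCat.toSSet.obj (TopCat.of Y) _⦋0⦌ :=
  (TopCat.toSSetObjEquiv (TopCat.of Y) _).symm (ContinuousMap.const _ y)

/-- Every singular `1`-simplex is a path. -/
lemma exists_pathSimplex (s : TopCat.toSSet.obj (TopCat.of Y) _⦋1⦌) :
    ∃ (y z : Y) (γ : Path y z), s = pathSimplex γ := by
  let f := TopCat.toSSetObjEquiv (TopCat.of Y) _ s
  refine ⟨_, _, ⟨f.comp ⟨stdSimplexHomeomorphUnitInterval.symm,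
    stdSimplexHomeomorphUnitInterval.symm.continuous⟩, rfl, rfl⟩, ?_⟩
  apply (TopCat.toSSetObjEquiv (TopCat.of Y) _).injective
  ext p
  simp [pathSimplex, f]

/-- A `1`-cocycle defines a functional on `H₁`. -/
lemma exists_functional {c : TopCat.toSSet.obj (TopCat.of Y) _⦋1⦌ → ZMod 2}
    (hc : IsCocycleOne c) : ∃ w : Hlg Y 1 →ₗ[ZMod 2] ZMod 2,
      ∀ (y : Y) (γ : Path y y), w (loopClass γ) = c (pathSimplex γ) := by
  have hd : chainFun c ∘ₗ ((singChains Y).d 2 1).hom = 0 := by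
    refine chainFun_ext fun s ↦ ?_
    change chainFun c (((singChains Y).d 2 1).hom (single s)) = 0
    rw [d_single, map_sum, ← hc s]
    exact Finset.sum_congr rfl fun i _ ↦ chainFun_single c _
  refine ⟨descSurj ((singChains Y).homologyπ 1).hom (homologyπ_surjective _ _)
    (chainFun c ∘ₗ ((singChains Y).iCycles 1).hom) fun z hz ↦ ?_, fun y γ ↦ ?_⟩
  · obtain ⟨y, hy⟩ := (homologyπ_eq_zero _ _ _).1 hz
    rw [LinearMap.comp_apply, ← hy]
    exact LinearMap.congr_fun hd y
  · refine (descSurj_apply ..).trans ?_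
    rw [LinearMap.comp_apply, iCycles_loop, chainFun_single]

/-- Every functional on `H₁` comes from a `1`-cocycle. -/
lemma exists_cocycleOne (w : Hlg Y 1 →ₗ[ZMod 2] ZMod 2) :
    ∃ c : TopCat.toSSet.obj (TopCat.of Y) _⦋1⦌ → ZMod 2, IsCocycleOne c ∧
      (∀ (y : Y) (γ : Path y y), c (pathSimplex γ) = w (loopClass γ)) ∧
      ((∃ g : Y → ZMod 2, ∀ (y z : Y) (γ : Path y z), c (pathSimplex γ) = g y + g z) →
        w = 0) := by
  obtain ⟨f, hf⟩ := exists_chain_extension (K := singChains Y) (n := 1)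
    (w ∘ₗ ((singChains Y).homologyπ 1).hom)
  refine ⟨fun s ↦ f (single s), fun s ↦ ?_, fun y γ ↦ ?_, ?_⟩
  -- The boundary of a `2`-simplex is a cycle of class zero, and on cycles `f` is `w` of the
  -- homology class.
  · rw [← map_sum, ← d_single]
    have h1 : (((singChains Y).iCycles 1).hom (((singChains Y).toCycles 2 1).hom (single s))) =
      ((singChains Y).d 2 1).hom (single s) :=
        congrArg (fun f ↦ f.hom (single s)) ((singChains Y).toCycles_i 2 1)
    refine (congrArg f h1.symm).trans ((hf _).trans ?_)
    have h2 : (((singChains Y).homologyπ 1).hom (((singChains Y).toCycles 2 1).hom (single s))) =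
      0 := congrArg (fun f ↦ f.hom (single s)) ((singChains Y).toCycles_comp_homologyπ 2 1)
    exact (congrArg w h2).trans (map_zero w)
  · dsimp only
    rw [← iCycles_loop, hf]
    rfl
  · rintro ⟨g, hg⟩
    -- A primitive on points makes `f` factor through the differential, which is zero on cycles.
    have hfg : f = chainFun (fun s ↦ g (TopCat.toSSetObjEquiv (TopCat.of Y) _ s
        (stdSimplex.vertex 0))) ∘ₗ ((singChains Y).d 1 0).hom := by
      refine chainFun_ext fun s ↦ ?_
      obtain ⟨y, z, γ, rfl⟩ := exists_pathSimplex s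
      refine (hg y z γ).trans ?_
      change _ = chainFun _ (((singChains Y).d 1 0).hom (single _))
      rw [d_single, map_sum, Fin.sum_univ_two, chainFun_single, chainFun_single,
        face_zero_pathSimplex, face_one_pathSimplex, add_comm]
    refine LinearMap.ext fun x ↦ ?_
    obtain ⟨z, rfl⟩ := homologyπ_surjective (singChains Y) 1 x
    refine (hf z).symm.trans ?_
    rw [hfg, LinearMap.comp_apply, d_iCycles, map_zero]
    rfl

end ParityCocycles

/-! ### Calculus of `1`-cocycles along paths, squares and homotopies. -/

section PathCocycles

open unitInterval Set.Icc

variable {Y : Type u} [TopologicalSpace Y]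

/-- The straight path between two points of the square. -/
def seg (p q : I × I) : C(I, I × I) where
  toFun t := (convexComb p.1 q.1 t, convexComb p.2 q.2 t)
  continuous_toFun := by
    refine Continuous.prodMk ?_ ?_ <;>
    exact Continuous.subtype_mk (by fun_prop) _

/-- The affine map from a simplex to the unit interval. -/
def bary {n : ℕ} (a : Fin n → I) : C(stdSimplex ℝ (Fin n), I) where
  toFun v := ⟨∑ i, v i * a i, Finset.sum_nonneg fun i _ ↦ mul_nonneg (v.2.1 i) (a i).2.1, by
    calc ∑ i, v i * (a i : ℝ) ≤ ∑ i, v i :=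
          Finset.sum_le_sum fun i _ ↦ mul_le_of_le_one_right (v.2.1 i) (a i).2.2
      _ = 1 := v.2.2⟩
  continuous_toFun := by
    refine Continuous.subtype_mk (continuous_finsetSum _ fun i _ ↦ ?_) _
    exact ((continuous_apply i).comp continuous_subtype_val).mul continuous_const

lemma bary_map {n m : ℕ} (a : Fin m → I) (f : Fin n → Fin m) (v : stdSimplex ℝ (Fin n)) :
    bary a (stdSimplex.map f v) = bary (a ∘ f) v := by
  apply Subtype.ext
  change ∑ i, (stdSimplex.map f v) i * (a i : ℝ) = ∑ i, v i * (a (f i) : ℝ)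
  simp only [stdSimplex.map_coe, FunOnFinite.linearMap_apply_apply, Finset.sum_mul]
  rw [← Finset.sum_fiberwise (s := Finset.univ) (g := f)]
  refine Finset.sum_congr rfl fun j _ ↦ Finset.sum_congr rfl fun i hi ↦ ?_
  rw [(Finset.mem_filter.1 hi).2]

lemma bary_two (a : Fin 2 → I) (v : stdSimplex ℝ (Fin 2)) :
    bary a v = convexComb (a 0) (a 1) (stdSimplexHomeomorphUnitInterval v) := by
  apply Subtype.ext
  rw [coe_convexComb]
  -- The homeomorphism with the interval is the coordinate `v 1`.
  change ∑ i, v i * (a i : ℝ) = (1 - v 1) * _ + v 1 * _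
  have := stdSimplex.add_eq_one v
  rw [Fin.sum_univ_two, ← eq_sub_iff_add_eq.2 this]

/-- The value of a cochain on a path. -/
def onPath (c : TopCat.toSSet.obj (TopCat.of Y) _⦋1⦌ → ZMod 2) (f : C(I, Y)) : ZMod 2 :=
  c (pathSimplex (⟨f, rfl, rfl⟩ : Path (f 0) (f 1)))

variable {c : TopCat.toSSet.obj (TopCat.of Y) _⦋1⦌ → ZMod 2}

lemma onPath_path {y z : Y} (γ : Path y z) : onPath c γ.toContinuousMap = c (pathSimplex γ) := rfl

/-- The cocycle condition for the affine triangle `p q r` in the square, mapped to `Y` by `G`. All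
rules for paths below come from this one, degenerate triangles included. -/
lemma IsCocycleOne.triangle (hc : IsCocycleOne c) (G : C(I × I, Y)) (p q r : I × I) :
    onPath c (G.comp (seg p q)) + onPath c (G.comp (seg q r)) = onPath c (G.comp (seg p r)) := by
  let T : C(stdSimplex ℝ (Fin 3), I × I) :=
    (bary ![p.1, q.1, r.1]).prodMk (bary ![p.2, q.2, r.2])
  let s : TopCat.toSSet.obj (TopCat.of Y) _⦋2⦌ :=
    (TopCat.toSSetObjEquiv (TopCat.of Y) _).symm (G.comp T)
  have face : ∀ (i : Fin 3) (a b : I × I),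
      a.1 = ![p.1, q.1, r.1] (i.succAbove 0) → b.1 = ![p.1, q.1, r.1] (i.succAbove 1) →
      a.2 = ![p.2, q.2, r.2] (i.succAbove 0) → b.2 = ![p.2, q.2, r.2] (i.succAbove 1) →
      c ((TopCat.toSSet.obj (TopCat.of Y)).δ i s) = onPath c (G.comp (seg a b)) := by
    intro i a b h1 h2 h3 h4
    refine congrArg c ((TopCat.toSSetObjEquiv (TopCat.of Y) _).injective ?_)
    ext v
    change G (bary _ (stdSimplex.map i.succAbove v), bary _ (stdSimplex.map i.succAbove v)) =
      G (seg a b (stdSimplexHomeomorphUnitInterval v))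
    rw [bary_map, bary_map, bary_two, bary_two]
    simp only [seg, ContinuousMap.coe_mk, h1, h2, h3, h4, Function.comp]
  have h := hc s
  rw [Fin.sum_univ_three, face 0 q r rfl rfl rfl rfl, face 1 p r rfl rfl rfl rfl,
    face 2 p q rfl rfl rfl rfl] at h
  generalize onPath c (G.comp (seg p q)) = x at *
  generalize onPath c (G.comp (seg q r)) = y at *
  generalize onPath c (G.comp (seg p r)) = z at *
  revert h x y z
  decide

/-- The part of a path between two parameters. -/
def subpath (f : C(I, Y)) (a b : I) : C(I, Y) where
  toFun t := f (convexComb a b t)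
  continuous_toFun := f.continuous.comp (Continuous.subtype_mk (by fun_prop) _)

@[simp] lemma subpath_apply (f : C(I, Y)) (a b t : I) : subpath f a b t = f (convexComb a b t) :=
  rfl

@[simp] lemma subpath_zero_one (f : C(I, Y)) : subpath f 0 1 = f := by
  ext t
  simp

/-- The path is regarded as a map of the square that ignores the second coordinate, and the triangle
is degenerate. -/
lemma IsCocycleOne.subpath_add (hc : IsCocycleOne c) (f : C(I, Y)) (a b d : I) :
    onPath c (subpath f a b) + onPath c (subpath f b d) = onPath c (subpath f a d) :=
  hc.triangle (f.comp ContinuousMap.fst) (a, 0) (b, 0) (d, 0)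

lemma IsCocycleOne.subpath_self (hc : IsCocycleOne c) (f : C(I, Y)) (a : I) :
    onPath c (subpath f a a) = 0 := by
  have := hc.subpath_add f a a a
  simpa using this

lemma IsCocycleOne.subpath_symm (hc : IsCocycleOne c) (f : C(I, Y)) (a b : I) :
    onPath c (subpath f a b) = onPath c (subpath f b a) := by
  have := hc.subpath_add f a b a
  rw [hc.subpath_self] at this
  exact CharTwo.add_eq_zero.1 this

lemma IsCocycleOne.const (hc : IsCocycleOne c) (y : Y) :
    onPath c (ContinuousMap.const I y) = 0 :=
  hc.subpath_self (ContinuousMap.const I y) 0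

lemma IsCocycleOne.path_symm (hc : IsCocycleOne c) {y z : Y} (γ : Path y z) :
    onPath c γ.symm.toContinuousMap = onPath c γ.toContinuousMap := by
  have := hc.subpath_symm γ.toContinuousMap 1 0
  rw [subpath_zero_one] at this
  rw [← this]
  refine congrArg (onPath c) (ContinuousMap.ext fun t ↦ ?_)
  change γ (σ t) = γ (convexComb 1 0 t)
  refine congrArg γ (Subtype.ext ?_)
  simp [coe_convexComb]

lemma IsCocycleOne.path_trans (hc : IsCocycleOne c) {x y z : Y} (γ : Path x y) (δ : Path y z) :
    onPath c (γ.trans δ).toContinuousMap =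
      onPath c γ.toContinuousMap + onPath c δ.toContinuousMap := by
  -- Cut at `1/2`, where `Path.trans` switches: affine reparametrization of the two halves gives
  -- back `γ` and `δ` on the nose.
  let h : I := ⟨1 / 2, by norm_num, by norm_num⟩
  have := hc.subpath_add (γ.trans δ).toContinuousMap 0 h 1
  rw [subpath_zero_one] at this
  rw [← this]
  congr 2
  · ext t
    change (γ.trans δ) _ = γ t
    have h0 := t.2.1
    have h1 := t.2.2
    rw [Path.trans_apply, dif_pos]
    · congr 1
      apply Subtype.ext
      simp [coe_convexComb, h]
      ring
    · simp only [coe_convexComb, h, Set.Icc.coe_zero]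
      linarith
  · ext t
    change (γ.trans δ) _ = δ t
    have h0 := t.2.1
    have h1 := t.2.2
    rw [Path.trans_apply]
    -- At the parameter `1/2` itself `Path.trans` takes its first branch, so the start `t = 0` of
    -- the second half is treated apart.
    split_ifs with h3
    · simp only [coe_convexComb, h, Set.Icc.coe_one] at h3
      have : t = 0 := Subtype.ext (by simp only [Set.Icc.coe_zero]; linarith)
      subst this
      simp [h]
    · congr 1
      apply Subtype.ext
      simp [coe_convexComb, h]
      ring

/-- The value of a cocycle along the boundary of a square vanishes. -/
lemma IsCocycleOne.square (hc : IsCocycleOne c) (G : C(I × I, Y)) {f₀ f₁ g₀ g₁ : C(I, Y)}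
    (h₀ : ∀ t, f₀ t = G (0, t)) (h₁ : ∀ t, f₁ t = G (1, t))
    (k₀ : ∀ t, g₀ t = G (t, 0)) (k₁ : ∀ t, g₁ t = G (t, 1)) :
    onPath c f₀ + onPath c g₁ = onPath c g₀ + onPath c f₁ := by
  have e₁ := hc.triangle G (0, 0) (0, 1) (1, 1)
  have e₂ := hc.triangle G (0, 0) (1, 0) (1, 1)
  have hf₀ : f₀ = G.comp (seg (0, 0) (0, 1)) := by
    ext t; simp [h₀, seg]
  have hf₁ : f₁ = G.comp (seg (1, 0) (1, 1)) := by
    ext t; simp [h₁, seg]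
  have hg₀ : g₀ = G.comp (seg (0, 0) (1, 0)) := by
    ext t; simp [k₀, seg]
  have hg₁ : g₁ = G.comp (seg (0, 1) (1, 1)) := by
    ext t; simp [k₁, seg]
  rw [hf₀, hf₁, hg₀, hg₁, e₁, e₂]

/-- Freely homotopic loops have the same value. -/
lemma IsCocycleOne.free_homotopy (hc : IsCocycleOne c) (G : C(I × I, Y)) {f₀ f₁ : C(I, Y)}
    (h₀ : ∀ t, f₀ t = G (0, t)) (h₁ : ∀ t, f₁ t = G (1, t))
    (hG : ∀ t, G (t, 0) = G (t, 1)) : onPath c f₀ = onPath c f₁ := by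
  have := hc.square G h₀ h₁ (g₀ := G.comp ((ContinuousMap.id I).prodMk (ContinuousMap.const I 0)))
    (g₁ := G.comp ((ContinuousMap.id I).prodMk (ContinuousMap.const I 0))) (fun t ↦ rfl) hG
  rw [add_comm] at this
  exact add_left_cancel this

/-- A cocycle that vanishes on loops is a coboundary. -/
lemma IsCocycleOne.exists_primitive (hc : IsCocycleOne c)
    (h : ∀ (y : Y) (γ : Path y y), onPath c γ.toContinuousMap = 0) :
    ∃ g : Y → ZMod 2, ∀ (y z : Y) (γ : Path y z), onPath c γ.toContinuousMap = g y + g z := by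
  -- A base point in each path component; the primitive at `y` is the value on a chosen path from
  -- the base point to `y`.
  let b : Y → Y := fun y ↦ (Quotient.mk (pathSetoid Y) y).out
  have hb : ∀ y, Joined (b y) y := fun y ↦ Quotient.mk_out (s := pathSetoid Y) y
  let p : ∀ y, Path (b y) y := fun y ↦ (hb y).some
  refine ⟨fun y ↦ onPath c (p y).toContinuousMap, fun y z γ ↦ ?_⟩
  have hbe : b y = b z := congrArg Quotient.out
    (Quotient.sound (s := pathSetoid Y) (⟨γ⟩ : Joined y z))
  -- The loop at the base point that goes out to `y`, along `γ` and back from `z`; its value is the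
  -- sum of the three values.
  have key := h (b z) ((((p y).trans γ).trans (p z).symm).cast hbe.symm rfl)
  have key' : onPath c (((p y).trans γ).trans (p z).symm).toContinuousMap = 0 := key
  rw [hc.path_trans, hc.path_trans, hc.path_symm] at key'
  change _ = onPath c (p y).toContinuousMap + onPath c (p z).toContinuousMap
  generalize onPath c (p y).toContinuousMap = x at *
  generalize onPath c (p z).toContinuousMap = x' at *
  generalize onPath c γ.toContinuousMap = x'' at *
  revert key' x x' x''
  decide

/-- Functionals on `H₁` are determined by their values on loops. -/
lemma functional_ext {w w' : Hlg Y 1 →ₗ[ZMod 2] ZMod 2}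
    (h : ∀ (y : Y) (γ : Path y y), w (loopClass γ) = w' (loopClass γ)) : w = w' := by
  rw [← sub_eq_zero]
  obtain ⟨c, hc, hcw, hc0⟩ := exists_cocycleOne (w - w')
  refine hc0 (hc.exists_primitive fun y γ ↦ ?_)
  rw [onPath_path, hcw, LinearMap.sub_apply, h, sub_self]

end PathCocycles

section DoubleCovers

open unitInterval

/-! ### Double covers -/

/-- A double cover `p : E → Y` with deck transformation `neg`. -/
structure IsDoubleCover {E Y : Type*} [TopologicalSpace E] [TopologicalSpace Y] (p : E → Y)
    (neg : E → E) : Prop where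
  cov : IsCoveringMap p
  surj : Function.Surjective p
  continuous_neg : Continuous neg
  proj_neg : ∀ e, p (neg e) = p e
  neg_ne : ∀ e, neg e ≠ e
  eq_or : ∀ e e', p e' = p e → e' = e ∨ e' = neg e

/-- Apply the deck transformation if `k ≠ 0`. -/
def flip {E : Type*} (neg : E → E) (k : ZMod 2) (e : E) : E := if k = 0 then e else neg e

@[simp] lemma flip_zero {E : Type*} (neg : E → E) (e : E) : flip neg 0 e = e := if_pos rfl

@[simp] lemma flip_one {E : Type*} (neg : E → E) (e : E) : flip neg 1 e = neg e :=
  if_neg one_ne_zero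

lemma ZMod.two_cases (k : ZMod 2) : k = 0 ∨ k = 1 := by
  revert k
  decide

/-- Contractible and locally path-connected: what unique lifting of singular simplices through a
covering needs. -/
instance {n : ℕ} : ContractibleSpace (stdSimplex ℝ (Fin (n + 1))) :=
  (convex_stdSimplex ℝ _).contractibleSpace ⟨_, single_mem_stdSimplex ℝ 0⟩

instance {n : ℕ} : LocallyPathConnectedSpace (stdSimplex ℝ (Fin n)) :=
  (convex_stdSimplex ℝ _).locallyPathConnectedSpace

section

variable {E : Type*} {Y : Type u} [TopologicalSpace E] [TopologicalSpace Y] {p : E → Y}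

/-- An element of `ℤ/2` is known once it is known whether it vanishes, and a functional is known
from its values on loops. So the class is unique. -/
lemma isFirstStiefelWhitney_iff {w : Hlg Y 1 →ₗ[ZMod 2] ZMod 2}
    (hw : IsFirstStiefelWhitney p w) (w' : Hlg Y 1 →ₗ[ZMod 2] ZMod 2) :
    IsFirstStiefelWhitney p w' ↔ w' = w := by
  constructor
  · intro hw'
    refine functional_ext fun y γ ↦ ?_
    have : w' (loopClass γ) = 0 ↔ w (loopClass γ) = 0 := (hw' y γ).trans (hw y γ).symm
    revert this
    generalize w (loopClass γ) = x
    generalize w' (loopClass γ) = x'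
    revert x x'
    decide
  · rintro rfl
    exact hw

/-- A global section lifts every loop to a loop. -/
lemma isFirstStiefelWhitney_eq_zero {w : Hlg Y 1 →ₗ[ZMod 2] ZMod 2} (hw : IsFirstStiefelWhitney p w)
    (s : C(Y, E)) (hs : ∀ y, p (s y) = y) : w = 0 := by
  refine functional_ext fun y γ ↦ (hw y γ).2 ⟨s y, γ.map s.continuous, fun t ↦ hs _⟩

end

namespace IsDoubleCover

section

variable {E Y : Type*} [TopologicalSpace E] [TopologicalSpace Y] {p : E → Y}
  {neg : E → E} (hp : IsDoubleCover p neg)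

include hp

lemma exists_flip {e e' : E} (h : p e' = p e) : ∃ k, e' = flip neg k e := by
  rcases hp.eq_or e e' h with h | h
  · exact ⟨0, by rw [flip_zero, h]⟩
  · exact ⟨1, by rw [flip_one, h]⟩

/-- A numbering of every fibre by `ℤ/2`, from an arbitrary set-theoretic section `b`. Nothing is
continuous here: the failure of continuity is what the cocycle of the cover records. -/
lemma exists_index : ∃ s : E → ZMod 2, (∀ e, s (neg e) = s e + 1) ∧
    (∀ e e', p e' = p e → s e' = s e → e' = e) ∧ ∀ y k, ∃ e, p e = y ∧ s e = k := by
  classical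
  choose b hb using hp.surj
  have h1 : ∀ e, (if neg e = b (p (neg e)) then (0 : ZMod 2) else 1) =
      (if e = b (p e) then 0 else 1) + 1 := by
    intro e
    rw [hp.proj_neg]
    rcases hp.eq_or e (b (p e)) (hb _) with h | h
    · rw [h, if_neg (hp.neg_ne e), if_pos rfl, zero_add]
    · rw [h, if_pos rfl, if_neg (hp.neg_ne e).symm]
      rfl
  refine ⟨fun e ↦ if e = b (p e) then 0 else 1, h1, fun e e' h h' ↦ ?_, fun y k ↦ ?_⟩
  · rcases hp.eq_or e e' h with rfl | rfl
    · rfl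
    · have := (h1 e).symm.trans h'
      exact absurd this (by rw [add_eq_left]; exact one_ne_zero)
  · rcases ZMod.two_cases k with rfl | rfl
    · exact ⟨b y, hb y, if_pos (by rw [hb])⟩
    · exact ⟨neg (b y), by rw [hp.proj_neg, hb], (h1 (b y)).trans (by simp [hb])⟩

lemma exists_simplex_lift {n : ℕ} (f : C(stdSimplex ℝ (Fin (n + 1)), Y)) :
    ∃ F : C(stdSimplex ℝ (Fin (n + 1)), E), ∀ x, p (F x) = f x := by
  obtain ⟨e, he⟩ := hp.surj (f (stdSimplex.vertex 0))
  obtain ⟨F, hF, -⟩ := hp.cov.existsUnique_continuousMap_lifts f (stdSimplex.vertex 0) e he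
  exact ⟨F, congrFun hF.2⟩

/-- Two lifts over a connected space that agree at one point agree. The deck transformation is
continuous, so it can be applied to one lift to make them agree at `a`. -/
lemma lift_unique {A : Type*} [TopologicalSpace A] [PreconnectedSpace A] {F F' : C(A, E)}
    (h : ∀ x, p (F' x) = p (F x)) (a : A) : ∃ k, ∀ x, F' x = flip neg k (F x) := by
  obtain ⟨k, hk⟩ := hp.exists_flip (h a)
  refine ⟨k, fun x ↦ ?_⟩
  have hc : Continuous fun x ↦ flip neg k (F x) := by
    rcases ZMod.two_cases k with rfl | rfl
    · simpa using F.continuous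
    · simpa using hp.continuous_neg.comp' F.continuous
  refine congrFun (hp.cov.eq_of_comp_eq F'.continuous hc (funext fun x ↦ ?_) a hk) x
  change p (F' x) = p (flip neg k (F x))
  rw [h]
  rcases ZMod.two_cases k with rfl | rfl
  · simp
  · simp [hp.proj_neg]

lemma exists_path_lift (f : C(I, Y)) {e : E} (he : p e = f 0) :
    ∃ F : C(I, E), F 0 = e ∧ ∀ x, p (F x) = f x := by
  obtain ⟨F, hF, h⟩ := hp.cov.exists_path_lifts f e he.symm
  exact ⟨F, h, congrFun hF⟩

end

variable {E : Type*} {Y : Type u} [TopologicalSpace E] [TopologicalSpace Y] {p : E → Y}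
  {neg : E → E} (hp : IsDoubleCover p neg)

include hp

/-- The cocycle of a double cover, determined by an enumeration of the fibres. -/
lemma exists_cocycle {s : E → ZMod 2} (hs : ∀ e, s (neg e) = s e + 1) :
    ∃ c : TopCat.toSSet.obj (TopCat.of Y) _⦋1⦌ → ZMod 2, IsCocycleOne c ∧
      ∀ (f : C(I, Y)) (F : C(I, E)), (∀ t, p (F t) = f t) → onPath c f = s (F 0) + s (F 1) := by
  choose F hF using fun τ : TopCat.toSSet.obj (TopCat.of Y) _⦋1⦌ ↦
    hp.exists_simplex_lift (TopCat.toSSetObjEquiv (TopCat.of Y) _ τ)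
  -- The change of index along a lift. It does not depend on the lift, since the other lift has both
  -- indices shifted by one.
  let c : TopCat.toSSet.obj (TopCat.of Y) _⦋1⦌ → ZMod 2 :=
    fun τ ↦ s (F τ (stdSimplex.vertex 0)) + s (F τ (stdSimplex.vertex 1))
  have key : ∀ (τ : TopCat.toSSet.obj (TopCat.of Y) _⦋1⦌) (G : C(stdSimplex ℝ (Fin 2), E)),
      (∀ x, p (G x) = TopCat.toSSetObjEquiv (TopCat.of Y) _ τ x) →
      c τ = s (G (stdSimplex.vertex 0)) + s (G (stdSimplex.vertex 1)) := by
    intro τ G hG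
    obtain ⟨k, hk⟩ := hp.lift_unique (F := G) (F' := F τ)
      (fun x ↦ (hF τ x).trans (hG x).symm) (stdSimplex.vertex 0)
    simp only [c, hk]
    rcases ZMod.two_cases k with rfl | rfl
    · simp
    · simp only [flip_one, hs]
      generalize s (G (stdSimplex.vertex 0)) = x
      generalize s (G (stdSimplex.vertex 1)) = y
      revert x y
      decide
  refine ⟨c, fun τ ↦ ?_, fun f G hG ↦ ?_⟩
  -- One lift of the `2`-simplex computes all three faces, and every vertex index then occurs twice.
  · obtain ⟨G, hG⟩ := hp.exists_simplex_lift (TopCat.toSSetObjEquiv (TopCat.of Y) _ τ)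
    have face : ∀ i : Fin 3, c ((TopCat.toSSet.obj (TopCat.of Y)).δ i τ) =
        s (G (stdSimplex.vertex (i.succAbove 0))) + s (G (stdSimplex.vertex (i.succAbove 1))) := by
      intro i
      refine (key _ (G.comp ⟨stdSimplex.map i.succAbove, stdSimplex.continuous_map _⟩)
        (fun x ↦ hG _)).trans ?_
      simp only [ContinuousMap.comp_apply, ContinuousMap.coe_mk, stdSimplex.map_vertex]
    rw [Fin.sum_univ_three, face, face, face]
    change s (G (stdSimplex.vertex 1)) + s (G (stdSimplex.vertex 2)) +
      (s (G (stdSimplex.vertex 0)) + s (G (stdSimplex.vertex 2))) +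
      (s (G (stdSimplex.vertex 0)) + s (G (stdSimplex.vertex 1))) = 0
    generalize s (G (stdSimplex.vertex 0)) = x
    generalize s (G (stdSimplex.vertex 1)) = y
    generalize s (G (stdSimplex.vertex 2)) = z
    revert x y z
    decide
  · exact key (pathSimplex ⟨f, rfl, rfl⟩) (G.comp ⟨stdSimplexHomeomorphUnitInterval,
      stdSimplexHomeomorphUnitInterval.continuous⟩) (fun x ↦ hG _)

/-- The first Stiefel–Whitney class exists. -/
lemma exists_isFirstStiefelWhitney :
    ∃ w : Hlg Y 1 →ₗ[ZMod 2] ZMod 2, IsFirstStiefelWhitney p w := by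
  obtain ⟨s, hs, hs', -⟩ := hp.exists_index
  obtain ⟨c, hc, hcs⟩ := hp.exists_cocycle hs
  obtain ⟨w, hw⟩ := exists_functional hc
  -- The value on a loop vanishes iff the ends of a lift have the same index, and points of one
  -- fibre with the same index are equal.
  refine ⟨w, fun y γ ↦ ?_⟩
  rw [hw, ← onPath_path (c := c)]
  constructor
  · intro h
    obtain ⟨e, he⟩ := hp.surj y
    obtain ⟨F, hF, hF'⟩ := hp.exists_path_lift γ.toContinuousMap (he.trans γ.source.symm)
    rw [hcs _ F hF', CharTwo.add_eq_zero] at h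
    refine ⟨e, ⟨F, hF, ?_⟩, hF'⟩
    rw [← hF]
    refine hs' _ _ ?_ h.symm
    exact (hF' 1).trans ((γ.target.trans γ.source.symm).trans (hF' 0).symm)
  · rintro ⟨e, γ', hγ⟩
    have h := hcs γ.toContinuousMap γ'.toContinuousMap hγ
    have h0 : γ'.toContinuousMap 0 = e := γ'.source
    have h1 : γ'.toContinuousMap 1 = e := γ'.target
    rw [h, h0, h1]
    exact CharTwo.add_self_eq_zero _

/-- The monodromy of a double cover. -/
lemma loop_iff {w : Hlg Y 1 →ₗ[ZMod 2] ZMod 2} (hw : IsFirstStiefelWhitney p w) {y : Y}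
    (γ : Path y y) (F : C(I, E)) (hF : ∀ t, p (F t) = γ t) (k : ZMod 2) :
    w (loopClass γ) = k ↔ F 1 = flip neg k (F 0) := by
  have h01 : p (F 1) = p (F 0) := by rw [hF, hF, γ.source, γ.target]
  have h0 : w (loopClass γ) = 0 ↔ F 1 = F 0 := by
    rw [hw]
    constructor
    -- The closed lift may start on the other sheet; `F` differs from it by a fixed power of the
    -- deck transformation, so `F` closes up as well.
    · rintro ⟨e, γ', hγ⟩
      obtain ⟨l, hl⟩ := hp.lift_unique (F := γ'.toContinuousMap) (F' := F)
        (fun x ↦ (hF x).trans (hγ x).symm) 0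
      rw [hl, hl]
      congr 1
      exact γ'.target.trans γ'.source.symm
    · intro h
      exact ⟨F 0, ⟨F, rfl, h⟩, hF⟩
  rcases ZMod.two_cases k with rfl | rfl
  · rw [flip_zero, h0]
  · rw [flip_one]
    have : w (loopClass γ) = 1 ↔ ¬ w (loopClass γ) = 0 := by
      generalize w (loopClass γ) = x
      revert x
      decide
    rw [this, h0]
    constructor
    · exact fun h ↦ (hp.eq_or _ _ h01).resolve_left h
    · intro h h'
      exact hp.neg_ne _ (h.symm.trans h')

/-- A double cover with trivial first Stiefel–Whitney class has a set-theoretic section that is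
compatible with lifts of paths. -/
lemma exists_flat_section {w : Hlg Y 1 →ₗ[ZMod 2] ZMod 2} (hw : IsFirstStiefelWhitney p w)
    (h0 : w = 0) : ∃ τ : Y → E, (∀ y, p (τ y) = y) ∧
      ∀ F : C(I, E), F 0 = τ (p (F 0)) → F 1 = τ (p (F 1)) := by
  obtain ⟨s, hs, hs', hs''⟩ := hp.exists_index
  obtain ⟨c, hc, hcs⟩ := hp.exists_cocycle hs
  -- Trivial monodromy makes the cocycle of the cover a coboundary. The section `τ` picks the point
  -- of index `g y`; along any lift the index and `g` change by the same amount.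
  obtain ⟨g, hg⟩ := hc.exists_primitive fun y γ ↦ by
    obtain ⟨e, γ', hγ⟩ := (hw y γ).1 (by rw [h0, LinearMap.zero_apply])
    rw [hcs _ γ'.toContinuousMap hγ]
    have h0 : γ'.toContinuousMap 0 = e := γ'.source
    have h1 : γ'.toContinuousMap 1 = e := γ'.target
    rw [h0, h1]
    exact CharTwo.add_self_eq_zero _
  choose τ hτ hτ' using fun y ↦ hs'' y (g y)
  refine ⟨τ, hτ, fun F hF ↦ ?_⟩
  refine hs' _ _ (hτ _).symm ?_
  have h1 := hg _ _ (⟨(⟨p, hp.cov.continuous⟩ : C(E, Y)).comp F, rfl, rfl⟩ :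
    Path (p (F 0)) (p (F 1)))
  have h2 := hcs ((⟨p, hp.cov.continuous⟩ : C(E, Y)).comp F) F (fun _ ↦ rfl)
  rw [hτ']
  have h3 := h2.symm.trans h1
  rw [hF, hτ', ← hF] at h3
  exact add_left_cancel h3

/-- A double cover with trivial first Stiefel–Whitney class is trivial, over a space with the
homotopy type of a locally path-connected space. -/
lemma exists_section {w : Hlg Y 1 →ₗ[ZMod 2] ZMod 2} (hw : IsFirstStiefelWhitney p w)
    (h0 : w = 0) {Z : Type*} [TopologicalSpace Z] [LocallyPathConnectedSpace Z]
    (h : ContinuousMap.HomotopyEquiv Y Z) : ∃ s : C(Y, E), ∀ y, p (s y) = y := by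
  obtain ⟨τ, hτ, hF⟩ := hp.exists_flat_section hw h0
  -- Pulled back to the locally path-connected space `Z`, the flat section is continuous: on a
  -- path-connected neighbourhood of `z₀` it agrees with a local inverse of `p`, because both are
  -- compatible with the lift of a path from `z₀`.
  have hc : Continuous fun z ↦ τ (h.invFun z) := by
    rw [continuous_iff_continuousAt]
    intro z₀
    obtain ⟨q, hq, hpq⟩ := hp.cov.isLocalHomeomorph (τ (h.invFun z₀))
    have hz₀ : h.invFun z₀ ∈ q.target := by
      rw [← hτ (h.invFun z₀), hpq]
      exact q.map_source hq
    obtain ⟨V, ⟨hV, hVc⟩, hVq⟩ := (path_connected_basis z₀).mem_iff.mp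
      ((q.open_target.preimage h.invFun.continuous).mem_nhds hz₀)
    refine ContinuousAt.congr (f := fun z ↦ q.symm (h.invFun z))
      (ContinuousAt.comp (q.continuousAt_symm hz₀) h.invFun.continuous.continuousAt) ?_
    refine Filter.mem_of_superset hV fun z hz ↦ ?_
    obtain ⟨γ, hγ⟩ := hVc.joinedIn _ (mem_of_mem_nhds hV) _ hz
    let F : C(I, E) := ⟨fun t ↦ q.symm (h.invFun (γ t)), by
      refine continuous_iff_continuousAt.2 fun t ↦ ?_
      exact ContinuousAt.comp (f := fun t ↦ h.invFun (γ t)) (q.continuousAt_symm (hVq (hγ t)))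
        (by fun_prop)⟩
    have hpF : ∀ t, p (F t) = h.invFun (γ t) := fun t ↦ by
      rw [hpq]
      exact q.right_inv (hVq (hγ t))
    have := hF F (by
      rw [hpF]
      change q.symm (h.invFun (γ 0)) = _
      rw [γ.source]
      conv_lhs => rw [← hτ (h.invFun z₀), hpq]
      exact q.left_inv hq)
    rw [hpF] at this
    change q.symm (h.invFun (γ 1)) = _ at this
    rwa [γ.target] at this
  -- Composing with `h.toFun` gives a continuous lift of a map homotopic to the identity of `Y`. The
  -- homotopy is lifted, and its end is a section.
  obtain ⟨H⟩ := h.left_inv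
  have H0 : ∀ y, H (0, y) = p (τ (h.invFun (h.toFun y))) := fun y ↦ by
    rw [hτ]
    exact H.apply_zero y
  let T := hp.cov.liftHomotopy H.toContinuousMap ⟨fun y ↦ τ (h.invFun (h.toFun y)),
    hc.comp h.toFun.continuous⟩ H0
  refine ⟨T.comp ((ContinuousMap.const Y 1).prodMk (ContinuousMap.id Y)), fun y ↦ ?_⟩
  have := congrFun (hp.cov.liftHomotopy_lifts H.toContinuousMap ⟨fun y ↦
    τ (h.invFun (h.toFun y)), hc.comp h.toFun.continuous⟩ H0) (1, y)
  exact this.trans (H.apply_one y)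

end IsDoubleCover

end DoubleCovers

section Sections

open Bundle LineBundle Filter

/-! ### Continuous sections of line bundles -/

namespace LineBundle

variable {X : Type u} [TopologicalSpace X] {Y : Type u} [TopologicalSpace Y]
  {T : Type*} [TopologicalSpace T]

/-- The linear coordinate on the fibre over `y` given by the trivialization at `y₀`. -/
def coord (A : LineBundle.{u, v} Y) (y₀ y : Y) : A.fiber y →ₗ[ℂ] ℂ :=
  (trivializationAt ℂ A.fiber y₀).linearMapAt ℂ y

/-- The neighbourhood of `y₀` over which the preferred trivialization is defined. -/
def nbhd (A : LineBundle.{u, v} Y) (y₀ : Y) : Set Y := (trivializationAt ℂ A.fiber y₀).baseSet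

lemma isOpen_nbhd (A : LineBundle.{u, v} Y) (y₀ : Y) : IsOpen (A.nbhd y₀) :=
  (trivializationAt ℂ A.fiber y₀).open_baseSet

lemma mem_nbhd (A : LineBundle.{u, v} Y) (y₀ : Y) : y₀ ∈ A.nbhd y₀ :=
  mem_baseSet_trivializationAt ℂ A.fiber y₀

lemma coord_apply (A : LineBundle.{u, v} Y) {y₀ y : Y} (hy : y ∈ A.nbhd y₀) (a : A.fiber y) :
    A.coord y₀ y a = (trivializationAt ℂ A.fiber y₀ ⟨y, a⟩).2 := by
  rw [coord, Trivialization.coe_linearMapAt_of_mem _ hy]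

lemma coord_ne_zero (A : LineBundle.{u, v} Y) {y₀ y : Y} (hy : y ∈ A.nbhd y₀) {a : A.fiber y}
    (ha : a ≠ 0) : A.coord y₀ y a ≠ 0 := by
  intro h
  apply ha
  have := (trivializationAt ℂ A.fiber y₀).symmₗ_linearMapAt (R := ℂ) hy a
  rw [← this]
  change (trivializationAt ℂ A.fiber y₀).symmₗ ℂ y (A.coord y₀ y a) = 0
  rw [h, map_zero]

/-- Every element of a fibre is a multiple of a nonzero one. -/
lemma exists_smul (A : LineBundle.{u, v} Y) {y : Y} {a : A.fiber y} (ha : a ≠ 0) (b : A.fiber y) :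
    ∃ c : ℂ, b = c • a := by
  refine ⟨A.fiberEquiv y b / A.fiberEquiv y a, (A.fiberEquiv y).injective ?_⟩
  have : A.fiberEquiv y a ≠ 0 := by simpa using ha
  rw [map_smul, smul_eq_mul, div_mul_cancel₀ _ this]

/-- A frame near `y₀`. -/
def frame (A : LineBundle.{u, v} Y) (y₀ y : Y) : A.fiber y :=
  open Classical in
  if y ∈ A.nbhd y₀ then (trivializationAt ℂ A.fiber y₀).symmₗ ℂ y 1
  -- Away from the neighbourhood any nonzero vector will do; the choice keeps the frame nowhere zero
  -- on all of `Y`.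
  else (A.fiberEquiv y).symm 1

lemma coord_frame (A : LineBundle.{u, v} Y) {y₀ y : Y} (hy : y ∈ A.nbhd y₀) :
    A.coord y₀ y (A.frame y₀ y) = 1 := by
  rw [frame, if_pos hy]
  exact (trivializationAt ℂ A.fiber y₀).linearMapAt_symmₗ hy 1

lemma frame_ne_zero (A : LineBundle.{u, v} Y) (y₀ y : Y) : A.frame y₀ y ≠ 0 := by
  by_cases hy : y ∈ A.nbhd y₀
  · intro h
    have := A.coord_frame hy
    rw [h, map_zero] at this
    exact zero_ne_one this
  · rw [frame, if_neg hy]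
    simp

/-- The section `s` of `A` along `f` is continuous at `t₀`. -/
def SecAt (A : LineBundle.{u, v} Y) (f : T → Y) (s : ∀ t, A.fiber (f t)) (t₀ : T) : Prop :=
  ContinuousAt (fun t ↦ (⟨f t, s t⟩ : TotalSpace ℂ A.fiber)) t₀

/-- Continuity into the total space can be tested in any one trivialization around the value. -/
lemma secAt_iff_nbhd {A : LineBundle.{u, v} Y} {f : T → Y} {s : ∀ t, A.fiber (f t)} {t₀ : T}
    {y₀ : Y} (h₀ : f t₀ ∈ A.nbhd y₀) :
    SecAt A f s t₀ ↔ ContinuousAt f t₀ ∧ ContinuousAt (fun t ↦ A.coord y₀ (f t) (s t)) t₀ := by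
  have : SecAt A f s t₀ ↔ ContinuousAt f t₀ ∧
      ContinuousAt (fun t ↦ (trivializationAt ℂ A.fiber y₀ ⟨f t, s t⟩).2) t₀ :=
    (trivializationAt ℂ A.fiber y₀).tendsto_nhds_iff
      (f := fun t ↦ (⟨f t, s t⟩ : TotalSpace ℂ A.fiber)) (z := ⟨f t₀, s t₀⟩)
      ((Trivialization.mem_source _).2 h₀)
  rw [this]
  refine and_congr_right fun hf ↦ ?_
  have hev : ∀ᶠ t in 𝓝 t₀, f t ∈ A.nbhd y₀ :=
    hf.eventually ((A.isOpen_nbhd y₀).mem_nhds h₀)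
  refine continuousAt_congr ?_
  filter_upwards [hev] with t ht
  rw [A.coord_apply ht]

lemma secAt_iff {A : LineBundle.{u, v} Y} {f : T → Y} {s : ∀ t, A.fiber (f t)} {t₀ : T} :
    SecAt A f s t₀ ↔ ContinuousAt f t₀ ∧ ContinuousAt (fun t ↦ A.coord (f t₀) (f t) (s t)) t₀ :=
  secAt_iff_nbhd (A.mem_nbhd _)

lemma SecAt.base {A : LineBundle.{u, v} Y} {f : T → Y} {s : ∀ t, A.fiber (f t)} {t₀ : T}
    (h : SecAt A f s t₀) : ContinuousAt f t₀ := (secAt_iff.1 h).1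

lemma secAt_frame (A : LineBundle.{u, v} Y) {f : T → Y} {t₀ : T} (hf : ContinuousAt f t₀)
    {y₀ : Y} (h₀ : f t₀ ∈ A.nbhd y₀) : SecAt A f (fun t ↦ A.frame y₀ (f t)) t₀ := by
  rw [secAt_iff_nbhd h₀]
  refine ⟨hf, ?_⟩
  refine (continuousAt_const (y := (1 : ℂ))).congr ?_
  filter_upwards [hf.eventually ((A.isOpen_nbhd y₀).mem_nhds h₀)] with t ht
  rw [A.coord_frame ht]

lemma SecAt.smul {A : LineBundle.{u, v} Y} {f : T → Y} {s : ∀ t, A.fiber (f t)} {t₀ : T}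
    (h : SecAt A f s t₀) {c : T → ℂ} (hc : ContinuousAt c t₀) :
    SecAt A f (fun t ↦ c t • s t) t₀ := by
  rw [secAt_iff] at h ⊢
  refine ⟨h.1, ?_⟩
  simpa only [map_smul, smul_eq_mul] using hc.fun_mul h.2

/-- The coefficient of a continuous section with respect to a frame is continuous. -/
lemma SecAt.coeff {A : LineBundle.{u, v} Y} {f : T → Y} {s s' : ∀ t, A.fiber (f t)} {t₀ : T}
    (h : SecAt A f s t₀) (h' : SecAt A f s' t₀) (hs : s t₀ ≠ 0) {c : T → ℂ}
    (hc : ∀ᶠ t in 𝓝 t₀, s' t = c t • s t) : ContinuousAt c t₀ := by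
  rw [secAt_iff] at h h'
  have h0 : A.coord (f t₀) (f t₀) (s t₀) ≠ 0 := A.coord_ne_zero (A.mem_nbhd _) hs
  refine (h'.2.div h.2 h0).congr ?_
  filter_upwards [hc, h.2.eventually_ne h0] with t ht ht'
  rw [Pi.div_apply, ht, map_smul, smul_eq_mul, mul_div_cancel_right₀ _ ht']

lemma SecAt.comp {S : Type*} [TopologicalSpace S] {A : LineBundle.{u, v} Y} {f : T → Y}
    {s : ∀ t, A.fiber (f t)} {g : S → T} {x₀ : S} (h : SecAt A f s (g x₀))
    (hg : ContinuousAt g x₀) : SecAt A (fun x ↦ f (g x)) (fun x ↦ s (g x)) x₀ :=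
  ContinuousAt.comp (f := g) h hg

lemma SecAt.congr {A : LineBundle.{u, v} Y} {f : T → Y} {s s' : ∀ t, A.fiber (f t)} {t₀ : T}
    (h : SecAt A f s t₀) (hs : ∀ᶠ t in 𝓝 t₀, s t = s' t) : SecAt A f s' t₀ := by
  refine ContinuousAt.congr h ?_
  filter_upwards [hs] with t ht
  rw [ht]

/-- The total space of a pullback carries the topology induced from the product of the base with the
original total space. -/
lemma secAt_pullback {A : LineBundle.{u, v} Y} {g : C(X, Y)} {f : T → X}
    {s : ∀ t, A.fiber (g (f t))} {t₀ : T} :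
    SecAt (A.pullback g) f s t₀ ↔ ContinuousAt f t₀ ∧ SecAt A (fun t ↦ g (f t)) s t₀ := by
  have hi := inducing_pullbackTotalSpaceEmbedding (F := ℂ) (E := A.fiber) g
  refine (hi.continuousAt_iff).trans ?_
  exact ⟨fun h ↦ ⟨continuousAt_fst.comp h, continuousAt_snd.comp h⟩, fun h ↦ h.1.prodMk h.2⟩

lemma SecAt.pullback {A : LineBundle.{u, v} Y} {g : C(X, Y)} {f : T → X}
    {s : ∀ t, A.fiber (g (f t))} {t₀ : T} (h : SecAt A (fun t ↦ g (f t)) s t₀)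
    (hf : ContinuousAt f t₀) : SecAt (A.pullback g) f s t₀ :=
  secAt_pullback.2 ⟨hf, h⟩

/-- The preferred trivialization of a tensor product is by construction the product of the preferred
trivializations of the factors. -/
lemma coord_tmul {A B : LineBundle.{u, v} Y} {y₀ y : Y} (hA : y ∈ A.nbhd y₀) (hB : y ∈ B.nbhd y₀)
    (a : A.fiber y) (b : B.fiber y) :
    (A.tensor B).coord y₀ y (tmul a b) = A.coord y₀ y a * B.coord y₀ y b := by
  have h : y ∈ (A.tensor B).nbhd y₀ := ⟨hA, hB⟩
  rw [coord_apply _ h]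
  change tensorCoord A.fiber B.fiber (trivializationAt ℂ A.fiber y₀)
    (trivializationAt ℂ B.fiber y₀) y (a ⊗ₜ[ℂ] b) = _
  rfl

lemma SecAt.tmul {A B : LineBundle.{u, v} Y} {f : T → Y} {a : ∀ t, A.fiber (f t)}
    {b : ∀ t, B.fiber (f t)} {t₀ : T} (ha : SecAt A f a t₀) (hb : SecAt B f b t₀) :
    SecAt (A.tensor B) f (fun t ↦ LineBundle.tmul (a t) (b t)) t₀ := by
  have hf := ha.base
  rw [secAt_iff] at ha hb ⊢
  refine ⟨hf, (ha.2.mul hb.2).congr ?_⟩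
  filter_upwards [hf.eventually ((A.isOpen_nbhd _).mem_nhds (A.mem_nbhd _)),
    hf.eventually ((B.isOpen_nbhd _).mem_nhds (B.mem_nbhd _))] with t h1 h2
  rw [coord_tmul h1 h2]
  rfl

lemma tmul_ne_zero {A B : LineBundle.{u, v} Y} {y : Y} {a : A.fiber y} {b : B.fiber y}
    (ha : a ≠ 0) (hb : b ≠ 0) : LineBundle.tmul a b ≠ 0 := by
  intro h
  have := coord_tmul (A.mem_nbhd y) (B.mem_nbhd y) a b
  rw [h, map_zero] at this
  exact mul_ne_zero (A.coord_ne_zero (A.mem_nbhd y) ha) (B.coord_ne_zero (B.mem_nbhd y) hb)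
    this.symm

lemma SecAt.iso {A B : LineBundle.{u, v} Y} {f : T → Y} {a : ∀ t, A.fiber (f t)} {t₀ : T}
    (ha : SecAt A f a t₀) (i : Iso A B) : SecAt B f (fun t ↦ i.equiv (f t) (a t)) t₀ :=
  ContinuousAt.comp (f := fun t ↦ (⟨f t, a t⟩ : TotalSpace ℂ A.fiber))
    i.continuous_equiv.continuousAt ha

/-- A family of linear maps between fibres of line bundles is continuous at `t₀`. -/
def MorAt {Z : Type u} [TopologicalSpace Z] (A : LineBundle.{u, v} Y) (f : T → Y)
    (B : LineBundle.{u, v} Z) (g : T → Z) (ξ : ∀ t, A.fiber (f t) →ₗ[ℂ] B.fiber (g t)) (t₀ : T) :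
    Prop :=
  ∀ s, SecAt A f s t₀ → SecAt B g (fun t ↦ ξ t (s t)) t₀

/-- Near `t₀` every continuous section is a continuous multiple of the frame `a`, so one section
tests continuity of the whole family. -/
lemma morAt_of_frame {Z : Type u} [TopologicalSpace Z] {A : LineBundle.{u, v} Y} {f : T → Y}
    {B : LineBundle.{u, v} Z} {g : T → Z} {ξ : ∀ t, A.fiber (f t) →ₗ[ℂ] B.fiber (g t)} {t₀ : T}
    {a : ∀ t, A.fiber (f t)} (ha : SecAt A f a t₀) (ha' : ∀ᶠ t in 𝓝 t₀, a t ≠ 0)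
    (h : SecAt B g (fun t ↦ ξ t (a t)) t₀) : MorAt A f B g ξ t₀ := by
  intro s hs
  have : ∀ t, ∃ c : ℂ, a t ≠ 0 → s t = c • a t := fun t ↦ by
    by_cases h0 : a t = 0
    · exact ⟨0, fun h ↦ absurd h0 h⟩
    · obtain ⟨c, hc⟩ := A.exists_smul h0 (s t)
      exact ⟨c, fun _ ↦ hc⟩
  choose c hc using this
  have hev : ∀ᶠ t in 𝓝 t₀, s t = c t • a t := by
    filter_upwards [ha'] with t ht using hc t ht
  refine (h.smul (ha.coeff hs ha'.self_of_nhds hev)).congr ?_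
  filter_upwards [hev] with t ht
  rw [ht, map_smul]

/-- The linear map between fibres that maps a nonzero element to a given one. -/
lemma exists_linearMap {Z : Type u} [TopologicalSpace Z] (A : LineBundle.{u, v} Y)
    (B : LineBundle.{u, v} Z) {y : Y} {z : Z} {a : A.fiber y} (ha : a ≠ 0) (b : B.fiber z) :
    ∃ ξ : A.fiber y →ₗ[ℂ] B.fiber z, ξ a = b := by
  refine ⟨LinearMap.toSpanSingleton ℂ _ b ∘ₗ ((A.fiberEquiv y a)⁻¹ • (A.fiberEquiv y).toLinearMap),
    ?_⟩
  have : A.fiberEquiv y a ≠ 0 := by simpa using ha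
  simp [inv_mul_cancel₀ this]

lemma linearMap_ext {Z : Type u} [TopologicalSpace Z] {A : LineBundle.{u, v} Y}
    {B : LineBundle.{u, v} Z} {y : Y} {z : Z} {a : A.fiber y} (ha : a ≠ 0)
    {ξ ξ' : A.fiber y →ₗ[ℂ] B.fiber z} (h : ξ a = ξ' a) : ξ = ξ' := by
  ext b
  obtain ⟨c, rfl⟩ := A.exists_smul ha b
  rw [map_smul, map_smul, h]

/-- Linear maps between fibres are continuous. -/
def toCLM {A B : LineBundle.{u, v} Y} {y : Y} (ξ : A.fiber y →ₗ[ℂ] B.fiber y) :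
    A.fiber y →L[ℂ] B.fiber y where
  toLinearMap := ξ
  cont := by
    have : (fun a ↦ ξ a) = fun a ↦ (A.fiberEquiv y a) • ξ ((A.fiberEquiv y).symm 1) := by
      funext a
      rw [← map_smul, ← map_smul]
      simp
    change Continuous fun a ↦ ξ a
    rw [this]
    exact (A.fiberEquiv y).continuous.smul continuous_const

/-- An isomorphism of line bundles from a continuous family of nonzero linear maps. -/
lemma exists_iso {A B : LineBundle.{u, v} Y} (ξ : ∀ y, A.fiber y →ₗ[ℂ] B.fiber y)
    (h0 : ∀ y, ξ y ≠ 0) (h : ∀ y, MorAt A id B id ξ y) :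
    ∃ i : Iso A B, ∀ y, (i.equiv y).toLinearMap = ξ y := by
  have hne : ∀ y (a : A.fiber y), a ≠ 0 → ξ y a ≠ 0 := by
    intro y a ha h
    exact h0 y (linearMap_ext ha (h.trans (LinearMap.zero_apply a).symm))
  have hbij : ∀ y, Function.Bijective (ξ y) := by
    intro y
    constructor
    · rw [injective_iff_map_eq_zero]
      intro a ha
      by_contra h
      exact hne y a h ha
    · intro b
      have ha := A.frame_ne_zero y y
      obtain ⟨c, rfl⟩ := B.exists_smul (hne y _ ha) b
      exact ⟨c • A.frame y y, map_smul _ _ _⟩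
  let e : ∀ y, A.fiber y ≃ₗ[ℂ] B.fiber y := fun y ↦ LinearEquiv.ofBijective (ξ y) (hbij y)
  have hfr : ∀ y, SecAt B id (fun z ↦ ξ z (A.frame y z)) y := fun y ↦
    h y _ (A.secAt_frame (f := id) continuousAt_id (A.mem_nbhd y))
  refine ⟨⟨e, continuous_iff_continuousAt.2 fun p ↦ ?_, continuous_iff_continuousAt.2 fun p ↦ ?_⟩,
    fun y ↦ rfl⟩
  · have hp : ContinuousAt (fun q : TotalSpace ℂ A.fiber ↦ q.1) p :=
      (FiberBundle.continuous_proj ℂ A.fiber).continuousAt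
    -- The parameter space is the total space itself; continuity on its tautological section `q ↦
    -- q.2` is continuity of the bundle map.
    exact morAt_of_frame (f := fun q : TotalSpace ℂ A.fiber ↦ q.1) (g := fun q ↦ q.1)
      (ξ := fun q ↦ ξ q.1) (a := fun q ↦ A.frame p.1 q.1)
      (A.secAt_frame (f := fun q : TotalSpace ℂ A.fiber ↦ q.1) hp (A.mem_nbhd _))
      (.of_forall fun q ↦ A.frame_ne_zero _ _)
      ((hfr p.1).comp (g := fun q : TotalSpace ℂ A.fiber ↦ q.1) hp) (fun q ↦ q.2) continuousAt_id
  · have hp : ContinuousAt (fun q : TotalSpace ℂ B.fiber ↦ q.1) p :=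
      (FiberBundle.continuous_proj ℂ B.fiber).continuousAt
    -- For the inverse, `B` is framed by the image of a frame of `A`, which the inverse carries back
    -- to that frame.
    refine morAt_of_frame (f := fun q : TotalSpace ℂ B.fiber ↦ q.1) (g := fun q ↦ q.1)
      (ξ := fun q ↦ (e q.1).symm.toLinearMap) (a := fun q ↦ ξ q.1 (A.frame p.1 q.1))
      ((hfr p.1).comp (g := fun q : TotalSpace ℂ B.fiber ↦ q.1) hp)
      (.of_forall fun q ↦ hne _ _ (A.frame_ne_zero _ _)) ?_ (fun q ↦ q.2) continuousAt_id
    refine (A.secAt_frame (f := fun q : TotalSpace ℂ B.fiber ↦ q.1) hp (A.mem_nbhd p.1)).congr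
      (.of_forall fun q ↦ ((e q.1).symm_apply_apply _).symm)

lemma Iso.morAt {A B : LineBundle.{u, v} Y} (i : Iso A B) (f : T → Y) (t₀ : T) :
    MorAt A f B f (fun t ↦ (i.equiv (f t)).toLinearMap) t₀ :=
  fun _ hs ↦ hs.iso i

end LineBundle

lemma continuousAt_clm {T : Type*} [TopologicalSpace T] {L : T → ℂ →L[ℂ] ℂ} {t₀ : T} :
    ContinuousAt L t₀ ↔ ContinuousAt (fun t ↦ L t 1) t₀ := by
  constructor
  · intro h
    exact h.clm_apply continuousAt_const
  · intro h
    have : L = fun t ↦ (L t 1) • ContinuousLinearMap.id ℂ ℂ := by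
      funext t
      ext
      simp
    rw [this]
    exact h.smul continuousAt_const

namespace HomSubspace

variable {Y : Type u} [TopologicalSpace Y] {A B : LineBundle.{u, v} Y}
  {P : ∀ y, (A.fiber y →ₗ[ℂ] B.fiber y) → Prop}

/-- The base point of a linear map between fibres. -/
def pt (q : HomSubspace A B P) : Y := HomSubspace.proj A B P q

/-- The underlying linear map. -/
def lin (q : HomSubspace A B P) : A.fiber q.pt →ₗ[ℂ] B.fiber q.pt := q.1.2.toLinearMap

lemma prop (q : HomSubspace A B P) : P q.pt q.lin := q.2

/-- The point of `HomSubspace` given by a linear map. -/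
def mk (y : Y) (ξ : A.fiber y →ₗ[ℂ] B.fiber y) (h : P y ξ) : HomSubspace A B P :=
  ⟨⟨y, toCLM ξ⟩, h⟩

/-- Continuity of maps to spaces of linear maps between the fibres of line bundles. -/
lemma continuousAt_iff {T : Type*} [TopologicalSpace T] {F : T → HomSubspace A B P} {t₀ : T} :
    ContinuousAt F t₀ ↔ ContinuousAt (fun t ↦ (F t).pt) t₀ ∧
      MorAt A (fun t ↦ (F t).pt) B (fun t ↦ (F t).pt) (fun t ↦ (F t).lin) t₀ := by
  have h1 : ContinuousAt F t₀ ↔ ContinuousAt (fun t ↦ (⟨(F t).pt, toCLM (F t).lin⟩ :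
      TotalSpace (ℂ →L[ℂ] ℂ) (fun y ↦ A.fiber y →L[ℂ] B.fiber y))) t₀ :=
    Topology.IsInducing.subtypeVal.continuousAt_iff
  rw [h1, continuousAt_hom_bundle]
  refine and_congr_right fun hf ↦ ?_
  rw [continuousAt_clm]
  -- In the charts at `F t₀` the `1 × 1` matrix of the linear map is the coordinate of the image of
  -- the frame.
  have key : (fun t ↦ (ContinuousLinearMap.inCoordinates ℂ A.fiber ℂ B.fiber (F t₀).pt
      (F t).pt (F t₀).pt (F t).pt (toCLM (F t).lin)) 1) =ᶠ[𝓝 t₀]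
      fun t ↦ B.coord (F t₀).pt (F t).pt ((F t).lin (A.frame (F t₀).pt (F t).pt)) := by
    filter_upwards [hf.eventually_mem ((A.isOpen_nbhd _).mem_nhds (A.mem_nbhd (F t₀).pt))] with t ht
    rw [LineBundle.frame, if_pos ht]
    rfl
  rw [continuousAt_congr key]
  have hfr := A.secAt_frame (f := fun t ↦ (F t).pt) hf (A.mem_nbhd (F t₀).pt)
  constructor
  · intro h
    exact morAt_of_frame hfr (.of_forall fun t ↦ A.frame_ne_zero _ _) (secAt_iff.2 ⟨hf, h⟩)
  · intro h
    exact (secAt_iff.1 (h _ hfr)).2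

end HomSubspace

end Sections

section RootCovers

open Bundle LineBundle Filter

/-! ### Double covers of square roots -/

/-- Near `y₀` the quotient `u y / u y₀` stays in the slit plane, where `exp (log / 2)` is a
continuous square root; `v₀` restores the constant. -/
lemma exists_local_sqrt {Y : Type*} [TopologicalSpace Y] {U : Set Y} (hU : IsOpen U) {y₀ : Y}
    (hy₀ : y₀ ∈ U) {u : Y → ℂ} (hu : ∀ y ∈ U, ContinuousAt u y) (h0 : u y₀ ≠ 0) :
    ∃ V ⊆ U, IsOpen V ∧ y₀ ∈ V ∧ ∃ v : Y → ℂ, ∀ y ∈ V, v y ^ 2 = u y ∧ ContinuousAt v y := by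
  obtain ⟨v₀, hv₀⟩ := IsAlgClosed.exists_pow_nat_eq (u y₀) (n := 2) (by norm_num)
  have hq : ContinuousOn (fun y ↦ u y / u y₀) U := fun y hy ↦
    ((hu y hy).div_const _).continuousWithinAt
  refine ⟨U ∩ (fun y ↦ u y / u y₀) ⁻¹' Complex.slitPlane, Set.inter_subset_left,
    hq.isOpen_inter_preimage hU Complex.isOpen_slitPlane, ⟨hy₀, ?_⟩,
    fun y ↦ Complex.exp (Complex.log (u y / u y₀) / 2) * v₀, fun y hy ↦ ⟨?_, ?_⟩⟩
  · simp [div_self h0]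
  · rw [mul_pow, hv₀, ← Complex.exp_nat_mul]
    have : ((2 : ℕ) : ℂ) * (Complex.log (u y / u y₀) / 2) = Complex.log (u y / u y₀) := by
      push_cast
      ring
    rw [this, Complex.exp_log (Complex.slitPlane_ne_zero hy.2), div_mul_cancel₀ _ h0]
  · have h1 : ContinuousAt (fun y ↦ Complex.log (u y / u y₀)) y :=
      ((hu y hy.1).div_const _).clog hy.2
    exact ((h1.div_const 2).cexp).mul continuousAt_const

/-- The condition `P` on linear maps `ξ : A_y → B_y` has the form `ξ ⊗ ξ = θ`
for an isomorphism `θ`. -/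
def IsRootCondition {Y : Type u} [TopologicalSpace Y] (A B : LineBundle.{u, v} Y)
    (P : ∀ y, (A.fiber y →ₗ[ℂ] B.fiber y) → Prop) : Prop :=
  ∀ y₀, ∃ U : Set Y, IsOpen U ∧ y₀ ∈ U ∧ ∃ (a : ∀ y, A.fiber y) (b : ∀ y, B.fiber y) (u : Y → ℂ),
    ∀ y ∈ U, a y ≠ 0 ∧ b y ≠ 0 ∧ u y ≠ 0 ∧ SecAt A id a y ∧ SecAt B id b y ∧ ContinuousAt u y ∧
      ∀ ξ, P y ξ ↔ ∃ w : ℂ, w ^ 2 = u y ∧ ξ (a y) = w • b y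

namespace IsRootCondition

variable {Y : Type u} [TopologicalSpace Y] {A B : LineBundle.{u, v} Y}
    {P : ∀ y, (A.fiber y →ₗ[ℂ] B.fiber y) → Prop} (hP : IsRootCondition A B P)

include hP

lemma neg_mem {y : Y} {ξ : A.fiber y →ₗ[ℂ] B.fiber y} (h : P y ξ) : P y (-ξ) := by
  obtain ⟨U, -, hy, a, b, u, H⟩ := hP y
  obtain ⟨-, -, -, -, -, -, H⟩ := H y hy
  obtain ⟨w, hw, hw'⟩ := (H ξ).1 h
  exact (H _).2 ⟨-w, by rw [neg_sq, hw], by rw [LinearMap.neg_apply, hw', neg_smul]⟩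

lemma ne_zero {y : Y} {ξ : A.fiber y →ₗ[ℂ] B.fiber y} (h : P y ξ) : ξ ≠ 0 := by
  obtain ⟨U, -, hy, a, b, u, H⟩ := hP y
  obtain ⟨ha, hb, hu, -, -, -, H⟩ := H y hy
  obtain ⟨w, hw, hw'⟩ := (H ξ).1 h
  rintro rfl
  have hw0 : w ≠ 0 := by
    rintro rfl
    exact hu (by rw [← hw]; norm_num)
  exact smul_ne_zero hw0 hb hw'.symm

lemma eq_or_neg {y : Y} {ξ ξ' : A.fiber y →ₗ[ℂ] B.fiber y} (h : P y ξ) (h' : P y ξ') :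
    ξ' = ξ ∨ ξ' = -ξ := by
  obtain ⟨U, -, hy, a, b, u, H⟩ := hP y
  obtain ⟨ha, -, -, -, -, -, H⟩ := H y hy
  obtain ⟨w, hw, hwξ⟩ := (H ξ).1 h
  obtain ⟨w', hw', hwξ'⟩ := (H ξ').1 h'
  rcases sq_eq_sq_iff_eq_or_eq_neg.1 (hw'.trans hw.symm) with rfl | rfl
  · exact Or.inl (linearMap_ext ha (hwξ'.trans hwξ.symm))
  · exact Or.inr (linearMap_ext ha (by rw [hwξ', LinearMap.neg_apply, hwξ, neg_smul]))

lemma exists_mem (y : Y) : ∃ ξ, P y ξ := by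
  obtain ⟨U, -, hy, a, b, u, H⟩ := hP y
  obtain ⟨ha, -, -, -, -, -, H⟩ := H y hy
  obtain ⟨w, hw⟩ := IsAlgClosed.exists_pow_nat_eq (u y) (n := 2) (by norm_num)
  obtain ⟨ξ, hξ⟩ := exists_linearMap A B ha (w • b y)
  exact ⟨ξ, (H ξ).2 ⟨w, hw, hξ⟩⟩

/-- The deck transformation. -/
def neg (q : HomSubspace A B P) : HomSubspace A B P :=
  HomSubspace.mk q.pt (-q.lin) (hP.neg_mem q.prop)

omit hP in
lemma continuous_pt : Continuous (HomSubspace.pt : HomSubspace A B P → Y) :=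
  continuous_iff_continuousAt.2 fun _ ↦
    (HomSubspace.continuousAt_iff (F := fun q : HomSubspace A B P ↦ q).1 continuousAt_id).1

omit hP in
lemma morAt_lin (q₀ : HomSubspace A B P) :
    MorAt A (fun q : HomSubspace A B P ↦ q.pt) B (fun q ↦ q.pt) (fun q ↦ q.lin) q₀ :=
  (HomSubspace.continuousAt_iff (F := fun q : HomSubspace A B P ↦ q).1 continuousAt_id).2

lemma continuous_neg : Continuous hP.neg := by
  refine continuous_iff_continuousAt.2 fun q ↦ HomSubspace.continuousAt_iff.2
    ⟨continuous_pt.continuousAt, fun s hs ↦ ?_⟩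
  have := (morAt_lin q s hs).smul (continuousAt_const (y := (-1 : ℂ)))
  refine this.congr (.of_forall fun t ↦ ?_)
  rw [neg_smul, one_smul]
  rfl

lemma eq_or (q q' : HomSubspace A B P) (h : q'.pt = q.pt) : q' = q ∨ q' = hP.neg q := by
  obtain ⟨⟨y, ξ⟩, hq⟩ := q
  obtain ⟨⟨y', ξ'⟩, hq'⟩ := q'
  obtain rfl : y' = y := h
  rcases hP.eq_or_neg hq hq' with h | h
  · left
    have : ξ' = ξ := ContinuousLinearMap.coe_injective h
    subst this
    rfl
  · right
    have : ξ' = toCLM (-ξ.toLinearMap) := ContinuousLinearMap.coe_injective h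
    subst this
    rfl

lemma neg_ne (q : HomSubspace A B P) : hP.neg q ≠ q := by
  intro h
  -- An equality of points is turned into one of linear maps on a fibre; the conclusion `-ξ = ξ`
  -- then contradicts `ξ ≠ 0`.
  have h1 : ∀ q' : HomSubspace A B P, q' = q → ∀ h : q'.pt = q.pt, ∀ a,
      q'.lin (h ▸ a) = h ▸ q.lin a := by
    rintro _ rfl _ a
    rfl
  have h2 : ∀ a, (-q.lin) a = q.lin a := fun a ↦ h1 _ h rfl a
  refine hP.ne_zero q.prop (LinearMap.ext fun a ↦ ?_)
  have := h2 a
  rw [LinearMap.neg_apply, neg_eq_iff_add_eq_zero, ← two_smul ℂ] at this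
  simpa using this

/-- The space of square roots is a double cover. -/
lemma isDoubleCover : IsDoubleCover (HomSubspace.proj A B P) hP.neg where
  surj y := by
    obtain ⟨ξ, hξ⟩ := hP.exists_mem y
    exact ⟨HomSubspace.mk y ξ hξ, rfl⟩
  continuous_neg := hP.continuous_neg
  proj_neg _ := rfl
  neg_ne := hP.neg_ne
  eq_or := hP.eq_or
  cov := by
    intro y₀
    obtain ⟨U, hU, hy₀, a, b, u, H⟩ := hP y₀
    obtain ⟨V, hVU, hV, hyV, w, hw⟩ := exists_local_sqrt hU hy₀ (fun y hy ↦ (H y hy).2.2.2.2.2.1)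
      (H y₀ hy₀).2.2.1
    choose ξ hξ using fun y : V ↦ exists_linearMap A B (H y (hVU y.2)).1 (w y • b y)
    have hξP : ∀ y : V, P y (ξ y) := fun y ↦
      ((H y (hVU y.2)).2.2.2.2.2.2 _).2 ⟨w y, (hw y y.2).1, hξ y⟩
    have hw0 : ∀ y ∈ V, w y ≠ 0 := fun y hy h ↦ (H y (hVU hy)).2.2.1 (by
      rw [← (hw y hy).1, h]
      norm_num)
    -- The local sheet: `ξ y` maps the frame `a` to `w • b` for the continuous square root `w` of
    -- `u`.
    let σ : V → HomSubspace A B P := fun y ↦ HomSubspace.mk y (ξ y) (hξP y)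
    have hσ : Continuous σ := by
      refine continuous_iff_continuousAt.2 fun y ↦ HomSubspace.continuousAt_iff.2
        ⟨continuous_subtype_val.continuousAt, ?_⟩
      obtain ⟨ha, hb, hu, hsa, hsb, huc, HP⟩ := H y (hVU y.2)
      refine morAt_of_frame (f := fun y : V ↦ y.1) (a := fun y ↦ a y)
        (hsa.comp (g := fun y : V ↦ y.1) continuous_subtype_val.continuousAt)
        (.of_forall fun y ↦ (H y (hVU y.2)).1) ?_
      refine SecAt.congr (s := fun y : V ↦ w y • b y) ?_ (.of_forall fun y ↦ (hξ y).symm)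
      exact (hsb.comp (g := fun y : V ↦ y.1) continuous_subtype_val.continuousAt).smul
        ((hw y y.2).2.comp continuous_subtype_val.continuousAt)
    let W : Set (HomSubspace A B P) := HomSubspace.proj A B P ⁻¹' V
    have hW : IsOpen W := hV.preimage continuous_pt
    -- The ratio of an arbitrary point over `V` to the point of the sheet `σ`. It is continuous with
    -- square `1`, so it tells the two sheets apart.
    have hκ : ∀ q : W, ∃ c : ℂ, q.1.lin (a q.1.pt) = c • w q.1.pt • b q.1.pt ∧ c ^ 2 = 1 := by
      intro q
      obtain ⟨ha, hb, hu, hsa, hsb, huc, HP⟩ := H q.1.pt (hVU q.2)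
      obtain ⟨w', hw', hwq⟩ := (HP _).1 q.1.prop
      have h0 := hw0 q.1.pt q.2
      refine ⟨w' / w q.1.pt, ?_, ?_⟩
      · rw [smul_smul, div_mul_cancel₀ _ h0, hwq]
      · have := (hw _ q.2).1
        change w q.1.pt ^ 2 = u q.1.pt at this
        rw [div_pow, hw', this, div_self hu]
    choose κ hκ hκ1 using hκ
    have hκc : Continuous κ := by
      refine continuous_iff_continuousAt.2 fun q ↦ ?_
      obtain ⟨ha, hb, hu, hsa, hsb, huc, HP⟩ := H q.1.pt (hVU q.2)
      have hpt : ContinuousAt (fun q : W ↦ q.1.pt) q :=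
        (continuous_pt.comp continuous_subtype_val).continuousAt
      refine SecAt.coeff (f := fun q : W ↦ q.1.pt) (s := fun q ↦ w q.1.pt • b q.1.pt)
        ((hsb.comp (g := fun q : W ↦ q.1.pt) hpt).smul
          (ContinuousAt.comp (f := fun q : W ↦ q.1.pt) (hw _ q.2).2 hpt))
        (s' := fun q ↦ q.1.lin (a q.1.pt)) ?_ (smul_ne_zero (hw0 _ q.2) hb) (.of_forall hκ)
      exact (HomSubspace.continuousAt_iff (F := fun q : W ↦ q.1) (t₀ := q)|>.1
        continuous_subtype_val.continuousAt).2
        _ (hsa.comp (g := fun q : W ↦ q.1.pt) hpt)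
    have hκu : ∀ (q : W) (c : ℂ), q.1.lin (a q.1.pt) = c • w q.1.pt • b q.1.pt → κ q = c := by
      intro q c hc
      have := (hκ q).symm.trans hc
      exact smul_left_injective ℂ (smul_ne_zero (hw0 _ q.2) (H q.1.pt (hVU q.2)).2.1) this
    have hκσ : ∀ y : V, κ ⟨σ y, y.2⟩ = 1 := fun y ↦ hκu _ _ (by
      rw [one_smul]
      exact hξ y)
    have hκn : ∀ y : V, κ ⟨hP.neg (σ y), y.2⟩ = -1 := fun y ↦ hκu _ _ (by
      rw [neg_smul, one_smul]
      exact congrArg Neg.neg (hξ y))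
    have h11 : (-1 : ℂ) ≠ 1 := by norm_num
    -- Both sheets are closed as level sets of `κ` and complementary, so the Boolean coordinate
    -- below is continuous.
    have hcl : IsClopen {q | κ q = 1} := by
      refine ⟨isClosed_eq hκc continuous_const, ?_⟩
      have : {q | κ q = 1} = {q | κ q = -1}ᶜ := by
        ext q
        change κ q = 1 ↔ ¬ κ q = -1
        rcases sq_eq_one_iff.1 (hκ1 q) with h | h
        · simp [h, h11.symm]
        · simp [h, h11]
      rw [this]
      exact (isClosed_eq hκc continuous_const).isOpen_compl
    classical
    have hev : IsEvenlyCovered (HomSubspace.proj A B P) y₀ Bool := by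
      refine ⟨inferInstance, V, hyV, hV, hW, ⟨⟨fun q ↦ (⟨q.1.pt, q.2⟩, decide (κ q = 1)),
        fun x ↦ ⟨if x.2 then σ x.1 else hP.neg (σ x.1), ?_⟩, ?_, ?_⟩, ?_, ?_⟩, fun x ↦ rfl⟩
      · rcases x with ⟨y, _ | _⟩
        · exact y.2
        · exact y.2
      · intro q
        apply Subtype.ext
        rcases hP.eq_or (σ ⟨q.1.pt, q.2⟩) q.1 rfl with h | h
        · have h1 : κ q = 1 := by
            rw [← hκσ ⟨q.1.pt, q.2⟩]
            exact congrArg κ (Subtype.ext h)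
          simp only [h1, decide_true, if_true]
          exact h.symm
        · have h1 : κ q = -1 := by
            rw [← hκn ⟨q.1.pt, q.2⟩]
            exact congrArg κ (Subtype.ext h)
          simp only [h1, h11, decide_false]
          exact h.symm
      · rintro ⟨y, _ | _⟩
        · refine Prod.ext rfl ?_
          simp only [Bool.false_eq_true, if_false]
          rw [decide_eq_false_iff_not]
          intro h
          exact h11 ((hκn y).symm.trans h)
        · refine Prod.ext rfl ?_
          simp only [if_true]
          rw [decide_eq_true_iff]
          exact hκσ y
      · refine Continuous.prodMk (Continuous.subtype_mk
          (continuous_pt.comp continuous_subtype_val) _) ((continuous_bool_rng true).2 ?_)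
        convert hcl using 1
        ext q
        exact decide_eq_true_iff
      · refine Continuous.subtype_mk (continuous_prod_of_discrete_right.2 fun k ↦ ?_) _
        rcases k with _ | _
        · exact hP.continuous_neg.comp hσ
        · exact hσ
    exact hev.to_isEvenlyCovered_preimage

end IsRootCondition

end RootCovers

/-! ### The covers `P₁₂` and `Q_J` are double covers. -/

section ConcreteCovers

open Bundle LineBundle Filter

variable {X : Type u} [TopologicalSpace X]

namespace LineBundle

lemma tmul_smul_smul {A B : LineBundle.{u, v} X} {x : X} (c d : ℂ) (a : A.fiber x)
    (b : B.fiber x) : tmul (c • a) (d • b) = (c * d) • tmul a b :=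
  TensorProduct.smul_tmul_smul c d a b

end LineBundle

/-- In local frames the condition reads `c ^ 2 • l = k` in a line, so the function to be rooted is
`u = k / l`. This is the criterion applied to each cover. -/
lemma IsRootCondition.of_square {Y : Type u} [TopologicalSpace Y] {A B C : LineBundle.{u, v} Y}
    {P : ∀ y, (A.fiber y →ₗ[ℂ] B.fiber y) → Prop}
    (h : ∀ y₀, ∃ (a : ∀ y, A.fiber y) (b : ∀ y, B.fiber y) (k l : ∀ y, C.fiber y),
      ∀ᶠ y in 𝓝 y₀, (a y ≠ 0 ∧ b y ≠ 0 ∧ k y ≠ 0 ∧ l y ≠ 0) ∧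
        (SecAt A id a y ∧ SecAt B id b y ∧ SecAt C id k y ∧ SecAt C id l y) ∧
        ∀ (ξ : A.fiber y →ₗ[ℂ] B.fiber y) (c : ℂ), ξ (a y) = c • b y → (P y ξ ↔ c ^ 2 • l y = k y)) :
    IsRootCondition A B P := by
  intro y₀
  obtain ⟨a, b, k, l, h⟩ := h y₀
  obtain ⟨U, hU, hU', hy₀⟩ := mem_nhds_iff.1 h
  have hu : ∀ y, ∃ u : ℂ, l y ≠ 0 → k y = u • l y := by
    intro y
    by_cases hl : l y = 0
    · exact ⟨0, fun h ↦ absurd hl h⟩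
    · obtain ⟨u, hu⟩ := C.exists_smul hl (k y)
      exact ⟨u, fun _ ↦ hu⟩
  choose u hu using hu
  refine ⟨U, hU', hy₀, a, b, u, fun y hy ↦ ?_⟩
  obtain ⟨⟨ha, hb, hk, hl⟩, ⟨sa, sb, sk, sl⟩, hP⟩ := hU hy
  refine ⟨ha, hb, ?_, sa, sb, ?_, fun ξ ↦ ?_⟩
  · intro h0
    apply hk
    rw [hu y hl, h0, zero_smul]
  · refine sl.coeff sk hl ?_
    filter_upwards [hU'.mem_nhds hy] with z hz
    obtain ⟨⟨-, -, -, hl⟩, -⟩ := hU hz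
    exact hu z hl
  · obtain ⟨c, hc⟩ := B.exists_smul hb (ξ (a y))
    rw [hP ξ c hc, hu y hl]
    constructor
    · intro h
      exact ⟨c, smul_left_injective ℂ hl h, hc⟩
    · rintro ⟨c', hc', h⟩
      have : c' = c := smul_left_injective ℂ hb (h.symm.trans hc)
      rw [← this, hc']

namespace RootPair

variable {K : LineBundle.{u, v} X}

/-- The square of an element of a square root. -/
def sq (r : RootPair K) {x : X} (a : r.J.fiber x) : K.fiber x := r.j.equiv x (tmul a a)

lemma j_smul (r : RootPair K) {x : X} (c d : ℂ) (a b : r.J.fiber x) :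
    r.j.equiv x (tmul (c • a) (d • b)) = (c * d) • r.j.equiv x (tmul a b) := by
  rw [tmul_smul_smul, map_smul]

lemma sq_smul (r : RootPair K) {x : X} (c : ℂ) (a : r.J.fiber x) :
    r.sq (c • a) = c ^ 2 • r.sq a := by
  rw [sq, j_smul, ← pow_two]
  rfl

lemma sq_ne_zero (r : RootPair K) {x : X} {a : r.J.fiber x} (ha : a ≠ 0) : r.sq a ≠ 0 := by
  intro h
  exact tmul_ne_zero ha ha ((r.j.equiv x).injective (h.trans (map_zero _).symm))

lemma secAt_sq (r : RootPair K) {T : Type*} [TopologicalSpace T] {f : T → X}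
    {a : ∀ t, r.J.fiber (f t)} {t₀ : T} (h : SecAt r.J f a t₀) :
    SecAt K f (fun t ↦ r.sq (a t)) t₀ := (h.tmul h).iso r.j

end RootPair

/-- The fibres are lines and both sides are bilinear, so the square of one nonzero vector decides.
-/
lemma isRootIsometry_iff {K : LineBundle.{u, v} X} (r₁ r₂ : RootPair K) {x : X}
    {a : r₂.J.fiber x} (ha : a ≠ 0) (ξ : r₂.J.fiber x →ₗ[ℂ] r₁.J.fiber x) :
    IsRootIsometry r₁ r₂ x ξ ↔ r₁.sq (ξ a) = r₂.sq a := by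
  constructor
  · intro h
    exact h a a
  · intro h b b'
    obtain ⟨c, rfl⟩ := r₂.J.exists_smul ha b
    obtain ⟨c', rfl⟩ := r₂.J.exists_smul ha b'
    rw [map_smul, map_smul, RootPair.j_smul, RootPair.j_smul]
    exact congrArg _ h

lemma isRootCondition_isometry {K : LineBundle.{u, v} X} (r₁ r₂ : RootPair K) :
    IsRootCondition r₂.J r₁.J (IsRootIsometry r₁ r₂) := by
  refine IsRootCondition.of_square (C := K) fun x₀ ↦ ⟨r₂.J.frame x₀, r₁.J.frame x₀,
    fun x ↦ r₂.sq (r₂.J.frame x₀ x), fun x ↦ r₁.sq (r₁.J.frame x₀ x), ?_⟩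
  filter_upwards [(r₂.J.isOpen_nbhd x₀).mem_nhds (r₂.J.mem_nbhd x₀),
    (r₁.J.isOpen_nbhd x₀).mem_nhds (r₁.J.mem_nbhd x₀)] with x h₂ h₁
  have s₁ := r₁.J.secAt_frame (f := id) continuousAt_id h₁
  have s₂ := r₂.J.secAt_frame (f := id) continuousAt_id h₂
  have n₁ := r₁.J.frame_ne_zero x₀ x
  have n₂ := r₂.J.frame_ne_zero x₀ x
  refine ⟨⟨n₂, n₁, r₂.sq_ne_zero n₂, r₁.sq_ne_zero n₁⟩,
    ⟨s₂, s₁, r₂.secAt_sq s₂, r₁.secAt_sq s₁⟩, fun ξ c hc ↦ ?_⟩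
  rw [isRootIsometry_iff r₁ r₂ n₂, hc, RootPair.sq_smul]

section Compatible

variable {m : C(X × X, X)} {L : LineBundle.{u, v} (X × X)}

lemma PhiIso.app_smul (φ : PhiIso m L) {x y : X} (c d e e' : ℂ) (k : (diagBundle L).fiber x)
    (k' : (diagBundle L).fiber y) (l l' : L.fiber (x, y)) :
    φ.app (c • k) (d • k') (e • l) (e' • l') = (c * d * (e * e')) • φ.app k k' l l' := by
  refine Eq.trans (congrArg (φ.equiv (x, y)) ?_) (map_smul (φ.equiv (x, y)) _ _)
  refine Eq.trans ?_ (tmul_smul_smul (A := ((diagBundle L).pullback pr1).tensor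
    ((diagBundle L).pullback pr2)) (B := L.tensor L) (x := (x, y)) _ _ _ _)
  exact congrArg₂ tmul (tmul_smul_smul (A := (diagBundle L).pullback pr1)
    (B := (diagBundle L).pullback pr2) (x := (x, y)) _ _ _ _) (tmul_smul_smul _ _ _ _)

lemma PhiIso.app_ne_zero (φ : PhiIso m L) {x y : X} {k : (diagBundle L).fiber x}
    {k' : (diagBundle L).fiber y} {l l' : L.fiber (x, y)} (h : k ≠ 0) (h' : k' ≠ 0) (hl : l ≠ 0)
    (hl' : l' ≠ 0) : φ.app k k' l l' ≠ 0 := by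
  intro h0
  refine tmul_ne_zero (tmul_ne_zero (A := (diagBundle L).pullback pr1)
    (B := (diagBundle L).pullback pr2) (y := (x, y)) h h') (tmul_ne_zero hl hl') ?_
  exact (φ.equiv (x, y)).injective (h0.trans (map_zero _).symm)

lemma PhiIso.secAt_app (φ : PhiIso m L) {T : Type*} [TopologicalSpace T] {f g : T → X}
    {k : ∀ t, (diagBundle L).fiber (f t)} {k' : ∀ t, (diagBundle L).fiber (g t)}
    {l l' : ∀ t, L.fiber (f t, g t)} {t₀ : T} (h : SecAt (diagBundle L) f k t₀)
    (h' : SecAt (diagBundle L) g k' t₀) (hl : SecAt L (fun t ↦ (f t, g t)) l t₀)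
    (hl' : SecAt L (fun t ↦ (f t, g t)) l' t₀) :
    SecAt (diagBundle L) (fun t ↦ m (f t, g t))
      (fun t ↦ φ.app (k t) (k' t) (l t) (l' t)) t₀ := by
  have hfg : ContinuousAt (fun t ↦ (f t, g t)) t₀ := h.base.prodMk h'.base
  have h1 : SecAt ((diagBundle L).pullback pr1) (fun t ↦ (f t, g t)) k t₀ := h.pullback hfg
  have h2 : SecAt ((diagBundle L).pullback pr2) (fun t ↦ (f t, g t)) k' t₀ := h'.pullback hfg
  exact (secAt_pullback.1 (((h1.tmul h2).tmul (hl.tmul hl')).iso φ)).2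

/-- The element `a ⊗ b ⊗ l`. -/
def rootElem {J : LineBundle.{u, v} X} {p : X × X} (a : J.fiber p.1) (b : J.fiber p.2)
    (l : L.fiber p) : (rootSource L J).fiber p :=
  tmul (tmul (A := J.pullback pr1) (B := J.pullback pr2) a b) l

lemma rootElem_smul {J : LineBundle.{u, v} X} {p : X × X} (c d e : ℂ) (a : J.fiber p.1)
    (b : J.fiber p.2) (l : L.fiber p) :
    rootElem (c • a) (d • b) (e • l) = (c * d * e) • rootElem a b l :=
  (congrArg (fun t ↦ tmul t (e • l)) (tmul_smul_smul (A := J.pullback pr1)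
    (B := J.pullback pr2) _ _ _ _)).trans (tmul_smul_smul _ _ _ _)

lemma rootElem_ne_zero {J : LineBundle.{u, v} X} {p : X × X} {a : J.fiber p.1} {b : J.fiber p.2}
    {l : L.fiber p} (ha : a ≠ 0) (hb : b ≠ 0) (hl : l ≠ 0) : rootElem a b l ≠ 0 :=
  tmul_ne_zero (tmul_ne_zero (A := J.pullback pr1) (B := J.pullback pr2) ha hb) hl

lemma secAt_rootElem {J : LineBundle.{u, v} X} {T : Type*} [TopologicalSpace T] {f : T → X × X}
    {a : ∀ t, J.fiber (f t).1} {b : ∀ t, J.fiber (f t).2} {l : ∀ t, L.fiber (f t)} {t₀ : T}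
    (ha : SecAt J (fun t ↦ (f t).1) a t₀) (hb : SecAt J (fun t ↦ (f t).2) b t₀)
    (hl : SecAt L f l t₀) :
    SecAt (rootSource L J) f (fun t ↦ rootElem (a t) (b t) (l t)) t₀ := by
  have h1 : SecAt (J.pullback pr1) f a t₀ := ha.pullback hl.base
  have h2 : SecAt (J.pullback pr2) f b t₀ := hb.pullback hl.base
  exact (h1.tmul h2).tmul hl

/-- Again one nonzero vector in each of the three lines suffices, by homogeneity; the scalars on the
two sides agree up to reordering. -/
lemma squaresTo_iff (φ : PhiIso m L) (r : RootPair (diagBundle L)) {p : X × X}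
    {a : r.J.fiber p.1} {b : r.J.fiber p.2} {l : L.fiber p} (ha : a ≠ 0) (hb : b ≠ 0)
    (hl : l ≠ 0) (ξ : (rootSource L r.J).fiber p →ₗ[ℂ] (r.J.pullback m).fiber p) :
    SquaresTo φ r p ξ ↔ r.sq (x := m p) (ξ (rootElem a b l)) = φ.app (r.sq a) (r.sq b) l l := by
  constructor
  · intro h
    exact h a a b b l l
  · intro h a₁ a₂ b₁ b₂ l₁ l₂
    obtain ⟨c₁, rfl⟩ := r.J.exists_smul ha a₁
    obtain ⟨c₂, rfl⟩ := r.J.exists_smul ha a₂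
    obtain ⟨d₁, rfl⟩ := r.J.exists_smul hb b₁
    obtain ⟨d₂, rfl⟩ := r.J.exists_smul hb b₂
    obtain ⟨e₁, rfl⟩ := L.exists_smul hl l₁
    obtain ⟨e₂, rfl⟩ := L.exists_smul hl l₂
    have h1 : ∀ c d e : ℂ, ξ (rootElem (c • a) (d • b) (e • l)) =
        (c * d * e) • ξ (rootElem a b l) := fun c d e ↦ by rw [rootElem_smul, map_smul]
    have h2 := (congrArg₂ (fun s t ↦ r.j.equiv (m p) (tmul (A := r.J) (B := r.J) s t))
      (h1 c₁ d₁ e₁) (h1 c₂ d₂ e₂)).trans (r.j_smul _ _ _ _)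
    refine h2.trans ?_
    rw [r.j_smul, r.j_smul, φ.app_smul]
    refine Eq.trans (congrArg _ h) ?_
    refine congrArg (fun c : ℂ ↦ c • φ.app (r.sq a) (r.sq b) l l) ?_
    ring

lemma isRootCondition_squaresTo (φ : PhiIso m L) (r : RootPair (diagBundle L)) :
    IsRootCondition (rootSource L r.J) (r.J.pullback m) (SquaresTo φ r) := by
  refine IsRootCondition.of_square (C := (diagBundle L).pullback m) fun p₀ ↦
    ⟨fun p ↦ rootElem (r.J.frame p₀.1 p.1) (r.J.frame p₀.2 p.2) (L.frame p₀ p),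
      fun p ↦ r.J.frame (m p₀) (m p), fun p ↦ φ.app (r.sq (r.J.frame p₀.1 p.1))
        (r.sq (r.J.frame p₀.2 p.2)) (L.frame p₀ p) (L.frame p₀ p),
      fun p ↦ r.sq (r.J.frame (m p₀) (m p)), ?_⟩
  filter_upwards [continuousAt_fst.eventually_mem
      ((r.J.isOpen_nbhd p₀.1).mem_nhds (r.J.mem_nbhd p₀.1)),
    continuousAt_snd.eventually_mem ((r.J.isOpen_nbhd p₀.2).mem_nhds (r.J.mem_nbhd p₀.2)),
    (L.isOpen_nbhd p₀).mem_nhds (L.mem_nbhd p₀),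
    m.continuous.continuousAt.eventually_mem
      ((r.J.isOpen_nbhd (m p₀)).mem_nhds (r.J.mem_nbhd (m p₀)))] with p h₁ h₂ h₃ h₄
  have s₁ := r.J.secAt_frame (f := fun q : X × X ↦ q.1) continuousAt_fst h₁
  have s₂ := r.J.secAt_frame (f := fun q : X × X ↦ q.2) continuousAt_snd h₂
  have s₃ := L.secAt_frame (f := id) continuousAt_id h₃
  have s₄ := r.J.secAt_frame (f := m) m.continuous.continuousAt h₄
  have n₁ := r.J.frame_ne_zero p₀.1 p.1
  have n₂ := r.J.frame_ne_zero p₀.2 p.2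
  have n₃ := L.frame_ne_zero p₀ p
  have n₄ := r.J.frame_ne_zero (m p₀) (m p)
  refine ⟨⟨rootElem_ne_zero n₁ n₂ n₃, n₄, φ.app_ne_zero (r.sq_ne_zero n₁) (r.sq_ne_zero n₂) n₃ n₃,
    r.sq_ne_zero n₄⟩, ⟨secAt_rootElem s₁ s₂ s₃, s₄.pullback continuousAt_id,
    SecAt.pullback (φ.secAt_app (r.secAt_sq s₁) (r.secAt_sq s₂) s₃ s₃) continuousAt_id,
    SecAt.pullback (r.secAt_sq s₄) continuousAt_id⟩, fun ξ c hc ↦ ?_⟩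
  rw [squaresTo_iff φ r n₁ n₂ n₃, hc]
  exact iff_of_eq (congrArg (· = _) (r.sq_smul _ _))

end Compatible

end ConcreteCovers

/-! ### The cover of `[0, 1] × X³` that joins the two bracketings. -/

section AssociativityCover

open Bundle LineBundle Filter

namespace LineBundle

variable {Z : Type u} [TopologicalSpace Z] {A₁ A₂ A₃ B₁ B₂ B₃ : LineBundle.{u, v} Z}

/-- The tensor product of six line bundles. -/
abbrev tensorSix (A₁ A₂ A₃ B₁ B₂ B₃ : LineBundle.{u, v} Z) : LineBundle.{u, v} Z :=
  ((((A₁.tensor A₂).tensor A₃).tensor B₁).tensor B₂).tensor B₃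

/-- The tensor product of six elements. -/
def tmulSix {z : Z} (a₁ : A₁.fiber z) (a₂ : A₂.fiber z) (a₃ : A₃.fiber z) (b₁ : B₁.fiber z)
    (b₂ : B₂.fiber z) (b₃ : B₃.fiber z) : (tensorSix A₁ A₂ A₃ B₁ B₂ B₃).fiber z :=
  tmul (tmul (tmul (tmul (tmul a₁ a₂) a₃) b₁) b₂) b₃

lemma tmulSix_smul {z : Z} (c₁ c₂ c₃ d₁ d₂ d₃ : ℂ) (a₁ : A₁.fiber z) (a₂ : A₂.fiber z)
    (a₃ : A₃.fiber z) (b₁ : B₁.fiber z) (b₂ : B₂.fiber z) (b₃ : B₃.fiber z) :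
    tmulSix (c₁ • a₁) (c₂ • a₂) (c₃ • a₃) (d₁ • b₁) (d₂ • b₂) (d₃ • b₃) =
      (c₁ * c₂ * c₃ * d₁ * d₂ * d₃) • tmulSix a₁ a₂ a₃ b₁ b₂ b₃ := by
  unfold tmulSix
  rw [tmul_smul_smul, tmul_smul_smul, tmul_smul_smul, tmul_smul_smul, tmul_smul_smul]

lemma tmulSix_congr {z : Z} (a₁ : A₁.fiber z) (a₂ : A₂.fiber z) (a₃ : A₃.fiber z)
    {b₁ b₁' : B₁.fiber z} {b₂ b₂' : B₂.fiber z} {b₃ b₃' : B₃.fiber z} (h₁ : b₁ = b₁')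
    (h₂ : b₂ = b₂') (h₃ : b₃ = b₃') :
    tmulSix a₁ a₂ a₃ b₁ b₂ b₃ = tmulSix a₁ a₂ a₃ b₁' b₂' b₃' := by
  rw [h₁, h₂, h₃]

lemma tmulSix_ne_zero {z : Z} {a₁ : A₁.fiber z} {a₂ : A₂.fiber z} {a₃ : A₃.fiber z}
    {b₁ : B₁.fiber z} {b₂ : B₂.fiber z} {b₃ : B₃.fiber z} (h₁ : a₁ ≠ 0) (h₂ : a₂ ≠ 0)
    (h₃ : a₃ ≠ 0) (k₁ : b₁ ≠ 0) (k₂ : b₂ ≠ 0) (k₃ : b₃ ≠ 0) :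
    tmulSix a₁ a₂ a₃ b₁ b₂ b₃ ≠ 0 :=
  tmul_ne_zero (tmul_ne_zero (tmul_ne_zero (tmul_ne_zero (tmul_ne_zero h₁ h₂) h₃) k₁) k₂) k₃

lemma SecAt.tmulSix {T : Type*} [TopologicalSpace T] {f : T → Z} {t₀ : T}
    {a₁ : ∀ t, A₁.fiber (f t)} {a₂ : ∀ t, A₂.fiber (f t)} {a₃ : ∀ t, A₃.fiber (f t)}
    {b₁ : ∀ t, B₁.fiber (f t)} {b₂ : ∀ t, B₂.fiber (f t)} {b₃ : ∀ t, B₃.fiber (f t)}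
    (h₁ : SecAt A₁ f a₁ t₀) (h₂ : SecAt A₂ f a₂ t₀) (h₃ : SecAt A₃ f a₃ t₀)
    (k₁ : SecAt B₁ f b₁ t₀) (k₂ : SecAt B₂ f b₂ t₀) (k₃ : SecAt B₃ f b₃ t₀) :
    SecAt (tensorSix A₁ A₂ A₃ B₁ B₂ B₃) f
      (fun t ↦ LineBundle.tmulSix (a₁ t) (a₂ t) (a₃ t) (b₁ t) (b₂ t) (b₃ t)) t₀ :=
  ((((h₁.tmul h₂).tmul h₃).tmul k₁).tmul k₂).tmul k₃

end LineBundle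

variable {X : Type u} [TopologicalSpace X] {L : LineBundle.{u, v} (X × X)}

variable (L) in
/-- The line bundle `π₁^* J ⊗ π₂^* J ⊗ π₃^* J ⊗ π₁₂^* L ⊗ π₁₃^* L ⊗ π₂₃^* L` over
`[0, 1] × X × X × X`. -/
abbrev tripleSource (J : LineBundle.{u, v} X) : LineBundle.{u, v} (unitInterval × X × X × X) :=
  tensorSix (J.pullback (pr1'.comp prX)) (J.pullback (pr2'.comp prX)) (J.pullback (pr3'.comp prX))
    (L.pullback (pr12.comp prX)) (L.pullback (pr13.comp prX)) (L.pullback (pr23.comp prX))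

/-- The element `a₁ ⊗ a₂ ⊗ a₃ ⊗ l₁₂ ⊗ l₁₃ ⊗ l₂₃` of a fibre of `tripleSource L J`. -/
def tripleElem {J : LineBundle.{u, v} X} {p : unitInterval × X × X × X} (a₁ : J.fiber p.2.1)
    (a₂ : J.fiber p.2.2.1) (a₃ : J.fiber p.2.2.2) (l₁₂ : L.fiber (p.2.1, p.2.2.1))
    (l₁₃ : L.fiber (p.2.1, p.2.2.2)) (l₂₃ : L.fiber (p.2.2.1, p.2.2.2)) :
    (tripleSource L J).fiber p :=
  tmulSix (A₁ := J.pullback (pr1'.comp prX)) (A₂ := J.pullback (pr2'.comp prX))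
    (A₃ := J.pullback (pr3'.comp prX)) (B₁ := L.pullback (pr12.comp prX))
    (B₂ := L.pullback (pr13.comp prX)) (B₃ := L.pullback (pr23.comp prX)) a₁ a₂ a₃ l₁₂ l₁₃ l₂₃

lemma tripleElem_smul {J : LineBundle.{u, v} X} {p : unitInterval × X × X × X}
    (c₁ c₂ c₃ d₁ d₂ d₃ : ℂ) (a₁ : J.fiber p.2.1)
    (a₂ : J.fiber p.2.2.1) (a₃ : J.fiber p.2.2.2) (l₁₂ : L.fiber (p.2.1, p.2.2.1))
    (l₁₃ : L.fiber (p.2.1, p.2.2.2)) (l₂₃ : L.fiber (p.2.2.1, p.2.2.2)) :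
    tripleElem (c₁ • a₁) (c₂ • a₂) (c₃ • a₃) (d₁ • l₁₂) (d₂ • l₁₃) (d₃ • l₂₃) =
      (c₁ * c₂ * c₃ * d₁ * d₂ * d₃) • tripleElem a₁ a₂ a₃ l₁₂ l₁₃ l₂₃ :=
  tmulSix_smul (A₁ := J.pullback (pr1'.comp prX)) (A₂ := J.pullback (pr2'.comp prX))
    (A₃ := J.pullback (pr3'.comp prX)) (B₁ := L.pullback (pr12.comp prX))
    (B₂ := L.pullback (pr13.comp prX)) (B₃ := L.pullback (pr23.comp prX)) ..

lemma tripleElem_ne_zero {J : LineBundle.{u, v} X} {p : unitInterval × X × X × X}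
    {a₁ : J.fiber p.2.1} {a₂ : J.fiber p.2.2.1} {a₃ : J.fiber p.2.2.2}
    {l₁₂ : L.fiber (p.2.1, p.2.2.1)} {l₁₃ : L.fiber (p.2.1, p.2.2.2)}
    {l₂₃ : L.fiber (p.2.2.1, p.2.2.2)} (h₁ : a₁ ≠ 0) (h₂ : a₂ ≠ 0) (h₃ : a₃ ≠ 0)
    (k₁ : l₁₂ ≠ 0) (k₂ : l₁₃ ≠ 0) (k₃ : l₂₃ ≠ 0) : tripleElem a₁ a₂ a₃ l₁₂ l₁₃ l₂₃ ≠ 0 :=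
  tmulSix_ne_zero (A₁ := J.pullback (pr1'.comp prX)) (A₂ := J.pullback (pr2'.comp prX))
    (A₃ := J.pullback (pr3'.comp prX)) (B₁ := L.pullback (pr12.comp prX))
    (B₂ := L.pullback (pr13.comp prX)) (B₃ := L.pullback (pr23.comp prX)) h₁ h₂ h₃ k₁ k₂ k₃

lemma secAt_tripleElem {J : LineBundle.{u, v} X} {T : Type*} [TopologicalSpace T]
    {f : T → unitInterval × X × X × X} {t₀ : T} (hf : ContinuousAt f t₀)
    {a₁ : ∀ t, J.fiber (f t).2.1} {a₂ : ∀ t, J.fiber (f t).2.2.1} {a₃ : ∀ t, J.fiber (f t).2.2.2}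
    {l₁₂ : ∀ t, L.fiber ((f t).2.1, (f t).2.2.1)} {l₁₃ : ∀ t, L.fiber ((f t).2.1, (f t).2.2.2)}
    {l₂₃ : ∀ t, L.fiber ((f t).2.2.1, (f t).2.2.2)}
    (h₁ : SecAt J (fun t ↦ (f t).2.1) a₁ t₀) (h₂ : SecAt J (fun t ↦ (f t).2.2.1) a₂ t₀)
    (h₃ : SecAt J (fun t ↦ (f t).2.2.2) a₃ t₀)
    (k₁ : SecAt L (fun t ↦ ((f t).2.1, (f t).2.2.1)) l₁₂ t₀)
    (k₂ : SecAt L (fun t ↦ ((f t).2.1, (f t).2.2.2)) l₁₃ t₀)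
    (k₃ : SecAt L (fun t ↦ ((f t).2.2.1, (f t).2.2.2)) l₂₃ t₀) :
    SecAt (tripleSource L J) f
      (fun t ↦ tripleElem (a₁ t) (a₂ t) (a₃ t) (l₁₂ t) (l₁₃ t) (l₂₃ t)) t₀ := by
  have e₁ : SecAt (J.pullback (pr1'.comp prX)) f a₁ t₀ := h₁.pullback hf
  have e₂ : SecAt (J.pullback (pr2'.comp prX)) f a₂ t₀ := h₂.pullback hf
  have e₃ : SecAt (J.pullback (pr3'.comp prX)) f a₃ t₀ := h₃.pullback hf
  have g₁ : SecAt (L.pullback (pr12.comp prX)) f l₁₂ t₀ := k₁.pullback hf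
  have g₂ : SecAt (L.pullback (pr13.comp prX)) f l₁₃ t₀ := k₂.pullback hf
  have g₃ : SecAt (L.pullback (pr23.comp prX)) f l₂₃ t₀ := k₃.pullback hf
  exact e₁.tmulSix e₂ e₃ g₁ g₂ g₃

/-- The image of `k₁ ⊗ k₂ ⊗ k₃ ⊗ l₁₂² ⊗ l₁₃² ⊗ l₂₃²`. -/
def assocValue {C : LineBundle.{u, v} (unitInterval × X × X × X)} (ζ : Iso (assocSource L) C)
    (p : unitInterval × X × X × X) (k₁ : (diagBundle L).fiber p.2.1)
    (k₂ : (diagBundle L).fiber p.2.2.1) (k₃ : (diagBundle L).fiber p.2.2.2)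
    (l₁₂ : L.fiber (p.2.1, p.2.2.1)) (l₁₃ : L.fiber (p.2.1, p.2.2.2))
    (l₂₃ : L.fiber (p.2.2.1, p.2.2.2)) : C.fiber p :=
  ζ.equiv p (assocElem p.1 k₁ k₂ k₃ l₁₂ l₁₂ l₁₃ l₁₃ l₂₃ l₂₃)

section AssocValue

variable {C : LineBundle.{u, v} (unitInterval × X × X × X)} (ζ : Iso (assocSource L) C)

lemma assocValue_smul (p : unitInterval × X × X × X) (c₁ c₂ c₃ d₁ d₂ d₃ : ℂ)
    (k₁ : (diagBundle L).fiber p.2.1)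
    (k₂ : (diagBundle L).fiber p.2.2.1) (k₃ : (diagBundle L).fiber p.2.2.2)
    (l₁₂ : L.fiber (p.2.1, p.2.2.1)) (l₁₃ : L.fiber (p.2.1, p.2.2.2))
    (l₂₃ : L.fiber (p.2.2.1, p.2.2.2)) :
    assocValue ζ p (c₁ • k₁) (c₂ • k₂) (c₃ • k₃) (d₁ • l₁₂) (d₂ • l₁₃) (d₃ • l₂₃) =
      (c₁ * c₂ * c₃ * (d₁ * d₁) * (d₂ * d₂) * (d₃ * d₃)) •
        assocValue ζ p k₁ k₂ k₃ l₁₂ l₁₃ l₂₃ := by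
  refine Eq.trans (congrArg (ζ.equiv p) ?_) (map_smul (ζ.equiv p) _ _)
  refine Eq.trans ?_ (tmulSix_smul (A₁ := (diagBundle L).pullback (pr1'.comp prX))
    (A₂ := (diagBundle L).pullback (pr2'.comp prX)) (A₃ := (diagBundle L).pullback (pr3'.comp prX))
    (B₁ := (L.tensor L).pullback (pr12.comp prX)) (B₂ := (L.tensor L).pullback (pr13.comp prX))
    (B₃ := (L.tensor L).pullback (pr23.comp prX)) (z := p) _ _ _ _ _ _ k₁ k₂ k₃
    (tmul (A := L) (B := L) l₁₂ l₁₂) (tmul (A := L) (B := L) l₁₃ l₁₃)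
    (tmul (A := L) (B := L) l₂₃ l₂₃))
  exact tmulSix_congr (A₁ := (diagBundle L).pullback (pr1'.comp prX))
    (A₂ := (diagBundle L).pullback (pr2'.comp prX)) (A₃ := (diagBundle L).pullback (pr3'.comp prX))
    (B₁ := (L.tensor L).pullback (pr12.comp prX)) (B₂ := (L.tensor L).pullback (pr13.comp prX))
    (B₃ := (L.tensor L).pullback (pr23.comp prX)) (z := p) _ _ _
    (tmul_smul_smul (A := L) (B := L) d₁ d₁ l₁₂ l₁₂)
    (tmul_smul_smul (A := L) (B := L) d₂ d₂ l₁₃ l₁₃)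
    (tmul_smul_smul (A := L) (B := L) d₃ d₃ l₂₃ l₂₃)

lemma assocValue_ne_zero {p : unitInterval × X × X × X} {k₁ : (diagBundle L).fiber p.2.1}
    {k₂ : (diagBundle L).fiber p.2.2.1} {k₃ : (diagBundle L).fiber p.2.2.2}
    {l₁₂ : L.fiber (p.2.1, p.2.2.1)} {l₁₃ : L.fiber (p.2.1, p.2.2.2)}
    {l₂₃ : L.fiber (p.2.2.1, p.2.2.2)} (h₁ : k₁ ≠ 0) (h₂ : k₂ ≠ 0) (h₃ : k₃ ≠ 0)
    (g₁ : l₁₂ ≠ 0) (g₂ : l₁₃ ≠ 0) (g₃ : l₂₃ ≠ 0) : assocValue ζ p k₁ k₂ k₃ l₁₂ l₁₃ l₂₃ ≠ 0 := by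
  intro h0
  refine tmulSix_ne_zero (A₁ := (diagBundle L).pullback (pr1'.comp prX))
    (A₂ := (diagBundle L).pullback (pr2'.comp prX)) (A₃ := (diagBundle L).pullback (pr3'.comp prX))
    (B₁ := (L.tensor L).pullback (pr12.comp prX)) (B₂ := (L.tensor L).pullback (pr13.comp prX))
    (B₃ := (L.tensor L).pullback (pr23.comp prX)) (z := p) h₁ h₂ h₃
    (tmul_ne_zero (A := L) (B := L) g₁ g₁) (tmul_ne_zero (A := L) (B := L) g₂ g₂)
    (tmul_ne_zero (A := L) (B := L) g₃ g₃) ?_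
  exact (ζ.equiv p).injective (h0.trans (map_zero _).symm)

lemma secAt_assocValue {T : Type*} [TopologicalSpace T]
    {f : T → unitInterval × X × X × X} {t₀ : T} (hf : ContinuousAt f t₀)
    {k₁ : ∀ t, (diagBundle L).fiber (f t).2.1} {k₂ : ∀ t, (diagBundle L).fiber (f t).2.2.1}
    {k₃ : ∀ t, (diagBundle L).fiber (f t).2.2.2}
    {l₁₂ : ∀ t, L.fiber ((f t).2.1, (f t).2.2.1)} {l₁₃ : ∀ t, L.fiber ((f t).2.1, (f t).2.2.2)}
    {l₂₃ : ∀ t, L.fiber ((f t).2.2.1, (f t).2.2.2)}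
    (h₁ : SecAt (diagBundle L) (fun t ↦ (f t).2.1) k₁ t₀)
    (h₂ : SecAt (diagBundle L) (fun t ↦ (f t).2.2.1) k₂ t₀)
    (h₃ : SecAt (diagBundle L) (fun t ↦ (f t).2.2.2) k₃ t₀)
    (g₁ : SecAt L (fun t ↦ ((f t).2.1, (f t).2.2.1)) l₁₂ t₀)
    (g₂ : SecAt L (fun t ↦ ((f t).2.1, (f t).2.2.2)) l₁₃ t₀)
    (g₃ : SecAt L (fun t ↦ ((f t).2.2.1, (f t).2.2.2)) l₂₃ t₀) :
    SecAt C f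
      (fun t ↦ assocValue ζ (f t) (k₁ t) (k₂ t) (k₃ t) (l₁₂ t) (l₁₃ t) (l₂₃ t)) t₀ := by
  have e₁ : SecAt ((diagBundle L).pullback (pr1'.comp prX)) f k₁ t₀ := h₁.pullback hf
  have e₂ : SecAt ((diagBundle L).pullback (pr2'.comp prX)) f k₂ t₀ := h₂.pullback hf
  have e₃ : SecAt ((diagBundle L).pullback (pr3'.comp prX)) f k₃ t₀ := h₃.pullback hf
  have q₁ : SecAt ((L.tensor L).pullback (pr12.comp prX)) f
    (fun t ↦ tmul (A := L) (B := L) (l₁₂ t) (l₁₂ t)) t₀ := (g₁.tmul g₁).pullback hf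
  have q₂ : SecAt ((L.tensor L).pullback (pr13.comp prX)) f
    (fun t ↦ tmul (A := L) (B := L) (l₁₃ t) (l₁₃ t)) t₀ := (g₂.tmul g₂).pullback hf
  have q₃ : SecAt ((L.tensor L).pullback (pr23.comp prX)) f
    (fun t ↦ tmul (A := L) (B := L) (l₂₃ t) (l₂₃ t)) t₀ := (g₃.tmul g₃).pullback hf
  exact (e₁.tmulSix e₂ e₃ q₁ q₂ q₃).iso ζ

end AssocValue

/-- For linear maps `ξ` from a fibre of `tripleSource L J` to `J`, the condition that `ξ ⊗ ξ` is
`ζ` up to the isomorphism `j`. -/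
def AssocSquaresTo {h : C(unitInterval × X × X × X, X)} (r : RootPair (diagBundle L))
    (ζ : Iso (assocSource L) ((diagBundle L).pullback h)) (p : unitInterval × X × X × X)
    (ξ : (tripleSource L r.J).fiber p →ₗ[ℂ] (r.J.pullback h).fiber p) : Prop :=
  ∀ (a₁ : r.J.fiber p.2.1) (a₂ : r.J.fiber p.2.2.1) (a₃ : r.J.fiber p.2.2.2)
    (l₁₂ : L.fiber (p.2.1, p.2.2.1)) (l₁₃ : L.fiber (p.2.1, p.2.2.2))
    (l₂₃ : L.fiber (p.2.2.1, p.2.2.2)),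
    r.sq (x := h p) (ξ (tripleElem a₁ a₂ a₃ l₁₂ l₁₃ l₂₃)) =
      assocValue ζ p (r.sq a₁) (r.sq a₂) (r.sq a₃) l₁₂ l₁₃ l₂₃

/-- The same reduction to one nonzero vector in each of six lines. -/
lemma assocSquaresTo_iff {h : C(unitInterval × X × X × X, X)} (r : RootPair (diagBundle L))
    (ζ : Iso (assocSource L) ((diagBundle L).pullback h)) {p : unitInterval × X × X × X}
    {a₁ : r.J.fiber p.2.1} {a₂ : r.J.fiber p.2.2.1} {a₃ : r.J.fiber p.2.2.2}
    {l₁₂ : L.fiber (p.2.1, p.2.2.1)} {l₁₃ : L.fiber (p.2.1, p.2.2.2)}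
    {l₂₃ : L.fiber (p.2.2.1, p.2.2.2)} (h₁ : a₁ ≠ 0) (h₂ : a₂ ≠ 0) (h₃ : a₃ ≠ 0)
    (g₁ : l₁₂ ≠ 0) (g₂ : l₁₃ ≠ 0) (g₃ : l₂₃ ≠ 0)
    (ξ : (tripleSource L r.J).fiber p →ₗ[ℂ] (r.J.pullback h).fiber p) :
    AssocSquaresTo r ζ p ξ ↔ r.sq (x := h p) (ξ (tripleElem a₁ a₂ a₃ l₁₂ l₁₃ l₂₃)) =
      assocValue ζ p (r.sq a₁) (r.sq a₂) (r.sq a₃) l₁₂ l₁₃ l₂₃ := by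
  constructor
  · intro h
    exact h a₁ a₂ a₃ l₁₂ l₁₃ l₂₃
  · intro he b₁ b₂ b₃ k₁ k₂ k₃
    obtain ⟨c₁, rfl⟩ := r.J.exists_smul h₁ b₁
    obtain ⟨c₂, rfl⟩ := r.J.exists_smul h₂ b₂
    obtain ⟨c₃, rfl⟩ := r.J.exists_smul h₃ b₃
    obtain ⟨d₁, rfl⟩ := L.exists_smul g₁ k₁
    obtain ⟨d₂, rfl⟩ := L.exists_smul g₂ k₂
    obtain ⟨d₃, rfl⟩ := L.exists_smul g₃ k₃
    rw [r.sq_smul, r.sq_smul, r.sq_smul, assocValue_smul, ← he, tripleElem_smul, map_smul]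
    refine (r.sq_smul (x := h p) _ _).trans ?_
    congr 1
    ring

/-- The square roots of `ζ` form a double cover of `[0, 1] × X³`. Its restrictions to the two ends
are computed by composites of lifts to `Q_J`, so it carries the sign of one bracketing over to the
other. -/
lemma isRootCondition_assoc {h : C(unitInterval × X × X × X, X)} (r : RootPair (diagBundle L))
    (ζ : Iso (assocSource L) ((diagBundle L).pullback h)) :
    IsRootCondition (tripleSource L r.J) (r.J.pullback h) (AssocSquaresTo r ζ) := by
  refine IsRootCondition.of_square (C := (diagBundle L).pullback h) fun p₀ ↦
    ⟨fun p ↦ tripleElem (r.J.frame p₀.2.1 p.2.1) (r.J.frame p₀.2.2.1 p.2.2.1)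
      (r.J.frame p₀.2.2.2 p.2.2.2) (L.frame (p₀.2.1, p₀.2.2.1) (p.2.1, p.2.2.1))
      (L.frame (p₀.2.1, p₀.2.2.2) (p.2.1, p.2.2.2))
      (L.frame (p₀.2.2.1, p₀.2.2.2) (p.2.2.1, p.2.2.2)),
    fun p ↦ r.J.frame (h p₀) (h p),
    fun p ↦ assocValue ζ p (r.sq (r.J.frame p₀.2.1 p.2.1)) (r.sq (r.J.frame p₀.2.2.1 p.2.2.1))
      (r.sq (r.J.frame p₀.2.2.2 p.2.2.2)) (L.frame (p₀.2.1, p₀.2.2.1) (p.2.1, p.2.2.1))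
      (L.frame (p₀.2.1, p₀.2.2.2) (p.2.1, p.2.2.2))
      (L.frame (p₀.2.2.1, p₀.2.2.2) (p.2.2.1, p.2.2.2)),
    fun p ↦ r.sq (r.J.frame (h p₀) (h p)), ?_⟩
  have c₁ : Continuous fun p : unitInterval × X × X × X ↦ p.2.1 := by fun_prop
  have c₂ : Continuous fun p : unitInterval × X × X × X ↦ p.2.2.1 := by fun_prop
  have c₃ : Continuous fun p : unitInterval × X × X × X ↦ p.2.2.2 := by fun_prop
  have hJ : ∀ {f : unitInterval × X × X × X → X}, Continuous f →
      ∀ᶠ p in 𝓝 p₀, f p ∈ r.J.nbhd (f p₀) := fun hf ↦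
    hf.continuousAt.eventually_mem ((r.J.isOpen_nbhd _).mem_nhds (r.J.mem_nbhd _))
  have hL : ∀ {f : unitInterval × X × X × X → X × X}, Continuous f →
      ∀ᶠ p in 𝓝 p₀, f p ∈ L.nbhd (f p₀) := fun hf ↦
    hf.continuousAt.eventually_mem ((L.isOpen_nbhd _).mem_nhds (L.mem_nbhd _))
  filter_upwards [hJ c₁, hJ c₂, hJ c₃, hL (c₁.prodMk c₂), hL (c₁.prodMk c₃), hL (c₂.prodMk c₃),
    hJ h.continuous] with p h₁ h₂ h₃ g₁ g₂ g₃ g₀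
  have s₁ := r.J.secAt_frame (f := fun p : unitInterval × X × X × X ↦ p.2.1) c₁.continuousAt h₁
  have s₂ := r.J.secAt_frame (f := fun p : unitInterval × X × X × X ↦ p.2.2.1) c₂.continuousAt h₂
  have s₃ := r.J.secAt_frame (f := fun p : unitInterval × X × X × X ↦ p.2.2.2) c₃.continuousAt h₃
  have q₁ := L.secAt_frame (f := fun p : unitInterval × X × X × X ↦ (p.2.1, p.2.2.1))
    (c₁.prodMk c₂).continuousAt g₁
  have q₂ := L.secAt_frame (f := fun p : unitInterval × X × X × X ↦ (p.2.1, p.2.2.2))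
    (c₁.prodMk c₃).continuousAt g₂
  have q₃ := L.secAt_frame (f := fun p : unitInterval × X × X × X ↦ (p.2.2.1, p.2.2.2))
    (c₂.prodMk c₃).continuousAt g₃
  have q₀ := r.J.secAt_frame (f := h) h.continuous.continuousAt g₀
  have n₁ := r.J.frame_ne_zero p₀.2.1 p.2.1
  have n₂ := r.J.frame_ne_zero p₀.2.2.1 p.2.2.1
  have n₃ := r.J.frame_ne_zero p₀.2.2.2 p.2.2.2
  have m₁ := L.frame_ne_zero (p₀.2.1, p₀.2.2.1) (p.2.1, p.2.2.1)
  have m₂ := L.frame_ne_zero (p₀.2.1, p₀.2.2.2) (p.2.1, p.2.2.2)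
  have m₃ := L.frame_ne_zero (p₀.2.2.1, p₀.2.2.2) (p.2.2.1, p.2.2.2)
  have n₀ := r.J.frame_ne_zero (h p₀) (h p)
  refine ⟨⟨tripleElem_ne_zero n₁ n₂ n₃ m₁ m₂ m₃, n₀, assocValue_ne_zero ζ (r.sq_ne_zero n₁)
    (r.sq_ne_zero n₂) (r.sq_ne_zero n₃) m₁ m₂ m₃, r.sq_ne_zero n₀⟩,
    ⟨secAt_tripleElem continuousAt_id s₁ s₂ s₃ q₁ q₂ q₃, q₀.pullback continuousAt_id,
    secAt_assocValue ζ continuousAt_id (r.secAt_sq s₁) (r.secAt_sq s₂) (r.secAt_sq s₃) q₁ q₂ q₃,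
    SecAt.pullback (r.secAt_sq q₀) continuousAt_id⟩, fun ξ c hc ↦ ?_⟩
  rw [assocSquaresTo_iff r ζ n₁ n₂ n₃ m₁ m₂ m₃, hc]
  exact iff_of_eq (congrArg (· = _) (r.sq_smul _ _))

end AssociativityCover

/-! ### Signs along loops, and their behaviour under composition of lifts. -/

section Monodromy

open Bundle LineBundle Filter
open scoped unitInterval

/-- The sign `(-1)^k`. -/
def sgn (k : ZMod 2) : ℂ := if k = 0 then 1 else -1

@[simp] lemma sgn_zero : sgn 0 = 1 := if_pos rfl

@[simp] lemma sgn_one : sgn 1 = -1 := if_neg one_ne_zero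

lemma sgn_ne_zero (k : ZMod 2) : sgn k ≠ 0 := by
  rcases ZMod.two_cases k with rfl | rfl <;> simp

lemma sgn_add (k l : ZMod 2) : sgn (k + l) = sgn k * sgn l := by
  rcases ZMod.two_cases k with rfl | rfl <;> rcases ZMod.two_cases l with rfl | rfl
  · simp
  · simp
  · simp
  · rw [CharTwo.add_self_eq_zero]
    simp

lemma sgn_mul_self (k : ZMod 2) : sgn k * sgn k = 1 := by
  rw [← sgn_add, CharTwo.add_self_eq_zero, sgn_zero]

lemma sgn_injective {k l : ZMod 2} (h : sgn k = sgn l) : k = l := by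
  rcases ZMod.two_cases k with rfl | rfl <;> rcases ZMod.two_cases l with rfl | rfl
  · rfl
  · norm_num [sgn] at h
  · norm_num [sgn] at h
  · rfl

section General

variable {Y : Type u} [TopologicalSpace Y] {A B : LineBundle.{u, v} Y}
    {P : ∀ y, (A.fiber y →ₗ[ℂ] B.fiber y) → Prop}

/-- The family `ξ` is a lift of the path `f` to `HomSubspace A B P`. -/
def IsLift (P : ∀ y, (A.fiber y →ₗ[ℂ] B.fiber y) → Prop) (f : C(I, Y))
    (ξ : ∀ t, A.fiber (f t) →ₗ[ℂ] B.fiber (f t)) : Prop :=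
  (∀ t, P (f t) (ξ t)) ∧ ∀ t, MorAt A f B f ξ t

/-- The family `ξ` of linear maps along a loop changes sign by `(-1)^k`. -/
def HasSign (f : C(I, Y)) (ξ : ∀ t, A.fiber (f t) →ₗ[ℂ] B.fiber (f t)) (k : ZMod 2) : Prop :=
  ∀ (a : ∀ y, A.fiber y) (b : ∀ y, B.fiber y) (c : ℂ), ξ 0 (a (f 0)) = c • b (f 0) →
    ξ 1 (a (f 1)) = (sgn k * c) • b (f 1)

lemma IsRootCondition.exists_isLift (hP : IsRootCondition A B P) (f : C(I, Y)) :
    ∃ ξ, IsLift P f ξ := by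
  obtain ⟨ξ, hξ⟩ := hP.exists_mem (f 0)
  obtain ⟨F, -, hF⟩ := hP.isDoubleCover.exists_path_lift f (e := HomSubspace.mk (f 0) ξ hξ) rfl
  -- Replacing `f` by the projection of its lift puts the linear maps of `F` in the right fibres
  -- without transport.
  obtain rfl : f = ⟨fun t ↦ (F t).pt, continuous_pt.comp F.continuous⟩ :=
    ContinuousMap.ext fun t ↦ (hF t).symm
  exact ⟨fun t ↦ (F t).lin, fun t ↦ (F t).prop, fun t ↦
    (HomSubspace.continuousAt_iff.1 F.continuous.continuousAt).2⟩

/-- The lift ends at the deck transform of its start, once for each unit of `w`. The equality `γ 0 =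
γ 1` is not definitional, so the two ends are compared through global families `a` and `b`, which
need not be continuous. -/
lemma IsLift.hasSign (hP : IsRootCondition A B P) {w : Hlg Y 1 →ₗ[ZMod 2] ZMod 2}
    (hw : IsFirstStiefelWhitney (HomSubspace.proj A B P) w) {y : Y} {γ : Path y y}
    {ξ : ∀ t, A.fiber (γ.toContinuousMap t) →ₗ[ℂ] B.fiber (γ.toContinuousMap t)}
    (hξ : IsLift P γ.toContinuousMap ξ) : HasSign γ.toContinuousMap ξ (w (loopClass γ)) := by
  let F : C(I, HomSubspace A B P) := ⟨fun t ↦ HomSubspace.mk (γ.toContinuousMap t) (ξ t) (hξ.1 t),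
    continuous_iff_continuousAt.2 fun t ↦ HomSubspace.continuousAt_iff.2
      ⟨γ.continuous.continuousAt, hξ.2 t⟩⟩
  have key := (hP.isDoubleCover.loop_iff hw γ F (fun t ↦ rfl) _).1 rfl
  generalize w (loopClass γ) = k at key
  have aux : ∀ q q' : HomSubspace A B P, q' = flip hP.neg k q →
      ∀ (a : ∀ y, A.fiber y) (b : ∀ y, B.fiber y) (c : ℂ), q.lin (a q.pt) = c • b q.pt →
        q'.lin (a q'.pt) = (sgn k * c) • b q'.pt := by
    rintro q _ rfl a b c h
    rcases ZMod.two_cases k with rfl | rfl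
    · rw [flip_zero, sgn_zero, one_mul]
      exact h
    · rw [flip_one, sgn_one, neg_one_mul, neg_smul]
      exact congrArg Neg.neg h
  exact aux _ _ key

/-- Conversely, one nonzero coefficient of a lift, compared at the two ends, determines the value of
the class. A class is computed below by exhibiting a lift and following one vector. -/
lemma IsLift.eq_sign (hP : IsRootCondition A B P) {w : Hlg Y 1 →ₗ[ZMod 2] ZMod 2}
    (hw : IsFirstStiefelWhitney (HomSubspace.proj A B P) w) {y : Y} {γ : Path y y}
    {ξ : ∀ t, A.fiber (γ.toContinuousMap t) →ₗ[ℂ] B.fiber (γ.toContinuousMap t)}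
    (hξ : IsLift P γ.toContinuousMap ξ) {k : ZMod 2} (a : ∀ y, A.fiber y) (b : ∀ y, B.fiber y)
    (hb : ∀ y, b y ≠ 0) {c : ℂ} (hc : c ≠ 0)
    (h0 : ξ 0 (a (γ.toContinuousMap 0)) = c • b (γ.toContinuousMap 0))
    (h1 : ξ 1 (a (γ.toContinuousMap 1)) = (sgn k * c) • b (γ.toContinuousMap 1)) :
    w (loopClass γ) = k := by
  have h2 := hξ.hasSign hP hw a b c h0
  rw [h2] at h1
  have := smul_left_injective ℂ (hb _) h1
  exact sgn_injective (mul_right_cancel₀ hc this)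

lemma exists_family_of_section (s : C(Y, HomSubspace A B P))
    (hs : ∀ y, HomSubspace.proj A B P (s y) = y) :
    ∃ ξ : ∀ y, A.fiber y →ₗ[ℂ] B.fiber y, (∀ y, P y (ξ y)) ∧ ∀ y, MorAt A id B id ξ y := by
  -- The base map of the section is generalized to `f`, so that `f = id` can be eliminated instead
  -- of transporting fibres.
  have aux : ∀ (f : Y → Y) (l : ∀ y, A.fiber (f y) →ₗ[ℂ] B.fiber (f y)), f = id →
      (∀ y, P (f y) (l y)) → (∀ y, MorAt A f B f l y) →
      ∃ ξ : ∀ y, A.fiber y →ₗ[ℂ] B.fiber y, (∀ y, P y (ξ y)) ∧ ∀ y, MorAt A id B id ξ y := by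
    rintro _ l rfl h h'
    exact ⟨l, h, h'⟩
  exact aux (fun y ↦ (s y).pt) (fun y ↦ (s y).lin) (funext hs) (fun y ↦ (s y).prop)
    fun y ↦ (HomSubspace.continuousAt_iff.1 s.continuous.continuousAt).2

lemma loopClass_congr {y y' : Y} {γ : Path y y} {γ' : Path y' y'} (h : ∀ t, γ t = γ' t) :
    loopClass γ = loopClass γ' := by
  obtain rfl : y = y' := by rw [← γ.source, ← γ'.source, h]
  obtain rfl : γ = γ' := Path.ext (funext h)
  rfl

/-- Functionals on `H₁` take the same value on freely homotopic loops. -/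
lemma functional_free_homotopy (w : Hlg Y 1 →ₗ[ZMod 2] ZMod 2) {y y' : Y} {γ : Path y y}
    {γ' : Path y' y'} (G : C(I × I, Y)) (h₀ : ∀ t, γ t = G (0, t)) (h₁ : ∀ t, γ' t = G (1, t))
    (hG : ∀ t, G (t, 0) = G (t, 1)) : w (loopClass γ) = w (loopClass γ') := by
  obtain ⟨c, hc, hcw, -⟩ := exists_cocycleOne w
  rw [← hcw, ← hcw]
  exact hc.free_homotopy G (f₀ := γ.toContinuousMap) (f₁ := γ'.toContinuousMap) h₀ h₁ hG

end General

variable {X : Type u} [TopologicalSpace X]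

/-! ### Comparison of square roots -/

section Difference

variable {K : LineBundle.{u, v} X}

lemma exists_differenceClass (r₁ r₂ : RootPair K) : ∃ w : Hlg X 1 →ₗ[ZMod 2] ZMod 2,
    IsFirstStiefelWhitney (DifferenceCover.proj r₁ r₂) w :=
  (isRootCondition_isometry r₁ r₂).isDoubleCover.exists_isFirstStiefelWhitney

/-- The composite of a lift to `P₂₃` with one to `P₁₂` is a lift to `P₁₃`, and signs multiply. -/
lemma differenceClass_trans {r₁ r₂ r₃ : RootPair K} {w₁₂ w₂₃ w₁₃ : Hlg X 1 →ₗ[ZMod 2] ZMod 2}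
    (h₁₂ : IsFirstStiefelWhitney (DifferenceCover.proj r₁ r₂) w₁₂)
    (h₂₃ : IsFirstStiefelWhitney (DifferenceCover.proj r₂ r₃) w₂₃)
    (h₁₃ : IsFirstStiefelWhitney (DifferenceCover.proj r₁ r₃) w₁₃) : w₁₃ = w₁₂ + w₂₃ := by
  refine functional_ext fun x γ ↦ ?_
  have p₁₂ := isRootCondition_isometry r₁ r₂
  have p₂₃ := isRootCondition_isometry r₂ r₃
  obtain ⟨ξ, hξ⟩ := p₁₂.exists_isLift γ.toContinuousMap
  obtain ⟨η, hη⟩ := p₂₃.exists_isLift γ.toContinuousMap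
  have hc : IsLift (IsRootIsometry r₁ r₃) γ.toContinuousMap (fun t ↦ ξ t ∘ₗ η t) :=
    ⟨fun t a b ↦ (hξ.1 t _ _).trans (hη.1 t a b), fun t s hs ↦ hξ.2 t _ (hη.2 t _ hs)⟩
  let f₁ : ∀ x, r₁.J.fiber x := fun x ↦ r₁.J.frame x x
  let f₂ : ∀ x, r₂.J.fiber x := fun x ↦ r₂.J.frame x x
  let f₃ : ∀ x, r₃.J.fiber x := fun x ↦ r₃.J.frame x x
  obtain ⟨c, hc'⟩ := r₂.J.exists_smul (r₂.J.frame_ne_zero _ _) (η 0 (f₃ (γ.toContinuousMap 0)))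
  obtain ⟨d, hd'⟩ := r₁.J.exists_smul (r₁.J.frame_ne_zero _ _) (ξ 0 (f₂ (γ.toContinuousMap 0)))
  have e₁ := hη.hasSign p₂₃ h₂₃ f₃ f₂ c hc'
  have e₂ := hξ.hasSign p₁₂ h₁₂ f₂ f₁ d hd'
  have h0 : (ξ 0 ∘ₗ η 0) (f₃ (γ.toContinuousMap 0)) = (c * d) • f₁ (γ.toContinuousMap 0) := by
    rw [LinearMap.comp_apply, hc', map_smul, hd', smul_smul]
  have h1 : (ξ 1 ∘ₗ η 1) (f₃ (γ.toContinuousMap 1)) =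
      (sgn (w₁₂ (loopClass γ) + w₂₃ (loopClass γ)) * (c * d)) • f₁ (γ.toContinuousMap 1) := by
    rw [LinearMap.comp_apply, e₁, map_smul, e₂, smul_smul, sgn_add]
    congr 1
    ring
  refine hc.eq_sign (isRootCondition_isometry r₁ r₃) h₁₃ f₃ f₁ (fun x ↦ r₁.J.frame_ne_zero _ _)
    ?_ h0 h1
  intro hcd
  rw [hcd, zero_smul] at h0
  exact (isRootCondition_isometry r₁ r₃).ne_zero (hc.1 0)
    (linearMap_ext (r₃.J.frame_ne_zero _ _) h0)

/-- An isomorphism of pairs is a global section of the cover. The cover consists of maps from the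
second root to the first, hence the `symm`. -/
lemma differenceClass_eq_zero_of_iso {r₁ r₂ : RootPair K} {w : Hlg X 1 →ₗ[ZMod 2] ZMod 2}
    (hw : IsFirstStiefelWhitney (DifferenceCover.proj r₁ r₂) w) (h : r₁.toRoot = r₂.toRoot) :
    w = 0 := by
  obtain ⟨i, hi⟩ := Quotient.exact h.symm
  refine isFirstStiefelWhitney_eq_zero hw ⟨fun x ↦ HomSubspace.mk x (i.equiv x).toLinearMap
    fun a b ↦ (hi x a b).symm, ?_⟩ fun x ↦ rfl
  exact continuous_iff_continuousAt.2 fun x ↦ HomSubspace.continuousAt_iff.2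
    ⟨continuousAt_id, i.morAt id x⟩

lemma toRoot_eq_of_section {r₁ r₂ : RootPair K} (s : C(X, DifferenceCover r₁ r₂))
    (hs : ∀ x, DifferenceCover.proj r₁ r₂ (s x) = x) : r₁.toRoot = r₂.toRoot := by
  obtain ⟨ξ, hξ, hξ'⟩ := exists_family_of_section s hs
  obtain ⟨i, hi⟩ := exists_iso ξ (fun x ↦ (isRootCondition_isometry r₁ r₂).ne_zero (hξ x)) hξ'
  refine (Quotient.sound (s := rootSetoid K) ⟨i, fun x a b ↦ ?_⟩).symm
  have h1 : ∀ a, i.equiv x a = ξ x a := fun a ↦ LinearMap.congr_fun (hi x) a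
  rw [h1, h1]
  exact (hξ x a b).symm

/-- The two classes add up to the class of `r₁` with itself, which is zero, and there are no signs
modulo `2`. -/
lemma differenceClass_comm {r₁ r₂ : RootPair K} {w w' : Hlg X 1 →ₗ[ZMod 2] ZMod 2}
    (h : IsFirstStiefelWhitney (DifferenceCover.proj r₁ r₂) w)
    (h' : IsFirstStiefelWhitney (DifferenceCover.proj r₂ r₁) w') : w' = w := by
  obtain ⟨w₀, hw₀⟩ := exists_differenceClass r₁ r₁
  have h1 := differenceClass_trans h h' hw₀
  rw [differenceClass_eq_zero_of_iso hw₀ rfl] at h1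
  ext z
  have := LinearMap.congr_fun h1 z
  exact (CharTwo.add_eq_zero.1 this.symm).symm

end Difference

/-! ### Change of the square root -/

section Compatible

variable {m : C(X × X, X)} {L : LineBundle.{u, v} (X × X)}

/-- The factors are lines, so multihomogeneity alone makes `F` come from a linear map; additivity
need not be assumed. -/
lemma exists_rootSource_map {Z : Type u} [TopologicalSpace Z] {B : LineBundle.{u, v} Z} {z : Z}
    {J : LineBundle.{u, v} X} {p : X × X}
    (F : J.fiber p.1 → J.fiber p.2 → L.fiber p → B.fiber z)
    (hF : ∀ (c d e : ℂ) a b l, F (c • a) (d • b) (e • l) = (c * d * e) • F a b l) :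
    ∃ ξ : (rootSource L J).fiber p →ₗ[ℂ] B.fiber z, ∀ a b l, ξ (rootElem a b l) = F a b l := by
  have ha := J.frame_ne_zero p.1 p.1
  have hb := J.frame_ne_zero p.2 p.2
  have hl := L.frame_ne_zero p p
  obtain ⟨ξ, hξ⟩ := exists_linearMap (rootSource L J) B (rootElem_ne_zero ha hb hl)
    (F (J.frame p.1 p.1) (J.frame p.2 p.2) (L.frame p p))
  refine ⟨ξ, fun a b l ↦ ?_⟩
  obtain ⟨c, rfl⟩ := J.exists_smul ha a
  obtain ⟨d, rfl⟩ := J.exists_smul hb b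
  obtain ⟨e, rfl⟩ := L.exists_smul hl l
  rw [rootElem_smul, map_smul, hξ, hF]

lemma exists_rootClass (φ : PhiIso m L) (r : RootPair (diagBundle L)) :
    ∃ w : Hlg (X × X) 1 →ₗ[ZMod 2] ZMod 2, IsFirstStiefelWhitney (RootCover.proj φ r) w :=
  (isRootCondition_squaresTo φ r).isDoubleCover.exists_isFirstStiefelWhitney

/-- For lifts `ι₁`, `ι₂` of isometries `J' → J`, `ξ` of `Q_J` and `η` of isometries `J → J'`, the
map `η ∘ ξ ∘ (ι₁ ⊗ ι₂ ⊗ id)` lifts `γ` to `Q_{J'}`. Its sign is the product of the four signs. -/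
lemma rootClass_change {φ : PhiIso m L} {r r' : RootPair (diagBundle L)}
    {w : Hlg (X × X) 1 →ₗ[ZMod 2] ZMod 2} (hw : IsFirstStiefelWhitney (RootCover.proj φ r) w)
    {w' : Hlg (X × X) 1 →ₗ[ZMod 2] ZMod 2} (hw' : IsFirstStiefelWhitney (RootCover.proj φ r') w')
    {d : Hlg X 1 →ₗ[ZMod 2] ZMod 2} (hd : IsFirstStiefelWhitney (DifferenceCover.proj r r') d)
    {p : X × X} (γ : Path p p) :
    w' (loopClass γ) = w (loopClass γ) + d (loopClass (γ.map pr1.continuous)) +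
      d (loopClass (γ.map pr2.continuous)) + d (loopClass (γ.map m.continuous)) := by
  -- Isometries are needed in both directions, and both covers have the same class.
  obtain ⟨d', hd'⟩ := exists_differenceClass r' r
  obtain rfl : d' = d := differenceClass_comm hd hd'
  have hQ := isRootCondition_squaresTo φ r
  have hQ' := isRootCondition_squaresTo φ r'
  have hD := isRootCondition_isometry r r'
  have hD' := isRootCondition_isometry r' r
  obtain ⟨ξ, hξ⟩ := hQ.exists_isLift γ.toContinuousMap
  obtain ⟨ι₁, hι₁⟩ := hD.exists_isLift (γ.map pr1.continuous).toContinuousMap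
  obtain ⟨ι₂, hι₂⟩ := hD.exists_isLift (γ.map pr2.continuous).toContinuousMap
  obtain ⟨η, hη⟩ := hD'.exists_isLift (γ.map m.continuous).toContinuousMap
  let F : ∀ t, r'.J.fiber (γ t).1 → r'.J.fiber (γ t).2 → L.fiber (γ t) → r'.J.fiber (m (γ t)) :=
    fun t a b l ↦ η t (ξ t (rootElem (J := r.J) (p := γ t) (ι₁ t a) (ι₂ t b) l))
  have hF : ∀ t (c d e : ℂ) a b l, F t (c • a) (d • b) (e • l) = (c * d * e) • F t a b l := by
    intro t c d e a b l
    have h1 : rootElem (J := r.J) (p := γ t) (ι₁ t (c • a)) (ι₂ t (d • b)) (e • l) =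
        (c * d * e) • rootElem (J := r.J) (p := γ t) (ι₁ t a) (ι₂ t b) l := by
      refine (congrArg₂ (fun s s' ↦ rootElem (J := r.J) (p := γ t) s s' (e • l))
        ((ι₁ t).map_smul c a) ((ι₂ t).map_smul d b)).trans ?_
      exact rootElem_smul (J := r.J) (p := γ t) ..
    exact (congrArg (fun z ↦ η t (ξ t z)) h1).trans
      ((congrArg (η t) ((ξ t).map_smul _ _)).trans ((η t).map_smul _ _))
  choose ξ' hξ' using fun t ↦ exists_rootSource_map (B := r'.J) (F t) (hF t)
  have hι₁0 : ∀ t {a}, a ≠ 0 → ι₁ t a ≠ 0 := fun t a ha h ↦ hD.ne_zero (hι₁.1 t)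
    (linearMap_ext ha h)
  have hι₂0 : ∀ t {a}, a ≠ 0 → ι₂ t a ≠ 0 := fun t a ha h ↦ hD.ne_zero (hι₂.1 t)
    (linearMap_ext ha h)
  have lift : IsLift (SquaresTo φ r') γ.toContinuousMap ξ' := by
    constructor
    · intro t
      have ha := r'.J.frame_ne_zero (γ t).1 (γ t).1
      have hb := r'.J.frame_ne_zero (γ t).2 (γ t).2
      have hl := L.frame_ne_zero (γ t) (γ t)
      refine (squaresTo_iff φ r' (p := γ t) ha hb hl (ξ' t)).2 ?_
      refine (congrArg (r'.sq (x := m (γ t))) (hξ' t _ _ _)).trans ?_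
      refine (hη.1 t _ _).trans ?_
      refine ((squaresTo_iff φ r (p := γ t) (hι₁0 t ha) (hι₂0 t hb) hl (ξ t)).1 (hξ.1 t)).trans ?_
      exact congrArg₂ (fun s s' ↦ φ.app s s' _ _) (hι₁.1 t _ _) (hι₂.1 t _ _)
    · intro t₀
      have hγ : ContinuousAt γ t₀ := γ.continuous.continuousAt
      have s₁ := r'.J.secAt_frame (f := fun t ↦ (γ t).1) (continuousAt_fst.comp hγ)
        (r'.J.mem_nbhd _)
      have s₂ := r'.J.secAt_frame (f := fun t ↦ (γ t).2) (continuousAt_snd.comp hγ)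
        (r'.J.mem_nbhd _)
      have s₃ := L.secAt_frame (f := γ) hγ (L.mem_nbhd _)
      refine morAt_of_frame (secAt_rootElem (f := γ) s₁ s₂ s₃)
        (.of_forall fun t ↦ rootElem_ne_zero (r'.J.frame_ne_zero _ _) (r'.J.frame_ne_zero _ _)
          (L.frame_ne_zero _ _)) ?_
      refine SecAt.pullback (A := r'.J) (g := m) ?_ hγ
      refine SecAt.congr ?_ (.of_forall fun t ↦ (hξ' t _ _ _).symm)
      exact hη.2 t₀ _ (secAt_pullback.1 (hξ.2 t₀ _
        (secAt_rootElem (f := γ) (hι₁.2 t₀ _ s₁) (hι₂.2 t₀ _ s₂) s₃))).2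
  let a : ∀ x, r.J.fiber x := fun x ↦ r.J.frame x x
  let a' : ∀ x, r'.J.fiber x := fun x ↦ r'.J.frame x x
  let l : ∀ p, L.fiber p := fun p ↦ L.frame p p
  have ha : ∀ x, a x ≠ 0 := fun x ↦ r.J.frame_ne_zero x x
  have ha' : ∀ x, a' x ≠ 0 := fun x ↦ r'.J.frame_ne_zero x x
  obtain ⟨c₁, hc₁⟩ := r.J.exists_smul (ha (γ 0).1) (ι₁ 0 (a' (γ 0).1))
  obtain ⟨c₂, hc₂⟩ := r.J.exists_smul (ha (γ 0).2) (ι₂ 0 (a' (γ 0).2))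
  obtain ⟨c₃, hc₃⟩ := r.J.exists_smul (ha (m (γ 0)))
    (ξ 0 (rootElem (J := r.J) (p := γ 0) (a (γ 0).1) (a (γ 0).2) (l (γ 0))))
  obtain ⟨c₄, hc₄⟩ := r'.J.exists_smul (ha' (m (γ 0))) (η 0 (a (m (γ 0))))
  have e₁ := hι₁.hasSign hD hd a' a c₁ hc₁
  have e₂ := hι₂.hasSign hD hd a' a c₂ hc₂
  have e₃ := hξ.hasSign hQ hw (fun p ↦ rootElem (J := r.J) (a p.1) (a p.2) (l p))
    (fun p ↦ a (m p)) c₃ hc₃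
  have e₄ := hη.hasSign hD' hd' a a' c₄ hc₄
  -- The coefficient of the composite is the product of four coefficients. This is used at `t = 0`
  -- and, with each factor multiplied by its own sign, at `t = 1`.
  have val : ∀ (t : I) (x₁ x₂ x₃ x₄ : ℂ), ι₁ t (a' (γ t).1) = x₁ • a (γ t).1 →
      ι₂ t (a' (γ t).2) = x₂ • a (γ t).2 →
      ξ t (rootElem (J := r.J) (p := γ t) (a (γ t).1) (a (γ t).2) (l (γ t))) =
        x₃ • a (m (γ t)) → η t (a (m (γ t))) = x₄ • a' (m (γ t)) →
      ξ' t (rootElem (J := r'.J) (p := γ t) (a' (γ t).1) (a' (γ t).2) (l (γ t))) =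
        (x₁ * x₂ * x₃ * x₄) • a' (m (γ t)) := by
    intro t x₁ x₂ x₃ x₄ h₁ h₂ h₃ h₄
    refine (hξ' t _ _ _).trans ?_
    have h5 : rootElem (J := r.J) (p := γ t) (ι₁ t (a' (γ t).1)) (ι₂ t (a' (γ t).2)) (l (γ t)) =
        (x₁ * x₂ * 1) • rootElem (J := r.J) (p := γ t) (a (γ t).1) (a (γ t).2) (l (γ t)) := by
      rw [← rootElem_smul, one_smul]
      exact congrArg₂ (fun s s' ↦ rootElem (J := r.J) (p := γ t) s s' (l (γ t))) h₁ h₂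
    have h6 : ξ t (rootElem (J := r.J) (p := γ t) (ι₁ t (a' (γ t).1)) (ι₂ t (a' (γ t).2))
        (l (γ t))) = (x₁ * x₂ * 1 * x₃) • a (m (γ t)) := by
      refine (congrArg (ξ t) h5).trans (((ξ t).map_smul _ _).trans ?_)
      exact (congrArg _ h₃).trans (smul_smul _ _ _)
    refine (congrArg (η t) h6).trans (((η t).map_smul _ _).trans ?_)
    refine (congrArg _ h₄).trans ((smul_smul _ _ _).trans ?_)
    rw [mul_one]
    rfl
  have h0 := val 0 _ _ _ _ hc₁ hc₂ hc₃ hc₄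
  have h1 := val 1 _ _ _ _ e₁ e₂ e₃ e₄
  refine lift.eq_sign hQ' hw' (fun p ↦ rootElem (J := r'.J) (a' p.1) (a' p.2) (l p))
    (fun p ↦ a' (m p)) (fun p ↦ ha' _) (c := c₁ * c₂ * c₃ * c₄) ?_ h0 ?_
  -- A zero coefficient would make the lift zero at `0`, but square roots of an isomorphism are
  -- nonzero.
  · intro hc
    rw [hc, zero_smul] at h0
    exact hQ'.ne_zero (lift.1 0) (linearMap_ext (rootElem_ne_zero (ha' _) (ha' _)
      (L.frame_ne_zero _ _)) h0)
  · refine h1.trans (congrArg (fun z : ℂ ↦ z • a' (m (γ 1))) ?_)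
    rw [sgn_add, sgn_add, sgn_add]
    ring

lemma rootClass_eq_zero_of_isCompatible {φ : PhiIso m L} {r : RootPair (diagBundle L)}
    {w : Hlg (X × X) 1 →ₗ[ZMod 2] ZMod 2} (hw : IsFirstStiefelWhitney (RootCover.proj φ r) w)
    (h : IsCompatible φ r) : w = 0 := by
  obtain ⟨ξ, hξ⟩ := h
  refine isFirstStiefelWhitney_eq_zero hw ⟨fun p ↦ HomSubspace.mk p (ξ.equiv p).toLinearMap
    (hξ p), ?_⟩ fun x ↦ rfl
  exact continuous_iff_continuousAt.2 fun x ↦ HomSubspace.continuousAt_iff.2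
    ⟨continuousAt_id, ξ.morAt id x⟩

end Compatible

end Monodromy

/-! ### The associativity relation for the class of `Q_J`. -/

section Associativity

open Bundle LineBundle Filter
open scoped unitInterval

variable {X : Type u} [TopologicalSpace X] {m : C(X × X, X)} {L : LineBundle.{u, v} (X × X)}

/-- A global section of `Q_J` is a continuous family of nonzero maps between lines, hence an
isomorphism of line bundles. -/
lemma isCompatible_of_section {φ : PhiIso m L} {r : RootPair (diagBundle L)}
    (s : C(X × X, RootCover φ r)) (hs : ∀ x, RootCover.proj φ r (s x) = x) :
    IsCompatible φ r := by
  obtain ⟨ξ, hξ, hξ'⟩ := exists_family_of_section s hs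
  obtain ⟨i, hi⟩ := exists_iso ξ (fun x ↦ (isRootCondition_squaresTo φ r).ne_zero (hξ x)) hξ'
  refine ⟨i, fun p ↦ ?_⟩
  rw [hi]
  exact hξ p

lemma exists_tripleSource_map {Z : Type u} [TopologicalSpace Z] {B : LineBundle.{u, v} Z} {z : Z}
    {J : LineBundle.{u, v} X} {p : I × X × X × X}
    (F : J.fiber p.2.1 → J.fiber p.2.2.1 → J.fiber p.2.2.2 → L.fiber (p.2.1, p.2.2.1) →
      L.fiber (p.2.1, p.2.2.2) → L.fiber (p.2.2.1, p.2.2.2) → B.fiber z)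
    (hF : ∀ (c₁ c₂ c₃ d₁ d₂ d₃ : ℂ) a₁ a₂ a₃ l₁₂ l₁₃ l₂₃,
      F (c₁ • a₁) (c₂ • a₂) (c₃ • a₃) (d₁ • l₁₂) (d₂ • l₁₃) (d₃ • l₂₃) =
        (c₁ * c₂ * c₃ * d₁ * d₂ * d₃) • F a₁ a₂ a₃ l₁₂ l₁₃ l₂₃) :
    ∃ ξ : (tripleSource L J).fiber p →ₗ[ℂ] B.fiber z, ∀ a₁ a₂ a₃ l₁₂ l₁₃ l₂₃,
      ξ (tripleElem a₁ a₂ a₃ l₁₂ l₁₃ l₂₃) = F a₁ a₂ a₃ l₁₂ l₁₃ l₂₃ := by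
  have h₁ := J.frame_ne_zero p.2.1 p.2.1
  have h₂ := J.frame_ne_zero p.2.2.1 p.2.2.1
  have h₃ := J.frame_ne_zero p.2.2.2 p.2.2.2
  have g₁ := L.frame_ne_zero (p.2.1, p.2.2.1) (p.2.1, p.2.2.1)
  have g₂ := L.frame_ne_zero (p.2.1, p.2.2.2) (p.2.1, p.2.2.2)
  have g₃ := L.frame_ne_zero (p.2.2.1, p.2.2.2) (p.2.2.1, p.2.2.2)
  obtain ⟨ξ, hξ⟩ := exists_linearMap (tripleSource L J) B (tripleElem_ne_zero h₁ h₂ h₃ g₁ g₂ g₃)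
    (F (J.frame p.2.1 p.2.1) (J.frame p.2.2.1 p.2.2.1) (J.frame p.2.2.2 p.2.2.2)
      (L.frame (p.2.1, p.2.2.1) (p.2.1, p.2.2.1)) (L.frame (p.2.1, p.2.2.2) (p.2.1, p.2.2.2))
      (L.frame (p.2.2.1, p.2.2.2) (p.2.2.1, p.2.2.2)))
  refine ⟨ξ, fun b₁ b₂ b₃ k₁ k₂ k₃ ↦ ?_⟩
  obtain ⟨c₁, rfl⟩ := J.exists_smul h₁ b₁
  obtain ⟨c₂, rfl⟩ := J.exists_smul h₂ b₂
  obtain ⟨c₃, rfl⟩ := J.exists_smul h₃ b₃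
  obtain ⟨d₁, rfl⟩ := L.exists_smul g₁ k₁
  obtain ⟨d₂, rfl⟩ := L.exists_smul g₂ k₂
  obtain ⟨d₃, rfl⟩ := L.exists_smul g₃ k₃
  rw [tripleElem_smul, map_smul, hξ, hF]

/-- The path `(i, γ)` in `[0, 1] × X`. -/
def constPair {Z : Type u} [TopologicalSpace Z] (i : I) {p : Z} (γ : Path p p) :
    Path (i, p) (i, p) :=
  (Path.refl i).prod γ

/-- The sign of a family along a loop in a slice `{i} × X³` that is given on pure tensors. -/
lemma assocClass_slice {h : C(I × X × X × X, X)} (r : RootPair (diagBundle L))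
    (ζ : Iso (assocSource L) ((diagBundle L).pullback h))
    {w : Hlg (I × X × X × X) 1 →ₗ[ZMod 2] ZMod 2}
    (hw : IsFirstStiefelWhitney (HomSubspace.proj _ _ (AssocSquaresTo r ζ)) w) (i : I)
    {p : X × X × X} (γ : Path p p) (g : X × X × X → X)
    (Φ : ∀ p : X × X × X, (diagBundle L).fiber p.1 → (diagBundle L).fiber p.2.1 →
      (diagBundle L).fiber p.2.2 → L.fiber (p.1, p.2.1) → L.fiber (p.1, p.2.2) →
      L.fiber (p.2.1, p.2.2) → (diagBundle L).fiber (g p))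
    (hΦ : ∀ p k₁ k₂ k₃ l₁₂ l₁₃ l₂₃,
      (⟨h (i, p), assocValue ζ (i, p) k₁ k₂ k₃ l₁₂ l₁₃ l₂₃⟩ : TotalSpace ℂ (diagBundle L).fiber) =
        ⟨g p, Φ p k₁ k₂ k₃ l₁₂ l₁₃ l₂₃⟩)
    (E : ∀ t, r.J.fiber (γ t).1 → r.J.fiber (γ t).2.1 → r.J.fiber (γ t).2.2 →
      L.fiber ((γ t).1, (γ t).2.1) → L.fiber ((γ t).1, (γ t).2.2) →
      L.fiber ((γ t).2.1, (γ t).2.2) → r.J.fiber (g (γ t)))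
    (hE : ∀ t (c₁ c₂ c₃ d₁ d₂ d₃ : ℂ) a₁ a₂ a₃ l₁₂ l₁₃ l₂₃,
      E t (c₁ • a₁) (c₂ • a₂) (c₃ • a₃) (d₁ • l₁₂) (d₂ • l₁₃) (d₃ • l₂₃) =
        (c₁ * c₂ * c₃ * d₁ * d₂ * d₃) • E t a₁ a₂ a₃ l₁₂ l₁₃ l₂₃)
    (hEΦ : ∀ t a₁ a₂ a₃ l₁₂ l₁₃ l₂₃, a₁ ≠ 0 → a₂ ≠ 0 → a₃ ≠ 0 → l₁₂ ≠ 0 → l₁₃ ≠ 0 → l₂₃ ≠ 0 →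
      r.sq (E t a₁ a₂ a₃ l₁₂ l₁₃ l₂₃) =
        Φ (γ t) (r.sq a₁) (r.sq a₂) (r.sq a₃) l₁₂ l₁₃ l₂₃)
    (hEc : ∀ t₀ a₁ a₂ a₃ l₁₂ l₁₃ l₂₃, SecAt r.J (fun t ↦ (γ t).1) a₁ t₀ →
      SecAt r.J (fun t ↦ (γ t).2.1) a₂ t₀ → SecAt r.J (fun t ↦ (γ t).2.2) a₃ t₀ →
      SecAt L (fun t ↦ ((γ t).1, (γ t).2.1)) l₁₂ t₀ →
      SecAt L (fun t ↦ ((γ t).1, (γ t).2.2)) l₁₃ t₀ →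
      SecAt L (fun t ↦ ((γ t).2.1, (γ t).2.2)) l₂₃ t₀ →
      SecAt r.J (fun t ↦ g (γ t)) (fun t ↦ E t (a₁ t) (a₂ t) (a₃ t) (l₁₂ t) (l₁₃ t) (l₂₃ t)) t₀)
    {k : ZMod 2} (a : ∀ x, r.J.fiber x) (ha : ∀ x, a x ≠ 0) (l : ∀ p, L.fiber p)
    (hl : ∀ p, l p ≠ 0) (c : ℂ)
    (h0 : E 0 (a _) (a _) (a _) (l _) (l _) (l _) = c • a (g (γ 0)))
    (h1 : E 1 (a _) (a _) (a _) (l _) (l _) (l _) = (sgn k * c) • a (g (γ 1))) :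
    w (loopClass (constPair i γ)) = k := by
  -- Equality in the total space also identifies base points; once `g` is eliminated, what remains
  -- is an equality within one fibre.
  obtain rfl : g = fun p ↦ h (i, p) :=
    funext fun p ↦ (congrArg TotalSpace.proj (hΦ p 0 0 0 0 0 0)).symm
  have hΦ' : ∀ p k₁ k₂ k₃ l₁₂ l₁₃ l₂₃,
      assocValue ζ (i, p) k₁ k₂ k₃ l₁₂ l₁₃ l₂₃ = Φ p k₁ k₂ k₃ l₁₂ l₁₃ l₂₃ :=
    fun p k₁ k₂ k₃ l₁₂ l₁₃ l₂₃ ↦ eq_of_heq (TotalSpace.mk.inj (hΦ p k₁ k₂ k₃ l₁₂ l₁₃ l₂₃)).2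
  have hR := isRootCondition_assoc r ζ
  -- The prescription `E` on pure tensors is multihomogeneous, so it comes from linear maps, which
  -- form the lift.
  choose ξ hξ using fun t ↦ exists_tripleSource_map (L := L) (p := (i, γ t)) (B := r.J) (E t) (hE t)
  have lift : IsLift (AssocSquaresTo r ζ) (constPair i γ).toContinuousMap ξ := by
    constructor
    · intro t
      refine (assocSquaresTo_iff r ζ (p := (i, γ t)) (ha _) (ha _) (ha _) (hl _) (hl _) (hl _)
        (ξ t)).2 ?_
      refine (congrArg (r.sq (x := h (i, γ t))) (hξ t _ _ _ _ _ _)).trans ?_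
      exact (hEΦ t _ _ _ _ _ _ (ha _) (ha _) (ha _) (hl _) (hl _) (hl _)).trans
        (hΦ' _ _ _ _ _ _ _).symm
    · intro t₀
      have hγ : ContinuousAt γ t₀ := γ.continuous.continuousAt
      have hγ' : ContinuousAt (constPair i γ) t₀ := (constPair i γ).continuous.continuousAt
      have d₁ : ContinuousAt (fun t ↦ (γ t).1) t₀ := hγ.fst
      have d₂ : ContinuousAt (fun t ↦ (γ t).2.1) t₀ := hγ.snd.fst
      have d₃ : ContinuousAt (fun t ↦ (γ t).2.2) t₀ := hγ.snd.snd
      have s₁ := r.J.secAt_frame (f := fun t ↦ (γ t).1) d₁ (r.J.mem_nbhd _)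
      have s₂ := r.J.secAt_frame (f := fun t ↦ (γ t).2.1) d₂ (r.J.mem_nbhd _)
      have s₃ := r.J.secAt_frame (f := fun t ↦ (γ t).2.2) d₃ (r.J.mem_nbhd _)
      have q₁ := L.secAt_frame (f := fun t ↦ ((γ t).1, (γ t).2.1)) (d₁.prodMk d₂) (L.mem_nbhd _)
      have q₂ := L.secAt_frame (f := fun t ↦ ((γ t).1, (γ t).2.2)) (d₁.prodMk d₃) (L.mem_nbhd _)
      have q₃ := L.secAt_frame (f := fun t ↦ ((γ t).2.1, (γ t).2.2)) (d₂.prodMk d₃) (L.mem_nbhd _)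
      refine morAt_of_frame (secAt_tripleElem (f := fun t ↦ (i, γ t)) hγ' s₁ s₂ s₃ q₁ q₂ q₃)
        (.of_forall fun t ↦ tripleElem_ne_zero (p := (i, γ t)) (r.J.frame_ne_zero _ _)
          (r.J.frame_ne_zero _ _) (r.J.frame_ne_zero _ _) (L.frame_ne_zero _ _)
          (L.frame_ne_zero _ _) (L.frame_ne_zero _ _)) ?_
      refine SecAt.pullback (A := r.J) (g := h) ?_ hγ'
      exact SecAt.congr (hEc t₀ _ _ _ _ _ _ s₁ s₂ s₃ q₁ q₂ q₃)
        (.of_forall fun t ↦ (hξ t _ _ _ _ _ _).symm)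
  have h0' := (hξ 0 _ _ _ _ _ _).trans h0
  have h1' := (hξ 1 _ _ _ _ _ _).trans h1
  refine lift.eq_sign hR hw (fun p ↦ tripleElem (p := p) (a _) (a _) (a _) (l _) (l _) (l _))
    (fun p ↦ a (h p)) (fun p ↦ ha _) (c := c) ?_ h0' h1'
  intro hc
  rw [hc, zero_smul] at h0'
  exact hR.ne_zero (lift.1 0) (linearMap_ext (tripleElem_ne_zero (p := (i, γ 0)) (ha _) (ha _)
    (ha _) (hl _) (hl _) (hl _)) h0')

lemma ChiIso.app_smul (χ : ChiIso m L) {x y z : X} (c d : ℂ) (k : L.fiber (x, z))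
    (k' : L.fiber (y, z)) : χ.app (c • k) (d • k') = (c * d) • χ.app k k' :=
  (congrArg (χ.equiv (x, y, z)) (tmul_smul_smul (A := L.pullback pr13) (B := L.pullback pr23)
    (x := (x, y, z)) c d k k')).trans (map_smul (χ.equiv (x, y, z)) _ _)

lemma ChiIso.secAt_app (χ : ChiIso m L) {T : Type*} [TopologicalSpace T] {f : T → X × X × X}
    {k : ∀ t, L.fiber ((f t).1, (f t).2.2)} {k' : ∀ t, L.fiber ((f t).2.1, (f t).2.2)} {t₀ : T}
    (hf : ContinuousAt f t₀) (h : SecAt L (fun t ↦ ((f t).1, (f t).2.2)) k t₀)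
    (h' : SecAt L (fun t ↦ ((f t).2.1, (f t).2.2)) k' t₀) :
    SecAt L (fun t ↦ mulId m (f t)) (fun t ↦ χ.app (k t) (k' t)) t₀ := by
  have h1 : SecAt (L.pullback pr13) f k t₀ := h.pullback hf
  have h2 : SecAt (L.pullback pr23) f k' t₀ := h'.pullback hf
  exact (secAt_pullback.1 ((h1.tmul h2).iso χ)).2

lemma PsiIso.app_smul (ψ : PsiIso m L) {x y z : X} (c d : ℂ) (k : L.fiber (x, y))
    (k' : L.fiber (x, z)) : ψ.app (c • k) (d • k') = (c * d) • ψ.app k k' :=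
  (congrArg (ψ.equiv (x, y, z)) (tmul_smul_smul (A := L.pullback pr12) (B := L.pullback pr13)
    (x := (x, y, z)) c d k k')).trans (map_smul (ψ.equiv (x, y, z)) _ _)

lemma PsiIso.secAt_app (ψ : PsiIso m L) {T : Type*} [TopologicalSpace T] {f : T → X × X × X}
    {k : ∀ t, L.fiber ((f t).1, (f t).2.1)} {k' : ∀ t, L.fiber ((f t).1, (f t).2.2)} {t₀ : T}
    (hf : ContinuousAt f t₀) (h : SecAt L (fun t ↦ ((f t).1, (f t).2.1)) k t₀)
    (h' : SecAt L (fun t ↦ ((f t).1, (f t).2.2)) k' t₀) :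
    SecAt L (fun t ↦ idMul m (f t)) (fun t ↦ ψ.app (k t) (k' t)) t₀ := by
  have h1 : SecAt (L.pullback pr12) f k t₀ := h.pullback hf
  have h2 : SecAt (L.pullback pr13) f k' t₀ := h'.pullback hf
  exact (secAt_pullback.1 ((h1.tmul h2).iso ψ)).2

/-- A lift of a path to `Q_J`, applied to `a ⊗ b ⊗ l`. -/
abbrev liftApp {r : RootPair (diagBundle L)} {p : X × X}
    (ξ : (rootSource L r.J).fiber p →ₗ[ℂ] (r.J.pullback m).fiber p) (a : r.J.fiber p.1)
    (b : r.J.fiber p.2) (l : L.fiber p) : r.J.fiber (m p) :=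
  ξ (rootElem (J := r.J) a b l)

lemma liftApp_smul {r : RootPair (diagBundle L)} {p : X × X}
    (ξ : (rootSource L r.J).fiber p →ₗ[ℂ] (r.J.pullback m).fiber p) (c d e : ℂ)
    (a : r.J.fiber p.1) (b : r.J.fiber p.2) (l : L.fiber p) :
    liftApp ξ (c • a) (d • b) (e • l) = (c * d * e) • liftApp ξ a b l :=
  (congrArg ξ (rootElem_smul c d e a b l)).trans (ξ.map_smul _ _)

lemma sq_liftApp {φ : PhiIso m L} {r : RootPair (diagBundle L)} {p : X × X}
    {ξ : (rootSource L r.J).fiber p →ₗ[ℂ] (r.J.pullback m).fiber p} (hξ : SquaresTo φ r p ξ)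
    (a : r.J.fiber p.1) (b : r.J.fiber p.2) (l : L.fiber p) :
    r.sq (liftApp ξ a b l) = φ.app (r.sq a) (r.sq b) l l := hξ a a b b l l

lemma IsLift.secAt_liftApp {φ : PhiIso m L} {r : RootPair (diagBundle L)} {f : C(I, X × X)}
    {ξ : ∀ t, (rootSource L r.J).fiber (f t) →ₗ[ℂ] (r.J.pullback m).fiber (f t)}
    (hξ : IsLift (SquaresTo φ r) f ξ) {t₀ : I} {a : ∀ t, r.J.fiber (f t).1}
    {b : ∀ t, r.J.fiber (f t).2} {l : ∀ t, L.fiber (f t)}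
    (ha : SecAt r.J (fun t ↦ (f t).1) a t₀) (hb : SecAt r.J (fun t ↦ (f t).2) b t₀)
    (hl : SecAt L f l t₀) :
    SecAt r.J (fun t ↦ m (f t)) (fun t ↦ liftApp (ξ t) (a t) (b t) (l t)) t₀ :=
  (secAt_pullback.1 (hξ.2 t₀ _ (secAt_rootElem ha hb hl))).2

/-- The class `w₃` of the associativity cover takes the same value on `{0} × γ` and `{1} × γ`. Over
the first loop a lift is `ξ₂ ∘ (ξ₁ ⊗ id ⊗ χ)`, over the second `η₂ ∘ (id ⊗ η₁ ⊗ ψ)`, with lifts to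
`Q_J` along the four loops of the statement. -/
lemma rootClass_assoc {φ : PhiIso m L} {χ : ChiIso m L} {ψ : PsiIso m L}
    (hassoc : IsAssociative φ χ ψ) {r : RootPair (diagBundle L)}
    {w : Hlg (X × X) 1 →ₗ[ZMod 2] ZMod 2} (hw : IsFirstStiefelWhitney (RootCover.proj φ r) w)
    {p : X × X × X} (γ : Path p p) :
    w (loopClass (γ.map (mulId m).continuous)) + w (loopClass (γ.map pr12.continuous)) =
      w (loopClass (γ.map (idMul m).continuous)) + w (loopClass (γ.map pr23.continuous)) := by
  obtain ⟨h, ζ, H⟩ := hassoc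
  have hQ := isRootCondition_squaresTo φ r
  obtain ⟨w₃, hw₃⟩ := (isRootCondition_assoc r ζ).isDoubleCover.exists_isFirstStiefelWhitney
  obtain ⟨ξ₁, hξ₁⟩ := hQ.exists_isLift (γ.map pr12.continuous).toContinuousMap
  obtain ⟨ξ₂, hξ₂⟩ := hQ.exists_isLift (γ.map (mulId m).continuous).toContinuousMap
  obtain ⟨η₁, hη₁⟩ := hQ.exists_isLift (γ.map pr23.continuous).toContinuousMap
  obtain ⟨η₂, hη₂⟩ := hQ.exists_isLift (γ.map (idMul m).continuous).toContinuousMap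
  let a : ∀ x, r.J.fiber x := fun x ↦ r.J.frame x x
  let l : ∀ p, L.fiber p := fun p ↦ L.frame p p
  have ha : ∀ x, a x ≠ 0 := fun x ↦ r.J.frame_ne_zero x x
  have hl : ∀ p, l p ≠ 0 := fun p ↦ L.frame_ne_zero p p
  have hγ : ∀ t, ContinuousAt γ t := fun t ↦ γ.continuous.continuousAt
  have hγ01 : γ 0 = γ 1 := by rw [γ.source, γ.target]
  -- The free homotopy moves the interval coordinate from `0` to `1`.
  have hh : w₃ (loopClass (constPair 0 γ)) = w₃ (loopClass (constPair 1 γ)) :=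
    functional_free_homotopy w₃ ⟨fun q ↦ (q.1, γ q.2), by fun_prop⟩ (fun t ↦ rfl) (fun t ↦ rfl)
      (fun t ↦ Prod.ext rfl hγ01)
  have e₀ : w₃ (loopClass (constPair 0 γ)) = w (loopClass (γ.map (mulId m).continuous)) +
      w (loopClass (γ.map pr12.continuous)) := by
    -- The coefficient of `χ` in the frames is a function of the point alone, so it agrees at the
    -- two ends of the loop and adds no sign.
    choose e he using fun q : X × X × X ↦ L.exists_smul (hl (mulId m q))
      (χ.app (l (q.1, q.2.2)) (l (q.2.1, q.2.2)))
    obtain ⟨c, hc⟩ := r.J.exists_smul (ha (m (pr12 (γ 0))))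
      (liftApp (r := r) (p := pr12 (γ 0)) (ξ₁ 0) (a _) (a _) (l _))
    obtain ⟨d, hd⟩ := r.J.exists_smul (ha (m (mulId m (γ 0))))
      (liftApp (r := r) (p := mulId m (γ 0)) (ξ₂ 0) (a _) (a _) (l _))
    have hc' := hξ₁.hasSign hQ hw (fun p ↦ rootElem (J := r.J) (a p.1) (a p.2) (l p))
      (fun p ↦ a (m p)) c hc
    have hd' := hξ₂.hasSign hQ hw (fun p ↦ rootElem (J := r.J) (a p.1) (a p.2) (l p))
      (fun p ↦ a (m p)) d hd
    -- The coefficient of the composite is the product of those of `ξ₁`, `χ` and `ξ₂`; the unchanged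
    -- third vector enters with coefficient `1`.
    have val : ∀ (t : I) (x y : ℂ),
        liftApp (r := r) (p := pr12 (γ t)) (ξ₁ t) (a _) (a _) (l _) = x • a (m (pr12 (γ t))) →
        liftApp (r := r) (p := mulId m (γ t)) (ξ₂ t) (a _) (a _) (l _) =
          y • a (m (mulId m (γ t))) →
        liftApp (r := r) (p := mulId m (γ t)) (ξ₂ t)
          (liftApp (r := r) (p := pr12 (γ t)) (ξ₁ t) (a _) (a _) (l _)) (a (γ t).2.2)
          (χ.app (l ((γ t).1, (γ t).2.2)) (l ((γ t).2.1, (γ t).2.2))) =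
          (x * e (γ t) * y) • a (m (mulId m (γ t))) := by
      intro t x y hx hy
      refine (congrArg₂ (fun s s' ↦ liftApp (r := r) (p := mulId m (γ t)) (ξ₂ t) s (a (γ t).2.2)
        s') hx (he (γ t))).trans ?_
      have := liftApp_smul (r := r) (p := mulId m (γ t)) (ξ₂ t) x 1 (e (γ t)) (a _) (a (γ t).2.2)
        (l _)
      refine (congrArg (fun s ↦ liftApp (r := r) (p := mulId m (γ t)) (ξ₂ t) (x • a _) s
        (e (γ t) • l _)) (one_smul ℂ (a (γ t).2.2)).symm).trans (this.trans ?_)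
      rw [mul_one]
      exact (congrArg _ hy).trans (smul_smul _ _ _)
    -- On the slice `0` the isomorphism `ζ` is the left bracketing of `φ`, whose square root is the
    -- composite of lifts.
    refine assocClass_slice r ζ hw₃ 0 γ (fun q ↦ m (mulId m q))
      (fun q k₁ k₂ k₃ l₁₂ l₁₃ l₂₃ ↦ φ.app (φ.app k₁ k₂ l₁₂ l₁₂) k₃ (χ.app l₁₃ l₂₃)
        (χ.app l₁₃ l₂₃)) (fun q k₁ k₂ k₃ l₁₂ l₁₃ l₂₃ ↦ (H _ _ _ k₁ k₂ k₃ l₁₂ l₁₂ l₁₃ l₁₃ l₂₃ l₂₃).1)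
      (fun t a₁ a₂ a₃ l₁₂ l₁₃ l₂₃ ↦ liftApp (r := r) (p := mulId m (γ t)) (ξ₂ t)
        (liftApp (r := r) (p := pr12 (γ t)) (ξ₁ t) a₁ a₂ l₁₂) a₃ (χ.app l₁₃ l₂₃))
      ?_ ?_ ?_ a ha l hl (c * e (γ 0) * d) ?_ ?_
    · intro t c₁ c₂ c₃ d₁ d₂ d₃ a₁ a₂ a₃ l₁₂ l₁₃ l₂₃
      refine (congrArg₂ (fun s s' ↦ liftApp (r := r) (p := mulId m (γ t)) (ξ₂ t) s (c₃ • a₃)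
        s') (liftApp_smul (r := r) (p := pr12 (γ t)) (ξ₁ t) c₁ c₂ d₁ a₁ a₂ l₁₂)
        (χ.app_smul d₂ d₃ l₁₃ l₂₃)).trans ?_
      refine (liftApp_smul (r := r) (p := mulId m (γ t)) (ξ₂ t) _ _ _ _ _ _).trans ?_
      refine congrArg (fun z : ℂ ↦ z • _) ?_
      ring
    · intro t a₁ a₂ a₃ l₁₂ l₁₃ l₂₃ h₁ h₂ h₃ g₁ g₂ g₃
      refine (sq_liftApp (φ := φ) (r := r) (p := mulId m (γ t)) (hξ₂.1 t) _ _ _).trans ?_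
      exact congrArg (fun s ↦ φ.app s (r.sq a₃) (χ.app l₁₃ l₂₃) (χ.app l₁₃ l₂₃))
        (sq_liftApp (φ := φ) (r := r) (p := pr12 (γ t)) (hξ₁.1 t) _ _ _)
    · intro t₀ a₁ a₂ a₃ l₁₂ l₁₃ l₂₃ h₁ h₂ h₃ g₁ g₂ g₃
      exact hξ₂.secAt_liftApp (hξ₁.secAt_liftApp h₁ h₂ g₁) h₃ (χ.secAt_app (hγ t₀) g₂ g₃)
    · exact val 0 c d hc hd
    · refine (val 1 _ _ hc' hd').trans (congrArg (fun z : ℂ ↦ z • _) ?_)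
      rw [← hγ01, sgn_add]
      ring
  have e₁ : w₃ (loopClass (constPair 1 γ)) = w (loopClass (γ.map (idMul m).continuous)) +
      w (loopClass (γ.map pr23.continuous)) := by
    -- The mirror image at the end `1`: `ψ` replaces `χ`, and the inner lift occupies the second
    -- slot.
    choose e he using fun q : X × X × X ↦ L.exists_smul (hl (idMul m q))
      (ψ.app (l (q.1, q.2.1)) (l (q.1, q.2.2)))
    obtain ⟨c, hc⟩ := r.J.exists_smul (ha (m (pr23 (γ 0))))
      (liftApp (r := r) (p := pr23 (γ 0)) (η₁ 0) (a _) (a _) (l _))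
    obtain ⟨d, hd⟩ := r.J.exists_smul (ha (m (idMul m (γ 0))))
      (liftApp (r := r) (p := idMul m (γ 0)) (η₂ 0) (a _) (a _) (l _))
    have hc' := hη₁.hasSign hQ hw (fun p ↦ rootElem (J := r.J) (a p.1) (a p.2) (l p))
      (fun p ↦ a (m p)) c hc
    have hd' := hη₂.hasSign hQ hw (fun p ↦ rootElem (J := r.J) (a p.1) (a p.2) (l p))
      (fun p ↦ a (m p)) d hd
    have val : ∀ (t : I) (x y : ℂ),
        liftApp (r := r) (p := pr23 (γ t)) (η₁ t) (a _) (a _) (l _) = x • a (m (pr23 (γ t))) →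
        liftApp (r := r) (p := idMul m (γ t)) (η₂ t) (a _) (a _) (l _) =
          y • a (m (idMul m (γ t))) →
        liftApp (r := r) (p := idMul m (γ t)) (η₂ t) (a (γ t).1)
          (liftApp (r := r) (p := pr23 (γ t)) (η₁ t) (a _) (a _) (l _))
          (ψ.app (l ((γ t).1, (γ t).2.1)) (l ((γ t).1, (γ t).2.2))) =
          (x * e (γ t) * y) • a (m (idMul m (γ t))) := by
      intro t x y hx hy
      refine (congrArg₂ (fun s s' ↦ liftApp (r := r) (p := idMul m (γ t)) (η₂ t) (a (γ t).1) s
        s') hx (he (γ t))).trans ?_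
      have := liftApp_smul (r := r) (p := idMul m (γ t)) (η₂ t) 1 x (e (γ t)) (a (γ t).1) (a _)
        (l _)
      refine (congrArg (fun s ↦ liftApp (r := r) (p := idMul m (γ t)) (η₂ t) s (x • a _)
        (e (γ t) • l _)) (one_smul ℂ (a (γ t).1)).symm).trans (this.trans ?_)
      rw [one_mul]
      exact (congrArg _ hy).trans (smul_smul _ _ _)
    refine assocClass_slice r ζ hw₃ 1 γ (fun q ↦ m (idMul m q))
      (fun q k₁ k₂ k₃ l₁₂ l₁₃ l₂₃ ↦ φ.app k₁ (φ.app k₂ k₃ l₂₃ l₂₃) (ψ.app l₁₂ l₁₃)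
        (ψ.app l₁₂ l₁₃)) (fun q k₁ k₂ k₃ l₁₂ l₁₃ l₂₃ ↦ (H _ _ _ k₁ k₂ k₃ l₁₂ l₁₂ l₁₃ l₁₃ l₂₃ l₂₃).2)
      (fun t a₁ a₂ a₃ l₁₂ l₁₃ l₂₃ ↦ liftApp (r := r) (p := idMul m (γ t)) (η₂ t) a₁
        (liftApp (r := r) (p := pr23 (γ t)) (η₁ t) a₂ a₃ l₂₃) (ψ.app l₁₂ l₁₃))
      ?_ ?_ ?_ a ha l hl (c * e (γ 0) * d) ?_ ?_
    · intro t c₁ c₂ c₃ d₁ d₂ d₃ a₁ a₂ a₃ l₁₂ l₁₃ l₂₃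
      refine (congrArg₂ (fun s s' ↦ liftApp (r := r) (p := idMul m (γ t)) (η₂ t) (c₁ • a₁) s
        s') (liftApp_smul (r := r) (p := pr23 (γ t)) (η₁ t) c₂ c₃ d₃ a₂ a₃ l₂₃)
        (ψ.app_smul d₁ d₂ l₁₂ l₁₃)).trans ?_
      refine (liftApp_smul (r := r) (p := idMul m (γ t)) (η₂ t) _ _ _ _ _ _).trans ?_
      refine congrArg (fun z : ℂ ↦ z • _) ?_
      ring
    · intro t a₁ a₂ a₃ l₁₂ l₁₃ l₂₃ h₁ h₂ h₃ g₁ g₂ g₃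
      refine (sq_liftApp (φ := φ) (r := r) (p := idMul m (γ t)) (hη₂.1 t) _ _ _).trans ?_
      exact congrArg (fun s ↦ φ.app (r.sq a₁) s (ψ.app l₁₂ l₁₃) (ψ.app l₁₂ l₁₃))
        (sq_liftApp (φ := φ) (r := r) (p := pr23 (γ t)) (hη₁.1 t) _ _ _)
    · intro t₀ a₁ a₂ a₃ l₁₂ l₁₃ l₂₃ h₁ h₂ h₃ g₁ g₂ g₃
      exact hη₂.secAt_liftApp h₁ (hη₁.secAt_liftApp h₂ h₃ g₃) (ψ.secAt_app (hγ t₀) g₁ g₂)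
    · exact val 0 c d hc hd
    · refine (val 1 _ _ hc' hd').trans (congrArg (fun z : ℂ ↦ z • _) ?_)
      rw [← hγ01, sgn_add]
      ring
  rw [← e₀, ← e₁, hh]

end Associativity

/-! ### Local primitives of cocycles on locally contractible spaces. -/

section LocalPrimitives

open Filter
open scoped unitInterval

/-- Contracting `V` inside `u` moves every point of `V` to `p` along a path in `u`, so any two
points of `V` are joined in `u`. -/
lemma locallyPathConnectedSpace_of_locallyContractibleSpace {Y : Type*} [TopologicalSpace Y]
    (h : LocallyContractibleSpace Y) : LocallyPathConnectedSpace Y := by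
  rw [locallyPathConnectedSpace_iff_pathComponentIn_mem_nhds]
  intro x u hu hx
  obtain ⟨V, hVU, hV, p, ⟨H⟩⟩ := h x u (hu.mem_nhds hx)
  have hj : ∀ z (hz : z ∈ V), JoinedIn u z p := fun z hz ↦
    ⟨⟨⟨fun t ↦ (H (t, ⟨z, hz⟩)).1, by fun_prop⟩, congrArg Subtype.val (H.apply_zero _),
      congrArg Subtype.val (H.apply_one _)⟩, fun t ↦ (H (t, ⟨z, hz⟩)).2⟩
  exact mem_of_superset hV fun z hz ↦ (hj x (mem_of_mem_nhds hV)).trans (hj z hz).symm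

/-- The primitive at `z` is the value on the track of `z` under a null-homotopy of `V` in `Y`.
Applying the null-homotopy to a path in `V` gives a square whose far side is constant. The value of
`κ` outside `V` plays no role. -/
lemma IsCocycleOne.exists_local_primitive {Y : Type u} [TopologicalSpace Y]
    (h : LocallyContractibleSpace Y) {c : TopCat.toSSet.obj (TopCat.of Y) _⦋1⦌ → ZMod 2}
    (hc : IsCocycleOne c) (y : Y) : ∃ V : Set Y, IsOpen V ∧ y ∈ V ∧ ∃ κ : Y → ZMod 2,
      ∀ f : C(I, Y), (∀ t, f t ∈ V) → onPath c f = κ (f 0) + κ (f 1) := by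
  classical
  obtain ⟨V, hVU, hV, p, ⟨H⟩⟩ := h y Set.univ univ_mem
  let track : V → C(I, Y) := fun z ↦ ⟨fun t ↦ (H (t, z)).1, by fun_prop⟩
  refine ⟨interior V, isOpen_interior, mem_interior_iff_mem_nhds.2 hV,
    fun z ↦ if hz : z ∈ V then onPath c (track ⟨z, hz⟩) else 0, fun f hf ↦ ?_⟩
  have hfV : ∀ t, f t ∈ V := fun t ↦ interior_subset (hf t)
  let f' : C(I, V) := ⟨fun t ↦ ⟨f t, hfV t⟩, by fun_prop⟩
  have := hc.square (⟨fun q : I × I ↦ (H (q.1, f' q.2)).1, by fun_prop⟩ : C(I × I, Y))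
    (f₀ := f) (f₁ := ContinuousMap.const I p.1) (g₀ := track (f' 0)) (g₁ := track (f' 1))
    (fun t ↦ (congrArg Subtype.val (H.apply_zero (f' t))).symm)
    (fun t ↦ (congrArg Subtype.val (H.apply_one (f' t))).symm) (fun t ↦ rfl) (fun t ↦ rfl)
  rw [hc.const, add_zero] at this
  dsimp only
  rw [dif_pos (hfV 0), dif_pos (hfV 1)]
  generalize onPath c f = a at *
  change a = onPath c (track (f' 0)) + onPath c (track (f' 1))
  rw [← this, add_assoc, CharTwo.add_self_eq_zero, add_zero]

/-- The pullback of a cochain along a continuous map. -/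
def cochainMap {Y Z : Type u} [TopologicalSpace Y] [TopologicalSpace Z] (g : C(Y, Z))
    (c : TopCat.toSSet.obj (TopCat.of Z) _⦋1⦌ → ZMod 2) :
    TopCat.toSSet.obj (TopCat.of Y) _⦋1⦌ → ZMod 2 :=
  fun s ↦ c ((TopCat.toSSet.map (TopCat.ofHom g)).app _ s)

lemma onPath_cochainMap {Y Z : Type u} [TopologicalSpace Y] [TopologicalSpace Z] (g : C(Y, Z))
    (c : TopCat.toSSet.obj (TopCat.of Z) _⦋1⦌ → ZMod 2) (f : C(I, Y)) :
    onPath (cochainMap g c) f = onPath c (g.comp f) := rfl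

lemma IsCocycleOne.cochainMap {Y Z : Type u} [TopologicalSpace Y] [TopologicalSpace Z]
    (g : C(Y, Z)) {c : TopCat.toSSet.obj (TopCat.of Z) _⦋1⦌ → ZMod 2} (hc : IsCocycleOne c) :
    IsCocycleOne (cochainMap g c) := fun s ↦
  hc ((TopCat.toSSet.map (TopCat.ofHom g)).app _ s)

/-- An open neighbourhood of every point with a function to `ℤ/2`, such that the sum of any two of
the functions is locally constant. -/
structure SignCocycle (X : Type u) [TopologicalSpace X] where
  /-- the neighbourhood -/
  nhd : X → Set X
  isOpen_nhd : ∀ x, IsOpen (nhd x)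
  mem_nhd : ∀ x, x ∈ nhd x
  /-- the function -/
  fn : X → X → ZMod 2
  locallyConst : ∀ x y, ∀ z ∈ nhd x ∩ nhd y, ∀ᶠ z' in 𝓝 z, fn x z' + fn y z' = fn x z + fn y z

/-- The cocycle is pulled back along `X → Y → X`. This does not change its values on loops, and it
makes the local primitives on `Y` available on `X`. Two primitives of one cocycle differ by a
locally constant function because `Y` is locally path-connected. -/
lemma exists_signCocycle {X : Type u} [TopologicalSpace X] {Y : Type u} [TopologicalSpace Y]
    (hY : LocallyContractibleSpace Y) (e : ContinuousMap.HomotopyEquiv X Y)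
    (w : Hlg X 1 →ₗ[ZMod 2] ZMod 2) :
    ∃ c : TopCat.toSSet.obj (TopCat.of X) _⦋1⦌ → ZMod 2, IsCocycleOne c ∧
      (∀ (x : X) (γ : Path x x), onPath c γ.toContinuousMap = w (loopClass γ)) ∧
      ∃ s : SignCocycle X, ∀ (x : X) (f : C(I, X)), (∀ t, f t ∈ s.nhd x) →
        onPath c f = s.fn x (f 0) + s.fn x (f 1) := by
  obtain ⟨c, hc, hcw, -⟩ := exists_cocycleOne w
  have hc' := hc.cochainMap e.invFun
  choose V hV hyV κ hκ using fun y ↦ hc'.exists_local_primitive hY y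
  have := locallyPathConnectedSpace_of_locallyContractibleSpace hY
  refine ⟨cochainMap (e.invFun.comp e.toFun) c, hc.cochainMap _, fun x γ ↦ ?_,
    ⟨fun x ↦ e.toFun ⁻¹' V (e.toFun x), fun x ↦ (hV _).preimage e.toFun.continuous,
      fun x ↦ hyV _, fun x z ↦ κ (e.toFun x) (e.toFun z), ?_⟩, ?_⟩
  · rw [← hcw, onPath_cochainMap]
    obtain ⟨H⟩ := e.left_inv
    -- The loop and its image under `X → Y → X` are freely homotopic by the homotopy to the
    -- identity.
    refine hc.free_homotopy (f₀ := (e.invFun.comp e.toFun).comp γ.toContinuousMap)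
      (f₁ := γ.toContinuousMap) (H.toContinuousMap.comp
      ((ContinuousMap.id I).prodMap γ.toContinuousMap)) (fun t ↦ (H.apply_zero _).symm)
      (fun t ↦ (H.apply_one _).symm) fun t ↦ ?_
    change H (t, γ 0) = H (t, γ 1)
    rw [γ.source, γ.target]
  · rintro x y z ⟨hx, hy⟩
    -- Both primitives compute the value of the cocycle on a path inside the overlap, so their sum
    -- is the same at its two ends.
    obtain ⟨W, ⟨hW, hWc⟩, hWV⟩ := (path_connected_basis (e.toFun z)).mem_iff.mp
      (((hV (e.toFun x)).inter (hV (e.toFun y))).mem_nhds ⟨hx, hy⟩)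
    filter_upwards [e.toFun.continuous.continuousAt.eventually_mem hW] with z' hz'
    obtain ⟨γ, hγ⟩ := hWc.joinedIn _ (mem_of_mem_nhds hW) _ hz'
    have h1 := hκ (e.toFun x) γ.toContinuousMap fun t ↦ (hWV (hγ t)).1
    have h2 := hκ (e.toFun y) γ.toContinuousMap fun t ↦ (hWV (hγ t)).2
    have h3 : γ.toContinuousMap 0 = e.toFun z := γ.source
    have h4 : γ.toContinuousMap 1 = e.toFun z' := γ.target
    rw [h3, h4] at h1 h2
    have h5 := h1.symm.trans h2
    generalize κ (e.toFun x) (e.toFun z) = a at *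
    generalize κ (e.toFun x) (e.toFun z') = a' at *
    generalize κ (e.toFun y) (e.toFun z) = b at *
    generalize κ (e.toFun y) (e.toFun z') = b' at *
    clear h1 h2
    revert h5 a a' b b'
    decide
  · intro x f hf
    exact hκ (e.toFun x) (e.toFun.comp f) hf

end LocalPrimitives

/-! ### Twisting a square root by signs, and realization of all difference classes. -/

section Twist

open Bundle LineBundle Filter
open scoped unitInterval

variable {X : Type u} [TopologicalSpace X]

namespace LineBundle

lemma coord_smul_frame (A : LineBundle.{u, v} X) {x y : X} (hy : y ∈ A.nbhd x) (a : A.fiber y) :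
    A.coord x y a • A.frame x y = a := by
  obtain ⟨c, rfl⟩ := A.exists_smul (A.frame_ne_zero x y) a
  rw [map_smul, A.coord_frame hy, smul_eq_mul, mul_one]

lemma continuousAt_coord_frame (A : LineBundle.{u, v} X) (x y : X) {z : X} (hx : z ∈ A.nbhd x)
    (hy : z ∈ A.nbhd y) : ContinuousAt (fun z ↦ A.coord y z (A.frame x z)) z :=
  ((secAt_iff_nbhd (f := id) hy).1 (A.secAt_frame (f := id) continuousAt_id hx)).2

/-- The preferred pretrivialization at `x`, with the sign changed. -/
def twistPretriv (A : LineBundle.{u, v} X) (s : SignCocycle X) (x : X) :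
    Pretrivialization ℂ (π ℂ A.fiber) where
  toFun p := ⟨p.1, sgn (s.fn x p.1) * A.coord x p.1 p.2⟩
  invFun p := ⟨p.1, (sgn (s.fn x p.1) * p.2) • A.frame x p.1⟩
  source := TotalSpace.proj ⁻¹' (s.nhd x ∩ A.nbhd x)
  target := (s.nhd x ∩ A.nbhd x) ×ˢ Set.univ
  map_source' := fun ⟨_, _⟩ h ↦ ⟨h, Set.mem_univ _⟩
  map_target' := fun ⟨_, _⟩ h ↦ h.1
  left_inv' := fun ⟨y, a⟩ h ↦ by
    simp only [TotalSpace.mk_inj]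
    rw [← mul_assoc, sgn_mul_self, one_mul, A.coord_smul_frame h.2]
  right_inv' := fun ⟨y, c⟩ h ↦ by
    simp only [Prod.mk.injEq, true_and]
    rw [map_smul, A.coord_frame h.1.2, smul_eq_mul, mul_one, ← mul_assoc, sgn_mul_self, one_mul]
  open_target := ((s.isOpen_nhd x).inter (A.isOpen_nbhd x)).prod isOpen_univ
  baseSet := s.nhd x ∩ A.nbhd x
  open_baseSet := (s.isOpen_nhd x).inter (A.isOpen_nbhd x)
  source_eq := rfl
  target_eq := rfl
  proj_toFun _ _ := rfl

/-- The topology on the fibres of a twisted line bundle. -/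
@[reducible]
def twistFiberTopology (A : LineBundle.{u, v} X) (s : SignCocycle X) (x : X) :
    TopologicalSpace (A.fiber x) :=
  TopologicalSpace.induced
    (twistPretriv A s x ∘ TotalSpace.mk (F := ℂ) (E := A.fiber) x) inferInstance

/-- A line bundle twisted by signs, as a vector prebundle. -/
def twistPrebundle (A : LineBundle.{u, v} X) (s : SignCocycle X) :
    letI := twistFiberTopology A s
    VectorPrebundle ℂ ℂ A.fiber :=
  letI := twistFiberTopology A s
  { pretrivializationAtlas := Set.range (twistPretriv A s)
    pretrivialization_linear' := by
      rintro _ ⟨x, rfl⟩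
      exact ⟨fun y _ ↦
        { map_add := fun a b ↦ by
            change sgn _ * A.coord x y (a + b) = sgn _ * A.coord x y a + sgn _ * A.coord x y b
            rw [map_add, mul_add]
          map_smul := fun c a ↦ by
            change sgn _ * A.coord x y (c • a) = c • (sgn _ * A.coord x y a)
            rw [map_smul, smul_eq_mul, smul_eq_mul, mul_left_comm] }⟩
    pretrivializationAt := twistPretriv A s
    mem_base_pretrivializationAt := fun x ↦ ⟨s.mem_nhd x, A.mem_nbhd x⟩
    pretrivialization_mem_atlas := fun x ↦ ⟨x, rfl⟩
    exists_coordChange := by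
      rintro _ ⟨x, rfl⟩ _ ⟨y, rfl⟩
      -- The individual signs need not be continuous. A coordinate change involves only the product
      -- of two of them, which is locally constant.
      refine ⟨fun z ↦ (sgn (s.fn x z + s.fn y z) * A.coord y z (A.frame x z)) •
        ContinuousLinearMap.id ℂ ℂ, ?_, ?_⟩
      · rintro z ⟨hx, hy⟩
        refine ContinuousAt.continuousWithinAt (ContinuousAt.smul (ContinuousAt.mul ?_
          (A.continuousAt_coord_frame x y hx.2 hy.2)) continuousAt_const)
        refine continuousAt_const.congr (f := fun _ ↦ sgn (s.fn x z + s.fn y z)) ?_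
        filter_upwards [s.locallyConst x y z ⟨hx.1, hy.1⟩] with z' hz'
        rw [hz']
      · rintro z ⟨hx, hy⟩ c
        rw [Pretrivialization.symm_apply _ hx]
        change (sgn (s.fn x z + s.fn y z) * A.coord y z (A.frame x z)) • c =
          sgn (s.fn y z) * A.coord y z ((sgn (s.fn x z) * c) • A.frame x z)
        rw [map_smul, sgn_add, smul_eq_mul, smul_eq_mul]
        ring
    totalSpaceMk_isInducing := fun _ ↦ ⟨rfl⟩ }

/-- A line bundle twisted by signs. -/
def twist (A : LineBundle.{u, v} X) (s : SignCocycle X) : LineBundle.{u, v} X :=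
  letI := twistFiberTopology A s
  letI := (twistPrebundle A s).totalSpaceTopology
  letI := (twistPrebundle A s).toFiberBundle
  { fiber := A.fiber
    vectorBundle := (twistPrebundle A s).toVectorBundle }

/-- The identity, as a map from the fibres of a line bundle to those of the twisted bundle. -/
def toTwist (A : LineBundle.{u, v} X) (s : SignCocycle X) (x : X) :
    A.fiber x ≃ₗ[ℂ] (A.twist s).fiber x :=
  LinearEquiv.refl ℂ (A.fiber x)

lemma coord_toTwist (A : LineBundle.{u, v} X) (s : SignCocycle X) {x y : X} (hs : y ∈ s.nhd x)
    (hA : y ∈ A.nbhd x) (a : A.fiber y) :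
    (A.twist s).coord x y (A.toTwist s y a) = sgn (s.fn x y) * A.coord x y a := by
  have h : y ∈ (A.twist s).nbhd x := ⟨hs, hA⟩
  rw [coord_apply _ h]
  rfl

/-- The fibres of the twisted bundle are unchanged, but a section is continuous there once its
product with the local sign is continuous in `A`. -/
lemma secAt_toTwist {A : LineBundle.{u, v} X} {s : SignCocycle X} {T : Type*}
    [TopologicalSpace T] {f : T → X} {a : ∀ t, A.fiber (f t)} {t₀ : T}
    (h : SecAt A f (fun t ↦ sgn (s.fn (f t₀) (f t)) • a t) t₀) :
    SecAt (A.twist s) f (fun t ↦ A.toTwist s (f t) (a t)) t₀ := by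
  have hf := h.base
  rw [secAt_iff] at h ⊢
  refine ⟨hf, h.2.congr ?_⟩
  filter_upwards [hf.eventually_mem ((A.isOpen_nbhd _).mem_nhds (A.mem_nbhd (f t₀))),
    hf.eventually_mem ((s.isOpen_nhd _).mem_nhds (s.mem_nhd (f t₀)))] with t h1 h2
  rw [A.coord_toTwist s h2 h1, map_smul, smul_eq_mul]

end LineBundle

namespace RootPair

variable {K : LineBundle.{u, v} X}

/-- The local sign enters twice in `J ⊗ J` and cancels, so the same fibrewise `j` remains an
isomorphism of bundles. -/
lemma exists_twist (r : RootPair K) (s : SignCocycle X) :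
    ∃ j : Iso ((r.J.twist s).tensor (r.J.twist s)) K, ∀ (x : X) (a b : r.J.fiber x),
      j.equiv x (tmul (r.J.toTwist s x a) (r.J.toTwist s x b)) = r.j.equiv x (tmul a b) := by
  let ξ : ∀ x, ((r.J.twist s).tensor (r.J.twist s)).fiber x →ₗ[ℂ] K.fiber x :=
    fun x ↦ (r.j.equiv x).toLinearMap
  have hξ : ∀ x (a b : r.J.fiber x), ξ x (tmul (r.J.toTwist s x a) (r.J.toTwist s x b)) =
    r.j.equiv x (tmul a b) := fun x a b ↦ rfl
  have h0 : ∀ x, ξ x ≠ 0 := by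
    intro x h
    have h1 := hξ x (r.J.frame x x) (r.J.frame x x)
    rw [h, LinearMap.zero_apply] at h1
    exact r.sq_ne_zero (r.J.frame_ne_zero x x) h1.symm
  have hc : ∀ x, MorAt ((r.J.twist s).tensor (r.J.twist s)) id K id ξ x := by
    intro x
    -- A frame of the twisted bundle near `x`: the old frame times the local sign.
    have hs : SecAt (r.J.twist s) id
        (fun y ↦ r.J.toTwist s y (sgn (s.fn x y) • r.J.frame x y)) x := by
      refine secAt_toTwist (f := id) ((r.J.secAt_frame (f := id) continuousAt_id
        (r.J.mem_nbhd x)).congr (.of_forall fun y ↦ ?_))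
      rw [smul_smul]
      exact ((congrArg (fun c : ℂ ↦ c • r.J.frame x y) (sgn_mul_self _)).trans
        (one_smul ℂ _)).symm
    refine morAt_of_frame (hs.tmul hs) (.of_forall fun y ↦ ?_) ?_
    · have h0 : r.J.toTwist s y (sgn (s.fn x y) • r.J.frame x y) ≠ 0 := by
        rw [ne_eq, LinearEquiv.map_eq_zero_iff]
        exact smul_ne_zero (sgn_ne_zero _) (r.J.frame_ne_zero x y)
      exact tmul_ne_zero h0 h0
    · refine (r.secAt_sq (r.J.secAt_frame (f := id) continuousAt_id (r.J.mem_nbhd x))).congr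
        (.of_forall fun y ↦ ?_)
      refine Eq.trans ?_ (hξ y _ _).symm
      rw [r.j_smul, sgn_mul_self, one_smul]
      rfl
  obtain ⟨j, hj⟩ := exists_iso ξ h0 hc
  refine ⟨j, fun x a b ↦ ?_⟩
  rw [← hξ, ← hj]
  rfl

/-- The identity on fibres squares correctly but is not continuous into the twist. Along a loop it
becomes a continuous lift after multiplication by the sign of `q t`, the value of the cocycle on the
part of the loop up to `t`, and `q 1` is the prescribed class. -/
lemma exists_differenceClass_eq (r : RootPair K) {Y : Type u} [TopologicalSpace Y]
    (hY : LocallyContractibleSpace Y) (e : ContinuousMap.HomotopyEquiv X Y)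
    (w : Hlg X 1 →ₗ[ZMod 2] ZMod 2) :
    ∃ r' : RootPair K, IsFirstStiefelWhitney (DifferenceCover.proj r' r) w := by
  obtain ⟨c, hc, hcw, s, hs⟩ := exists_signCocycle hY e w
  obtain ⟨j, hj⟩ := r.exists_twist s
  let r' : RootPair K := ⟨r.J.twist s, j⟩
  obtain ⟨w', hw'⟩ := exists_differenceClass r' r
  suffices h : w' = w from ⟨r', h ▸ hw'⟩
  refine functional_ext fun x γ ↦ ?_
  let q : I → ZMod 2 := fun t ↦ onPath c (subpath γ.toContinuousMap 0 t)
  let ξ : ∀ t, r.J.fiber (γ.toContinuousMap t) →ₗ[ℂ] r'.J.fiber (γ.toContinuousMap t) :=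
    fun t ↦ sgn (q t) • (r.J.toTwist s (γ.toContinuousMap t)).toLinearMap
  have lift : IsLift (IsRootIsometry r' r) γ.toContinuousMap ξ := by
    constructor
    · intro t a b
      change r'.j.equiv _ (tmul (sgn (q t) • r.J.toTwist s _ a) (sgn (q t) • r.J.toTwist s _ b)) = _
      rw [r'.j_smul, sgn_mul_self, one_smul]
      exact hj _ a b
    · intro t₀
      have hγ : ContinuousAt γ.toContinuousMap t₀ := γ.continuous.continuousAt
      have hfr := r.J.secAt_frame hγ (r.J.mem_nbhd (γ.toContinuousMap t₀))
      refine morAt_of_frame hfr (.of_forall fun t ↦ r.J.frame_ne_zero _ _) ?_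
      -- Near `t₀` the change of `q` is the value on a short subpath, which is the change of the
      -- local primitive; the two cancel modulo `2`.
      have hev : ∀ᶠ t in 𝓝 t₀, q t + s.fn (γ.toContinuousMap t₀) (γ.toContinuousMap t) =
          q t₀ + s.fn (γ.toContinuousMap t₀) (γ.toContinuousMap t₀) := by
        -- A ball is chosen because the whole segment from `t₀` to `t` has to stay in the domain of
        -- the primitive.
        obtain ⟨ε, hε, hb⟩ := Metric.mem_nhds_iff.1 (hγ.preimage_mem_nhds
          ((s.isOpen_nhd _).mem_nhds (s.mem_nhd (γ.toContinuousMap t₀))))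
        filter_upwards [Metric.ball_mem_nhds t₀ hε] with t ht
        have h1 := hc.subpath_add γ.toContinuousMap 0 t₀ t
        have h2 := hs (γ.toContinuousMap t₀) (subpath γ.toContinuousMap t₀ t) fun z ↦ by
          refine hb ?_
          rw [Metric.mem_ball, Subtype.dist_eq, Set.Icc.coe_convexComb, Real.dist_eq]
          rw [Metric.mem_ball, Subtype.dist_eq, Real.dist_eq] at ht
          have h3 : (1 - (z : ℝ)) * t₀ + z * t - t₀ = z * (t - t₀) := by ring
          rw [h3, abs_mul, abs_of_nonneg z.2.1]
          exact (mul_le_of_le_one_left (abs_nonneg _) z.2.2).trans_lt ht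
        rw [subpath_apply, subpath_apply, Set.Icc.convexComb_zero, Set.Icc.convexComb_one] at h2
        change onPath c _ + _ = onPath c _ + _
        rw [← h1, h2, add_assoc, add_assoc, CharTwo.add_self_eq_zero, add_zero]
      have h1 : SecAt (r.J.twist s) γ.toContinuousMap (fun t ↦ r.J.toTwist s _
          (sgn (q t) • r.J.frame (γ.toContinuousMap t₀) (γ.toContinuousMap t))) t₀ := by
        refine secAt_toTwist ((hfr.smul (c := fun _ ↦ sgn (q t₀ + s.fn (γ.toContinuousMap t₀)
          (γ.toContinuousMap t₀))) continuousAt_const).congr ?_)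
        filter_upwards [hev] with t ht
        rw [← ht, smul_smul, add_comm, sgn_add]
      refine h1.congr (.of_forall fun t ↦ ?_)
      exact map_smul _ _ _
  refine lift.eq_sign (isRootCondition_isometry r' r) hw' (fun y ↦ r.J.frame y y)
    (fun y ↦ r.J.toTwist s y (r.J.frame y y)) (fun y ↦ ?_) one_ne_zero ?_ ?_
  · rw [ne_eq, LinearEquiv.map_eq_zero_iff]
    exact r.J.frame_ne_zero y y
  · change sgn (q 0) • r.J.toTwist s (γ.toContinuousMap 0) (r.J.frame _ _) = _
    have : q 0 = 0 := hc.subpath_self _ _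
    rw [this, sgn_zero]
  · change sgn (q 1) • r.J.toTwist s (γ.toContinuousMap 1) (r.J.frame _ _) = _
    have : q 1 = w (loopClass γ) := by
      change onPath c (subpath _ 0 1) = _
      rw [subpath_zero_one, hcw]
    rw [this, mul_one]

end RootPair

end Twist

section LowDegree

open scoped unitInterval

/-! ### Homology classes of points and loops -/

variable {X Y : Type u} [TopologicalSpace X] [TopologicalSpace Y]

/-- The class in `H_0(X, ℤ/2)` of a point. -/
def ptClass (x : X) : Hlg X 0 :=
  ((singChains X).homologyπ 0).hom
    (((singChains X).liftCycles
      ((TopCat.toSSet.obj (TopCat.of X)).ιChainComplex (R := F2.{u}) (pointSimplex x)) 0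
      (by simp) (by simp)).hom (ULift.up 1))

lemma exists_cycle_point (x : X) : ∃ z : (singChains X).cycles 0,
    ((singChains X).iCycles 0).hom z = single (pointSimplex x) ∧
      ((singChains X).homologyπ 0).hom z = ptClass x :=
  ⟨_, congrArg (fun f ↦ f.hom (ULift.up 1)) ((singChains X).liftCycles_i
    ((TopCat.toSSet.obj (TopCat.of X)).ιChainComplex (R := F2.{u}) (pointSimplex x)) 0
      (by simp) (by simp)), rfl⟩

lemma exists_cycle_loop {x : X} (γ : Path x x) : ∃ z : (singChains X).cycles 1,
    ((singChains X).iCycles 1).hom z = single (pathSimplex γ) ∧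
      ((singChains X).homologyπ 1).hom z = loopClass γ :=
  ⟨_, iCycles_loop γ, rfl⟩

lemma homologyπ_eq_ptClass {x : X} {z : (singChains X).cycles 0}
    (h : ((singChains X).iCycles 0).hom z = single (pointSimplex x)) :
    ((singChains X).homologyπ 0).hom z = ptClass x := by
  obtain ⟨z', h', hz'⟩ := exists_cycle_point x
  rw [← hz', iCycles_injective _ _ (h.trans h'.symm)]

lemma homologyπ_eq_loopClass {x : X} {γ : Path x x} {z : (singChains X).cycles 1}
    (h : ((singChains X).iCycles 1).hom z = single (pathSimplex γ)) :
    ((singChains X).homologyπ 1).hom z = loopClass γ := by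
  obtain ⟨z', h', hz'⟩ := exists_cycle_loop γ
  rw [← hz', iCycles_injective _ _ (h.trans h'.symm)]

lemma exists_pointSimplex (s : TopCat.toSSet.obj (TopCat.of X) _⦋0⦌) :
    ∃ x : X, s = pointSimplex x := by
  refine ⟨TopCat.toSSetObjEquiv (TopCat.of X) _ s (stdSimplex.vertex 0), ?_⟩
  apply (TopCat.toSSetObjEquiv (TopCat.of X) _).injective
  ext p
  obtain rfl : p = stdSimplex.vertex 0 := Subsingleton.elim _ _
  simp [pointSimplex]

/-- Every `0`-simplex is a cycle, so two functionals that agree on classes of points have the same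
extension to chains. -/
lemma functional_zero_ext {w w' : Hlg X 0 →ₗ[ZMod 2] ZMod 2}
    (h : ∀ x, w (ptClass x) = w' (ptClass x)) : w = w' := by
  obtain ⟨f, hf⟩ := exists_chain_extension (w ∘ₗ ((singChains X).homologyπ 0).hom)
  obtain ⟨f', hf'⟩ := exists_chain_extension (w' ∘ₗ ((singChains X).homologyπ 0).hom)
  have key : f = f' := by
    refine chainFun_ext fun s ↦ ?_
    obtain ⟨x, rfl⟩ := exists_pointSimplex s
    obtain ⟨z, hz, hz'⟩ := exists_cycle_point x
    rw [← hz, hf, hf']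
    refine (congrArg w hz').trans ((h x).trans (congrArg w' hz').symm)
  refine LinearMap.ext fun y ↦ ?_
  obtain ⟨z, rfl⟩ := homologyπ_surjective (singChains X) 0 y
  exact (hf z).symm.trans ((LinearMap.congr_fun key _).trans (hf' z))

/-- Induced maps are followed on representing cycles, here for a cycle consisting of one simplex. -/
lemma cyclesMap_single (f : C(X, Y)) {n : ℕ} {s : TopCat.toSSet.obj (TopCat.of X) _⦋n⦌}
    {z : (singChains X).cycles n} (hz : ((singChains X).iCycles n).hom z = single s) :
    ∃ z' : (singChains Y).cycles n,
      ((singChains Y).iCycles n).hom z' =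
        single ((TopCat.toSSet.map (TopCat.ofHom f)).app _ s) ∧
      ((singChains Y).homologyπ n).hom z' =
        Hlg.map f n (((singChains X).homologyπ n).hom z) := by
  let F : singChains X ⟶ singChains Y :=
    SSet.chainComplexMap (TopCat.toSSet.map (TopCat.ofHom f)) F2.{u}
  refine ⟨(HomologicalComplex.cyclesMap F n).hom z, ?_, ?_⟩
  · have h1 := congrArg (fun g ↦ g.hom z) (HomologicalComplex.cyclesMap_i F n)
    refine h1.trans ((congrArg (F.f n).hom hz).trans ?_)
    exact congrArg (fun g ↦ g.hom (ULift.up 1)) (SSet.ι_chainComplexMap_f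
      (TopCat.toSSet.obj (TopCat.of X)) (TopCat.toSSet.obj (TopCat.of Y))
      (TopCat.toSSet.map (TopCat.ofHom f)) F2.{u} s)
  · exact (congrArg (fun g ↦ g.hom z) (HomologicalComplex.homologyπ_naturality F n)).symm

lemma map_ptClass (f : C(X, Y)) (x : X) : Hlg.map f 0 (ptClass x) = ptClass (f x) := by
  obtain ⟨z, hz, hz'⟩ := exists_cycle_point x
  obtain ⟨z', h1, h2⟩ := cyclesMap_single f hz
  rw [← hz', ← h2]
  exact homologyπ_eq_ptClass h1

lemma map_loopClass (f : C(X, Y)) {x : X} (γ : Path x x) :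
    Hlg.map f 1 (loopClass γ) = loopClass (γ.map f.continuous) := by
  obtain ⟨z, hz, hz'⟩ := exists_cycle_loop γ
  obtain ⟨z', h1, h2⟩ := cyclesMap_single f hz
  rw [← hz', ← h2]
  exact homologyπ_eq_loopClass h1

lemma crossSimplex_zero_zero (x : X) (y : Y) :
    crossSimplex 0 0 0 (pointSimplex x) (pointSimplex y) = single (pointSimplex (x, y)) := by
  have : Unique (Shuffle 0 0 0) :=
    { default := ⟨fun _ ↦ (0, 0), fun a b h ↦ absurd h (Fin.subsingleton_one.elim a b ▸ lt_irrefl _)⟩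
      uniq := fun c ↦ Subtype.ext (funext fun k ↦ Prod.ext (Fin.subsingleton_one.elim _ _)
        (Fin.subsingleton_one.elim _ _)) }
  rw [crossSimplex, Fintype.sum_unique]
  rfl

/-- There is one shuffle: the first coordinate is constant, so by rank the second is the identity.
-/
lemma crossSimplex_zero_one (x : X) {y z : Y} (γ : Path y z) :
    crossSimplex 0 1 1 (pointSimplex x) (pathSimplex γ) =
      single (pathSimplex ((Path.refl x).prod γ)) := by
  have h : ∀ (c : Shuffle 0 1 1) k, (c.1 k).2 = k := fun c k ↦ by
    have := shuffle_rank (n := 1) rfl c k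
    have := (c.1 k).1.isLt
    exact Fin.ext (by omega)
  have : Unique (Shuffle 0 1 1) :=
    { default := ⟨fun k ↦ (0, k), fun a b h ↦ Prod.lt_iff.2 (Or.inr ⟨le_rfl, h⟩)⟩
      uniq := fun c ↦ Subtype.ext (funext fun k ↦ Prod.ext (Fin.subsingleton_one.elim _ _) (h c k)) }
  have h2 : (default : Shuffle 0 1 1).snd = 𝟙 _ := by
    ext k : 3
    exact h _ k
  rw [crossSimplex, Fintype.sum_unique, h2]
  refine congrArg single ?_
  rw [op_id, Functor.map_id_apply]
  rfl

lemma crossSimplex_one_zero {x z : X} (γ : Path x z) (y : Y) :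
    crossSimplex 1 0 1 (pathSimplex γ) (pointSimplex y) =
      single (pathSimplex (γ.prod (Path.refl y))) := by
  have h : ∀ (c : Shuffle 1 0 1) k, (c.1 k).1 = k := fun c k ↦ by
    have := shuffle_rank (n := 1) rfl c k
    have := (c.1 k).2.isLt
    exact Fin.ext (by omega)
  have : Unique (Shuffle 1 0 1) :=
    { default := ⟨fun k ↦ (k, 0), fun a b h ↦ Prod.lt_iff.2 (Or.inl ⟨h, le_rfl⟩)⟩
      uniq := fun c ↦ Subtype.ext (funext fun k ↦ Prod.ext (h c k) (Fin.subsingleton_one.elim _ _)) }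
  have h2 : (default : Shuffle 1 0 1).fst = 𝟙 _ := by
    ext k : 3
    exact h _ k
  rw [crossSimplex, Fintype.sum_unique, h2]
  refine congrArg single ?_
  rw [op_id, Functor.map_id_apply]
  rfl

lemma iCycles_crossCycles_single {p q : ℕ} {s : TopCat.toSSet.obj (TopCat.of X) _⦋p⦌}
    {t : TopCat.toSSet.obj (TopCat.of Y) _⦋q⦌} {a : (singChains X).cycles p}
    {b : (singChains Y).cycles q} (ha : ((singChains X).iCycles p).hom a = single s)
    (hb : ((singChains Y).iCycles q).hom b = single t) :
    ((singChains (X × Y)).iCycles (p + q)).hom (crossCycles p q a b) =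
      crossSimplex p q (p + q) s t := by
  rw [iCycles_crossCycles, ha, hb, crossChain_single]

lemma cross_ptClass_ptClass (x : X) (y : Y) :
    cross 0 0 (ptClass x) (ptClass y) = ptClass (x, y) := by
  obtain ⟨a, ha, ha'⟩ := exists_cycle_point x
  obtain ⟨b, hb, hb'⟩ := exists_cycle_point y
  rw [← ha', ← hb']
  exact (cross_homologyπ 0 0 a b).trans (homologyπ_eq_ptClass
    ((iCycles_crossCycles_single ha hb).trans (crossSimplex_zero_zero x y)))

lemma cross_ptClass_loopClass (x : X) {y : Y} (γ : Path y y) :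
    cross 0 1 (ptClass x) (loopClass γ) = loopClass ((Path.refl x).prod γ) := by
  obtain ⟨a, ha, ha'⟩ := exists_cycle_point x
  obtain ⟨b, hb, hb'⟩ := exists_cycle_loop γ
  rw [← ha', ← hb']
  exact (cross_homologyπ 0 1 a b).trans (homologyπ_eq_loopClass
    ((iCycles_crossCycles_single ha hb).trans (crossSimplex_zero_one x γ)))

lemma cross_loopClass_ptClass {x : X} (γ : Path x x) (y : Y) :
    cross 1 0 (loopClass γ) (ptClass y) = loopClass (γ.prod (Path.refl y)) := by
  obtain ⟨a, ha, ha'⟩ := exists_cycle_loop γ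
  obtain ⟨b, hb, hb'⟩ := exists_cycle_point y
  rw [← ha', ← hb']
  exact (cross_homologyπ 1 0 a b).trans (homologyπ_eq_loopClass
    ((iCycles_crossCycles_single ha hb).trans (crossSimplex_one_zero γ y)))

lemma augmentation_ptClass (x : X) : augmentation (TotalHlg.of 0 (ptClass x)) = 1 := by
  have h := congrArg (fun g ↦ (g.hom (ULift.up 1)).down)
    (SSet.liftCycles_ιChainComplex_homologyπ_homology₀ε
      (TopCat.toSSet.obj (TopCat.of X)) F2.{u} (pointSimplex x))
  have h2 : augmentation (TotalHlg.of 0 (ptClass x)) =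
      ((TopCat.singularHomology₀ε (TopCat.of X) F2).hom (ptClass x)).down := by
    change ((TopCat.singularHomology₀ε (TopCat.of X) F2).hom
      (TotalHlg.component 0 (TotalHlg.of 0 (ptClass x)))).down = _
    rw [TotalHlg.component, TotalHlg.of, DirectSum.component.lof_self]
  exact h2.trans h

lemma augmentation_of {n : ℕ} (hn : n ≠ 0) (a : Hlg X n) :
    augmentation (TotalHlg.of n a) = 0 := by
  change ((TopCat.singularHomology₀ε (TopCat.of X) F2).hom
    (TotalHlg.component 0 (TotalHlg.of n a))).down = _
  have : TotalHlg.component 0 (TotalHlg.of n a) = 0 := by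
    rw [TotalHlg.component, TotalHlg.of, DirectSum.component.of, dif_neg hn]
  rw [this, map_zero]
  rfl

lemma functional_const (w : Hlg X 1 →ₗ[ZMod 2] ZMod 2) {x : X} {γ : Path x x}
    (h : ∀ t, γ t = x) : w (loopClass γ) = 0 := by
  obtain ⟨c, hc, hcw, -⟩ := exists_cocycleOne w
  obtain rfl : γ = Path.refl x := Path.ext (funext h)
  rw [← hcw]
  exact hc.const x

/-- A functional on `H₁(X × Y)` that vanishes on loops in the slices is zero. -/
lemma functional_prod_ext {w : Hlg (X × Y) 1 →ₗ[ZMod 2] ZMod 2}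
    (h₁ : ∀ (x : X) (y : Y) (γ : Path y y), w (loopClass ((Path.refl x).prod γ)) = 0)
    (h₂ : ∀ (x : X) (γ : Path x x) (y : Y), w (loopClass (γ.prod (Path.refl y))) = 0) :
    w = 0 := by
  refine functional_ext fun p γ ↦ ?_
  obtain ⟨c, hc, hcw, -⟩ := exists_cocycleOne w
  let α : Path p.1 p.1 := γ.map continuous_fst
  let β : Path p.2 p.2 := γ.map continuous_snd
  -- The diagonal of this square is `γ`, and the triangle below it has a loop in each of the two
  -- slices as its other sides.
  let G : C(I × I, X × Y) := ⟨fun st ↦ (α st.1, β st.2), by fun_prop⟩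
  have h := hc.triangle G (0, 0) (1, 0) (1, 1)
  have e₁ : G.comp (seg (0, 0) (1, 0)) = (α.prod (Path.refl p.2)).toContinuousMap := by
    ext t
    · simp [G, seg]
    · simp [G, seg]
  have e₂ : G.comp (seg (1, 0) (1, 1)) = ((Path.refl p.1).prod β).toContinuousMap := by
    ext t
    · simp [G, seg]
    · simp [G, seg]
  have e₃ : G.comp (seg (0, 0) (1, 1)) = γ.toContinuousMap := by
    ext t
    · simp [G, seg, α]
    · simp [G, seg, β]
  rw [e₁, e₂, e₃, onPath_path, onPath_path, onPath_path] at h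
  have f₁ := (hcw _ (α.prod (Path.refl p.2))).trans (h₂ p.1 α p.2)
  have f₂ := (hcw _ ((Path.refl p.1).prod β)).trans (h₁ p.1 p.2 β)
  have f₃ := hcw _ γ
  rw [LinearMap.zero_apply, ← f₃]
  refine h.symm.trans ?_
  exact (congrArg₂ (· + ·) f₁ f₂).trans (add_zero 0)

end LowDegree

section LowDegreeCochains

open scoped unitInterval

/-! ### Cochains of total degree one -/

variable {X Y : Type u} [TopologicalSpace X] [TopologicalSpace Y]

/-- The class of a point, in the total homology. -/
abbrev TotalHlg.point (x : X) : TotalHlg X := TotalHlg.of 0 (ptClass x)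

/-- The class of a loop, in the total homology. -/
abbrev TotalHlg.loop {x : X} (γ : Path x x) : TotalHlg X := TotalHlg.of 1 (loopClass γ)

lemma component_of_self (n : ℕ) (a : Hlg X n) :
    TotalHlg.component n (TotalHlg.of n a) = a :=
  DirectSum.component.lof_self (ZMod 2) n a

lemma component_of_ne {n k : ℕ} (h : n ≠ k) (a : Hlg X n) :
    TotalHlg.component k (TotalHlg.of n a) = 0 := by
  rw [TotalHlg.component, TotalHlg.of, DirectSum.component.of, dif_neg h]

lemma totalCross_of (p q : ℕ) (a : Hlg X p) (b : Hlg Y q) :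
    TotalHlg.cross (TotalHlg.of p a) (TotalHlg.of q b) = TotalHlg.of (p + q) (cross p q a b) := by
  simp [TotalHlg.cross]

lemma pontryagin_of (m : C(X × X, X)) (p q : ℕ) (a : Hlg X p) (b : Hlg X q) :
    pontryagin m (TotalHlg.of p a) (TotalHlg.of q b) =
      TotalHlg.of (p + q) (Hlg.map m (p + q) (cross p q a b)) := by
  change TotalHlg.map m (TotalHlg.cross (TotalHlg.of p a) (TotalHlg.of q b)) = _
  rw [totalCross_of]
  simp [TotalHlg.map]

lemma totalCross_point_loop (x : X) {y : Y} (γ : Path y y) :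
    TotalHlg.cross (TotalHlg.point x) (TotalHlg.loop γ) =
      TotalHlg.loop ((Path.refl x).prod γ) :=
  (totalCross_of 0 1 _ _).trans (congrArg (TotalHlg.of 1) (cross_ptClass_loopClass x γ))

lemma totalCross_loop_point {x : X} (γ : Path x x) (y : Y) :
    TotalHlg.cross (TotalHlg.loop γ) (TotalHlg.point y) =
      TotalHlg.loop (γ.prod (Path.refl y)) :=
  (totalCross_of 1 0 _ _).trans (congrArg (TotalHlg.of 1) (cross_loopClass_ptClass γ y))

lemma pontryagin_point_point (m : C(X × X, X)) (x y : X) :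
    pontryagin m (TotalHlg.point x) (TotalHlg.point y) = TotalHlg.point (m (x, y)) :=
  (pontryagin_of m 0 0 _ _).trans (congrArg (TotalHlg.of 0)
    ((congrArg (Hlg.map m 0) (cross_ptClass_ptClass x y)).trans (map_ptClass m _)))

lemma pontryagin_point_loop (m : C(X × X, X)) (x : X) {y : X} (γ : Path y y) :
    pontryagin m (TotalHlg.point x) (TotalHlg.loop γ) =
      TotalHlg.loop (((Path.refl x).prod γ).map m.continuous) :=
  (pontryagin_of m 0 1 _ _).trans (congrArg (TotalHlg.of 1)
    ((congrArg (Hlg.map m 1) (cross_ptClass_loopClass x γ)).trans (map_loopClass m _)))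

lemma pontryagin_loop_point (m : C(X × X, X)) {x : X} (γ : Path x x) (y : X) :
    pontryagin m (TotalHlg.loop γ) (TotalHlg.point y) =
      TotalHlg.loop ((γ.prod (Path.refl y)).map m.continuous) :=
  (pontryagin_of m 1 0 _ _).trans (congrArg (TotalHlg.of 1)
    ((congrArg (Hlg.map m 1) (cross_loopClass_ptClass γ y)).trans (map_loopClass m _)))

lemma augmentation_point (x : X) : augmentation (TotalHlg.point x) = 1 := augmentation_ptClass x

lemma augmentation_loop {x : X} (γ : Path x x) : augmentation (TotalHlg.loop γ) = 0 :=
  augmentation_of one_ne_zero _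

/-- An element of the total homology is the class of a point (if `d = 0`) or of a loop (if
`d = 1`). -/
def IsBasic (d : ℕ) (r : TotalHlg X) : Prop :=
  (d = 0 ∧ ∃ x : X, r = TotalHlg.point x) ∨
    (d = 1 ∧ ∃ (x : X) (γ : Path x x), r = TotalHlg.loop γ)

lemma functional_eq_zero_of_isBasic {d : ℕ} (hd : d ≤ 1) (l : TotalHlg X →ₗ[ZMod 2] ZMod 2)
    (h : ∀ r, IsBasic d r → l r = 0) (a : Hlg X d) : l (TotalHlg.of d a) = 0 := by
  obtain rfl | rfl : d = 0 ∨ d = 1 := by omega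
  · have : l ∘ₗ TotalHlg.of 0 = 0 := functional_zero_ext fun x ↦ h _ (Or.inl ⟨rfl, x, rfl⟩)
    exact LinearMap.congr_fun this a
  · have : l ∘ₗ TotalHlg.of 1 = 0 := functional_ext fun x γ ↦ h _ (Or.inr ⟨rfl, x, γ, rfl⟩)
    exact LinearMap.congr_fun this a

/-- In total degree one every entry has degree `0` or `1`, where functionals are determined by
points and loops. By multilinearity the entries may be tested one at a time. -/
lemma cochain_eq_zero {n : ℕ} {F : Cochain X n} (hF : F ∈ cochainDeg X n 1)
    (h : ∀ (d : Fin n → ℕ) (v : Fin n → TotalHlg X), ∑ k, d k = 1 →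
      (∀ k, IsBasic (d k) (v k)) → F v = 0) : F = 0 := by
  refine MultilinearMap.directSum_ext fun d ↦ MultilinearMap.ext fun x ↦ ?_
  change F (fun k ↦ TotalHlg.of (d k) (x k)) = 0
  by_cases hd : ∑ k, d k = 1
  · have hd1 : ∀ k, d k ≤ 1 := fun k ↦
      hd ▸ Finset.single_le_sum (fun i _ ↦ Nat.zero_le (d i)) (Finset.mem_univ k)
    -- Induction on the set of entries allowed to be arbitrary homogeneous classes, the others being
    -- points or loops.
    have key : ∀ s : Finset (Fin n), ∀ v : Fin n → TotalHlg X,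
        (∀ k ∈ s, ∃ a, v k = TotalHlg.of (d k) a) → (∀ k ∉ s, IsBasic (d k) (v k)) → F v = 0 := by
      intro s
      induction s using Finset.induction_on with
      | empty => exact fun v _ hv ↦ h d v hd fun k ↦ hv k (Finset.notMem_empty k)
      | insert i s hi ih =>
        intro v hv hv'
        obtain ⟨a, ha⟩ := hv i (Finset.mem_insert_self i s)
        have h1 := functional_eq_zero_of_isBasic (hd1 i) (F.toLinearMap v i) (fun r hr ↦ by
          refine ih (Function.update v i r) (fun k hk ↦ ?_) fun k hk ↦ ?_
          · have hki : k ≠ i := fun e ↦ hi (e ▸ hk)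
            rw [Function.update_of_ne hki]
            exact hv k (Finset.mem_insert_of_mem hk)
          · by_cases hki : k = i
            · subst hki
              rwa [Function.update_self]
            · rw [Function.update_of_ne hki]
              exact hv' k fun e ↦ (Finset.mem_insert.1 e).elim hki hk) a
        rw [← ha] at h1
        have h2 : F (Function.update v i (v i)) = 0 := h1
        rwa [Function.update_eq_self] at h2
    exact key Finset.univ _ (fun k _ ↦ ⟨x k, rfl⟩) fun k hk ↦ absurd (Finset.mem_univ k) hk
  · exact hF d x hd

lemma isBasic_zero {r : TotalHlg X} (h : IsBasic 0 r) : ∃ x : X, r = TotalHlg.point x := by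
  rcases h with ⟨-, h⟩ | ⟨h, -⟩
  · exact h
  · exact absurd h zero_ne_one

lemma isBasic_one {r : TotalHlg X} (h : IsBasic 1 r) :
    ∃ (x : X) (γ : Path x x), r = TotalHlg.loop γ := by
  rcases h with ⟨h, -⟩ | ⟨-, h⟩
  · exact absurd h one_ne_zero
  · exact h

lemma cochain_one_eq_zero {F : Cochain X 1} (hF : F ∈ cochainDeg X 1 1)
    (h : ∀ (x : X) (γ : Path x x), F ![TotalHlg.loop γ] = 0) : F = 0 := by
  refine cochain_eq_zero hF fun d v hd hv ↦ ?_
  rw [Fin.sum_univ_one] at hd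
  have h0 := hv 0
  rw [hd] at h0
  obtain ⟨x, γ, h0⟩ := isBasic_one h0
  have hv' : v = ![v 0] := by
    ext1 k
    fin_cases k
    rfl
  rw [hv', h0]
  exact h x γ

lemma cochain_two_eq_zero {F : Cochain X 2} (hF : F ∈ cochainDeg X 2 1)
    (h₁ : ∀ (x y : X) (γ : Path y y), F ![TotalHlg.point x, TotalHlg.loop γ] = 0)
    (h₂ : ∀ (x : X) (γ : Path x x) (y : X), F ![TotalHlg.loop γ, TotalHlg.point y] = 0) :
    F = 0 := by
  refine cochain_eq_zero hF fun d v hd hv ↦ ?_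
  rw [Fin.sum_univ_two] at hd
  have h0 := hv 0
  have h1 := hv 1
  have hv' : v = ![v 0, v 1] := by
    ext1 k
    fin_cases k <;> rfl
  rw [hv']
  obtain ⟨e0, e1⟩ | ⟨e0, e1⟩ : (d 0 = 0 ∧ d 1 = 1) ∨ (d 0 = 1 ∧ d 1 = 0) := by omega
  · rw [e0] at h0
    rw [e1] at h1
    obtain ⟨x, h0⟩ := isBasic_zero h0
    obtain ⟨y, γ, h1⟩ := isBasic_one h1
    rw [h0, h1]
    exact h₁ x y γ
  · rw [e0] at h0
    rw [e1] at h1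
    obtain ⟨x, γ, h0⟩ := isBasic_one h0
    obtain ⟨y, h1⟩ := isBasic_zero h1
    rw [h0, h1]
    exact h₂ x γ y

lemma cochain_three_eq_zero {F : Cochain X 3} (hF : F ∈ cochainDeg X 3 1)
    (h₁ : ∀ (x y z : X) (γ : Path z z),
      F ![TotalHlg.point x, TotalHlg.point y, TotalHlg.loop γ] = 0)
    (h₂ : ∀ (x y : X) (γ : Path y y) (z : X),
      F ![TotalHlg.point x, TotalHlg.loop γ, TotalHlg.point z] = 0)
    (h₃ : ∀ (x : X) (γ : Path x x) (y z : X),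
      F ![TotalHlg.loop γ, TotalHlg.point y, TotalHlg.point z] = 0) :
    F = 0 := by
  refine cochain_eq_zero hF fun d v hd hv ↦ ?_
  rw [Fin.sum_univ_three] at hd
  have h0 := hv 0
  have h1 := hv 1
  have h2 := hv 2
  have hv' : v = ![v 0, v 1, v 2] := by
    ext1 k
    fin_cases k <;> rfl
  rw [hv']
  obtain ⟨e0, e1, e2⟩ | ⟨e0, e1, e2⟩ | ⟨e0, e1, e2⟩ : (d 0 = 0 ∧ d 1 = 0 ∧ d 2 = 1) ∨
      (d 0 = 0 ∧ d 1 = 1 ∧ d 2 = 0) ∨ (d 0 = 1 ∧ d 1 = 0 ∧ d 2 = 0) := by omega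
  all_goals
    rw [e0] at h0
    rw [e1] at h1
    rw [e2] at h2
  · obtain ⟨x, h0⟩ := isBasic_zero h0
    obtain ⟨y, h1⟩ := isBasic_zero h1
    obtain ⟨z, γ, h2⟩ := isBasic_one h2
    rw [h0, h1, h2]
    exact h₁ x y z γ
  · obtain ⟨x, h0⟩ := isBasic_zero h0
    obtain ⟨y, γ, h1⟩ := isBasic_one h1
    obtain ⟨z, h2⟩ := isBasic_zero h2
    rw [h0, h1, h2]
    exact h₂ x y γ z
  · obtain ⟨x, γ, h0⟩ := isBasic_one h0
    obtain ⟨y, h1⟩ := isBasic_zero h1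
    obtain ⟨z, h2⟩ := isBasic_zero h2
    rw [h0, h1, h2]
    exact h₃ x γ y z

lemma codiff_one_apply (m : C(X × X, X)) (f : Cochain X 1) (r s : TotalHlg X) :
    codiff m 1 f ![r, s] =
      augmentation r * f ![s] + f ![pontryagin m r s] + f ![r] * augmentation s := by
  have h1 : Fin.contractNth (Fin.castSucc (0 : Fin 1)) (fun r s ↦ pontryagin m r s) ![r, s] =
      ![pontryagin m r s] := by
    ext1 k
    fin_cases k
    rfl
  have h2 : Fin.init (α := fun _ ↦ TotalHlg X) ![r, s] = ![r] := by
    ext1 k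
    fin_cases k
    rfl
  have h3 : Fin.tail (α := fun _ ↦ TotalHlg X) ![r, s] = ![s] := by
    ext1 k
    fin_cases k
    rfl
  change (firstCochain f + ∑ i : Fin 1, contractCochain m i f + lastCochain f) ![r, s] = _
  rw [Fin.sum_univ_one]
  change augmentation r * f (Fin.tail (α := fun _ ↦ TotalHlg X) _) + f (Fin.contractNth _ _ _) +
    f (Fin.init (α := fun _ ↦ TotalHlg X) _) * augmentation s = _
  rw [h1, h2, h3]

lemma codiff_two_apply (m : C(X × X, X)) (f : Cochain X 2) (r s t : TotalHlg X) :
    codiff m 2 f ![r, s, t] =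
      augmentation r * f ![s, t] + (f ![pontryagin m r s, t] + f ![r, pontryagin m s t]) +
        f ![r, s] * augmentation t := by
  have h0 : Fin.contractNth (Fin.castSucc (0 : Fin 2)) (fun r s ↦ pontryagin m r s) ![r, s, t] =
      ![pontryagin m r s, t] := by
    ext1 k
    fin_cases k <;> rfl
  have h1 : Fin.contractNth (Fin.castSucc (1 : Fin 2)) (fun r s ↦ pontryagin m r s) ![r, s, t] =
      ![r, pontryagin m s t] := by
    ext1 k
    fin_cases k <;> rfl
  have h2 : Fin.init (α := fun _ ↦ TotalHlg X) ![r, s, t] = ![r, s] := by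
    ext1 k
    fin_cases k <;> rfl
  have h3 : Fin.tail (α := fun _ ↦ TotalHlg X) ![r, s, t] = ![s, t] := by
    ext1 k
    fin_cases k <;> rfl
  change (firstCochain f + ∑ i : Fin 2, contractCochain m i f + lastCochain f) ![r, s, t] = _
  rw [Fin.sum_univ_two]
  change augmentation r * f (Fin.tail (α := fun _ ↦ TotalHlg X) _) + (f (Fin.contractNth _ _ _) +
    f (Fin.contractNth _ _ _)) + f (Fin.init (α := fun _ ↦ TotalHlg X) _) * augmentation t = _
  rw [h0, h1, h2, h3]

lemma cochainDeg_apply {n j : ℕ} {f : Cochain X n} (hf : f ∈ cochainDeg X n j) {d : Fin n → ℕ}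
    {v : Fin n → TotalHlg X} (hv : ∀ k, ∃ a, v k = TotalHlg.of (d k) a) (hd : ∑ k, d k ≠ j) :
    f v = 0 := by
  choose x hx using hv
  rw [show v = fun k ↦ TotalHlg.of (d k) (x k) from funext hx]
  exact hf d x hd

lemma cochainDeg_one_apply {j : ℕ} {f : Cochain X 1} (hf : f ∈ cochainDeg X 1 j) {p : ℕ}
    (a : Hlg X p) (h : p ≠ j) : f ![TotalHlg.of p a] = 0 :=
  cochainDeg_apply hf (d := ![p]) (fun k ↦ by fin_cases k; exact ⟨a, rfl⟩)
    (by rwa [Fin.sum_univ_one])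

lemma cochainDeg_two_apply {j : ℕ} {f : Cochain X 2} (hf : f ∈ cochainDeg X 2 j) {p q : ℕ}
    (a : Hlg X p) (b : Hlg X q) (h : p + q ≠ j) : f ![TotalHlg.of p a, TotalHlg.of q b] = 0 :=
  cochainDeg_apply hf (d := ![p, q])
    (fun k ↦ by fin_cases k; exacts [⟨a, rfl⟩, ⟨b, rfl⟩]) (by rwa [Fin.sum_univ_two])

/-- The augmentation is zero in positive degree, so the outer terms of the codifferential respect
the internal degree too. -/
lemma augmentation_mul_eq_zero {p : ℕ} (a : Hlg X p) {c : ZMod 2} (h : p = 0 → c = 0) :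
    augmentation (TotalHlg.of p a) * c = 0 := by
  by_cases hp : p = 0
  · rw [h hp, mul_zero]
  · rw [augmentation_of hp, zero_mul]

lemma codiff_one_mem {m : C(X × X, X)} {j : ℕ} {f : Cochain X 1} (hf : f ∈ cochainDeg X 1 j) :
    codiff m 1 f ∈ cochainDeg X 2 j := by
  intro d x hd
  rw [Fin.sum_univ_two] at hd
  have hv : (fun k ↦ TotalHlg.of (d k) (x k)) =
      ![TotalHlg.of (d 0) (x 0), TotalHlg.of (d 1) (x 1)] := by
    ext1 k
    fin_cases k <;> rfl
  rw [hv, codiff_one_apply, pontryagin_of, cochainDeg_one_apply hf _ hd,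
    mul_comm (f _) (augmentation _),
    augmentation_mul_eq_zero _ fun h ↦ cochainDeg_one_apply hf _ (by omega),
    augmentation_mul_eq_zero _ fun h ↦ cochainDeg_one_apply hf _ (by omega), add_zero, add_zero]

lemma codiff_two_mem {m : C(X × X, X)} {j : ℕ} {f : Cochain X 2} (hf : f ∈ cochainDeg X 2 j) :
    codiff m 2 f ∈ cochainDeg X 3 j := by
  intro d x hd
  rw [Fin.sum_univ_three] at hd
  have hv : (fun k ↦ TotalHlg.of (d k) (x k)) = ![TotalHlg.of (d 0) (x 0),
      TotalHlg.of (d 1) (x 1), TotalHlg.of (d 2) (x 2)] := by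
    ext1 k
    fin_cases k <;> rfl
  have h1 := augmentation_mul_eq_zero (x 0) (c := f ![TotalHlg.of (d 1) (x 1),
    TotalHlg.of (d 2) (x 2)]) fun h ↦ cochainDeg_two_apply hf _ _ (by omega)
  have h2 := augmentation_mul_eq_zero (x 2) (c := f ![TotalHlg.of (d 0) (x 0),
    TotalHlg.of (d 1) (x 1)]) fun h ↦ cochainDeg_two_apply hf _ _ (by omega)
  rw [hv, codiff_two_apply, pontryagin_of, pontryagin_of, h1, mul_comm (f _) (augmentation _), h2,
    cochainDeg_two_apply hf _ _ (by omega), cochainDeg_two_apply hf _ _ (by omega)]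
  simp

/-- The cochain `r ↦ w(r₁)`. -/
def oneCochain (w : Hlg X 1 →ₗ[ZMod 2] ZMod 2) : Cochain X 1 :=
  MultilinearMap.ofSubsingleton (ZMod 2) (TotalHlg X) (ZMod 2) (0 : Fin 1)
    (w ∘ₗ TotalHlg.component 1)

lemma oneCochain_loop (w : Hlg X 1 →ₗ[ZMod 2] ZMod 2) {x : X} (γ : Path x x) :
    oneCochain w ![TotalHlg.loop γ] = w (loopClass γ) :=
  congrArg w (component_of_self 1 _)

lemma oneCochain_add (w w' : Hlg X 1 →ₗ[ZMod 2] ZMod 2) :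
    oneCochain (w + w') = oneCochain w + oneCochain w' := rfl

lemma oneCochain_mem (w : Hlg X 1 →ₗ[ZMod 2] ZMod 2) : oneCochain w ∈ cochainDeg X 1 1 := by
  intro d x hd
  rw [Fin.sum_univ_one] at hd
  exact (congrArg w (component_of_ne hd _)).trans (map_zero w)

lemma exists_oneCochain {f : Cochain X 1} (hf : f ∈ cochainDeg X 1 1) :
    ∃ w : Hlg X 1 →ₗ[ZMod 2] ZMod 2, f = oneCochain w := by
  have hu : ∀ r : TotalHlg X, Function.update ![0] 0 r = ![r] := fun r ↦ by
    ext1 k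
    fin_cases k
    rfl
  refine ⟨f.toLinearMap ![0] 0 ∘ₗ TotalHlg.of 1, sub_eq_zero.1 (cochain_one_eq_zero
    (sub_mem hf (oneCochain_mem _)) fun x γ ↦ ?_)⟩
  rw [sub_apply, oneCochain_loop]
  change _ - f (Function.update ![0] 0 (TotalHlg.loop γ)) = 0
  rw [hu, sub_self]

/-- The cochain `(r, s) ↦ w((r × s)₁)`. -/
def twoCochain (w : Hlg (X × X) 1 →ₗ[ZMod 2] ZMod 2) : Cochain X 2 where
  toFun r := w (TotalHlg.component 1 (TotalHlg.cross (r 0) (r 1)))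
  map_update_add' := by
    intro inst g a x y
    obtain rfl : inst = instDecidableEqFin 2 := Subsingleton.elim _ _
    fin_cases a <;> simp
  map_update_smul' := by
    intro inst g a c x
    obtain rfl : inst = instDecidableEqFin 2 := Subsingleton.elim _ _
    fin_cases a <;> simp

lemma twoCochain_apply (w : Hlg (X × X) 1 →ₗ[ZMod 2] ZMod 2) (r s : TotalHlg X) :
    twoCochain w ![r, s] = w (TotalHlg.component 1 (TotalHlg.cross r s)) := rfl

lemma twoCochain_point_loop (w : Hlg (X × X) 1 →ₗ[ZMod 2] ZMod 2) (x : X) {y : X}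
    (γ : Path y y) : twoCochain w ![TotalHlg.point x, TotalHlg.loop γ] =
      w (loopClass ((Path.refl x).prod γ)) := by
  rw [twoCochain_apply, totalCross_point_loop]
  exact congrArg w (component_of_self 1 _)

lemma twoCochain_loop_point (w : Hlg (X × X) 1 →ₗ[ZMod 2] ZMod 2) {x : X} (γ : Path x x)
    (y : X) : twoCochain w ![TotalHlg.loop γ, TotalHlg.point y] =
      w (loopClass (γ.prod (Path.refl y))) := by
  rw [twoCochain_apply, totalCross_loop_point]
  exact congrArg w (component_of_self 1 _)

lemma twoCochain_mem (w : Hlg (X × X) 1 →ₗ[ZMod 2] ZMod 2) :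
    twoCochain w ∈ cochainDeg X 2 1 := by
  intro d x hd
  rw [Fin.sum_univ_two] at hd
  change w (TotalHlg.component 1 (TotalHlg.cross (TotalHlg.of (d 0) (x 0))
    (TotalHlg.of (d 1) (x 1)))) = 0
  rw [totalCross_of, component_of_ne hd, map_zero]

lemma codiff_oneCochain_point_loop (m : C(X × X, X)) (w : Hlg X 1 →ₗ[ZMod 2] ZMod 2) (x : X)
    {y : X} (γ : Path y y) :
    codiff m 1 (oneCochain w) ![TotalHlg.point x, TotalHlg.loop γ] =
      w (loopClass γ) + w (loopClass (((Path.refl x).prod γ).map m.continuous)) := by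
  rw [codiff_one_apply, augmentation_point, augmentation_loop, pontryagin_point_loop,
    oneCochain_loop, oneCochain_loop, one_mul, mul_zero, add_zero]

lemma codiff_oneCochain_loop_point (m : C(X × X, X)) (w : Hlg X 1 →ₗ[ZMod 2] ZMod 2) {x : X}
    (γ : Path x x) (y : X) :
    codiff m 1 (oneCochain w) ![TotalHlg.loop γ, TotalHlg.point y] =
      w (loopClass γ) + w (loopClass ((γ.prod (Path.refl y)).map m.continuous)) := by
  rw [codiff_one_apply, augmentation_point, augmentation_loop, pontryagin_loop_point,
    oneCochain_loop, oneCochain_loop, zero_mul, mul_one, zero_add, add_comm]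

/-- A cochain `(r, s) ↦ w((r × s)₁)` is closed if `w` is associative on loops. -/
lemma codiff_twoCochain_eq_zero {m : C(X × X, X)} {w : Hlg (X × X) 1 →ₗ[ZMod 2] ZMod 2}
    (h : ∀ (p : X × X × X) (γ : Path p p),
      w (loopClass (γ.map (mulId m).continuous)) + w (loopClass (γ.map pr12.continuous)) =
      w (loopClass (γ.map (idMul m).continuous)) + w (loopClass (γ.map pr23.continuous))) :
    codiff m 2 (twoCochain w) = 0 := by
  refine cochain_three_eq_zero (codiff_two_mem (twoCochain_mem w)) (fun x y z γ ↦ ?_)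
    (fun x y γ z ↦ ?_) fun x γ y z ↦ ?_
  -- With the loop in the last slot its image under `π₁₂` is constant. The matching term of the
  -- codifferential is zero because the augmentation of a loop is.
  · have h1 := h _ ((Path.refl x).prod ((Path.refl y).prod γ))
    rw [functional_const w (γ := Path.map _ pr12.continuous) (fun t ↦ rfl)] at h1
    rw [codiff_two_apply, augmentation_point, augmentation_loop, pontryagin_point_point,
      pontryagin_point_loop, twoCochain_point_loop, twoCochain_point_loop, twoCochain_point_loop,
      one_mul, mul_zero, add_zero]
    have e1 : w (loopClass ((Path.refl (m (x, y))).prod γ)) =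
        w (loopClass ((Path.refl x).prod (((Path.refl y).prod γ).map m.continuous))) +
          w (loopClass ((Path.refl y).prod γ)) := (add_zero _).symm.trans h1
    rw [e1]
    grind
  -- With the loop in the middle all four terms survive, and they are the four terms of the
  -- hypothesis.
  · have h1 := h _ ((Path.refl x).prod (γ.prod (Path.refl z)))
    rw [codiff_two_apply, augmentation_point, augmentation_point, pontryagin_point_loop,
      pontryagin_loop_point, twoCochain_point_loop, twoCochain_point_loop, twoCochain_loop_point,
      twoCochain_loop_point, one_mul, mul_one]
    have e1 : w (loopClass ((((Path.refl x).prod γ).map m.continuous).prod (Path.refl z))) +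
          w (loopClass ((Path.refl x).prod γ)) =
        w (loopClass ((Path.refl x).prod ((γ.prod (Path.refl z)).map m.continuous))) +
          w (loopClass (γ.prod (Path.refl z))) := h1
    grind
  · have h1 := h _ (γ.prod ((Path.refl y).prod (Path.refl z)))
    rw [functional_const w (γ := Path.map _ pr23.continuous) (fun t ↦ rfl)] at h1
    rw [codiff_two_apply, augmentation_point, augmentation_loop, pontryagin_point_point,
      pontryagin_loop_point, twoCochain_loop_point, twoCochain_loop_point, twoCochain_loop_point,
      zero_mul, mul_one, zero_add]
    have e1 : w (loopClass (((γ.prod (Path.refl y)).map m.continuous).prod (Path.refl z))) +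
          w (loopClass (γ.prod (Path.refl y))) =
        w (loopClass (γ.prod (Path.refl (m (y, z))))) := h1.trans (add_zero _)
    grind

lemma HP.mk_eq_zero_iff {m : C(X × X, X)} {i j : ℕ} {f : cocycles m i j} :
    HP.mk m f = 0 ↔ f.1 ∈ coboundaries m i j :=
  (QuotientAddGroup.eq_zero_iff f).trans AddSubgroup.mem_addSubgroupOf

lemma HP.mk_eq_iff {m : C(X × X, X)} {i j : ℕ} {f g : cocycles m i j} :
    HP.mk m f = HP.mk m g ↔ f.1 - g.1 ∈ coboundaries m i j := by
  rw [← sub_eq_zero]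
  exact HP.mk_eq_zero_iff (f := f - g)

/-- A `0`-cochain of internal degree `1` is zero, since the empty sum of degrees is `0`. So in
`HP^{1,1}` no cocycles are identified. -/
lemma coboundaries_one_eq_zero {m : C(X × X, X)} {f : Cochain X 1}
    (hf : f ∈ coboundaries m 1 1) : f = 0 := by
  obtain ⟨g, hg, rfl⟩ := hf
  have : g = 0 := by
    ext v
    refine (congrArg g (Subsingleton.elim _ _)).trans
      (hg (fun k ↦ k.elim0) (fun k ↦ k.elim0) (by simp))
  rw [this, map_zero]

lemma coboundaries_two_iff {m : C(X × X, X)} {f : Cochain X 2} :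
    f ∈ coboundaries m 2 1 ↔ ∃ w, codiff m 1 (oneCochain w) = f := by
  constructor
  · rintro ⟨g, hg, rfl⟩
    obtain ⟨w, rfl⟩ := exists_oneCochain hg
    exact ⟨w, rfl⟩
  · rintro ⟨w, rfl⟩
    exact ⟨_, oneCochain_mem w, rfl⟩

end LowDegreeCochains

/-! ### Torsors from difference functions. -/

section Torsor

/-- A transitive difference function with bijective partial evaluations defines a torsor. -/
lemma exists_addTorsor {G S : Type*} [AddGroup G] [Nonempty S] (D : S → S → G)
    (trans : ∀ a b c, D a c = D a b + D b c) (inj : ∀ a b, D a b = 0 → a = b)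
    (surj : ∀ g c, ∃ a, D a c = g) : ∃ _ : AddTorsor G S, ∀ a b : S, a -ᵥ b = D a b := by
  have self : ∀ a, D a a = 0 := fun a ↦ left_eq_add.1 (trans a a a)
  have inj' : ∀ a b c, D a c = D b c → a = b := fun a b c h ↦
    inj a b (right_eq_add.1 (h.symm.trans (trans a b c)))
  -- Translation by `g` picks the element whose difference from `c` is `g`, unique by `inj'`; the
  -- torsor axioms then follow by comparing differences.
  choose A hA using surj
  let T : AddTorsor G S :=
    { vadd := A
      zero_vadd := fun c ↦ inj' _ _ c ((hA 0 c).trans (self c).symm)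
      add_vadd := fun g h c ↦ inj' _ _ c ((hA (g + h) c).trans
        ((trans _ (A h c) c).trans (congrArg₂ (· + ·) (hA g _) (hA h c))).symm)
      vsub := D
      vsub_vadd' := fun a b ↦ inj' _ _ b (hA _ b)
      vadd_vsub' := fun g c ↦ hA g c }
  exact ⟨T, fun a b ↦ rfl⟩

end Torsor

/-! ### The obstruction class and the torsor of compatible square roots. -/

section Main

open scoped unitInterval

variable {X : Type u} [TopologicalSpace X] {m : C(X × X, X)} {L : LineBundle.{u, v} (X × X)}

lemma representsOne_iff {w : Hlg X 1 →ₗ[ZMod 2] ZMod 2} {o : HP m 1 1} :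
    RepresentsOne m w o ↔
      ∃ h : oneCochain w ∈ cocycles m 1 1, HP.mk m ⟨oneCochain w, h⟩ = o := by
  constructor
  · rintro ⟨⟨f, hf⟩, hw, ho⟩
    obtain rfl : f = oneCochain w := by
      refine MultilinearMap.ext fun v ↦ ?_
      have hv : v = ![v 0] := by
        ext1 k
        fin_cases k
        rfl
      rw [hv]
      exact hw _
    exact ⟨hf, ho⟩
  · rintro ⟨h, ho⟩
    exact ⟨⟨_, h⟩, fun r ↦ rfl, ho⟩

lemma RepresentsOne.unique {w : Hlg X 1 →ₗ[ZMod 2] ZMod 2} {o o' : HP m 1 1}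
    (h : RepresentsOne m w o) (h' : RepresentsOne m w o') : o = o' := by
  obtain ⟨-, rfl⟩ := representsOne_iff.1 h
  obtain ⟨-, rfl⟩ := representsOne_iff.1 h'
  rfl

lemma RepresentsOne.add {w w' : Hlg X 1 →ₗ[ZMod 2] ZMod 2} {o o' : HP m 1 1}
    (h : RepresentsOne m w o) (h' : RepresentsOne m w' o') :
    RepresentsOne m (w + w') (o + o') := by
  obtain ⟨hf, rfl⟩ := representsOne_iff.1 h
  obtain ⟨hf', rfl⟩ := representsOne_iff.1 h'
  have hc : oneCochain (w + w') ∈ cocycles m 1 1 := by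
    rw [oneCochain_add]
    exact (cocycles m 1 1).add_mem hf hf'
  have he : (⟨oneCochain (w + w'), hc⟩ : cocycles m 1 1) = ⟨_, hf⟩ + ⟨_, hf'⟩ :=
    Subtype.ext (oneCochain_add w w')
  exact representsOne_iff.2 ⟨hc, (congrArg (HP.mk m) he).trans (QuotientAddGroup.mk_add _ _ _)⟩

/-- There are no nonzero coboundaries here, so the class determines the functional. -/
lemma RepresentsOne.eq_zero {w : Hlg X 1 →ₗ[ZMod 2] ZMod 2}
    (h : RepresentsOne m w 0) : w = 0 := by
  obtain ⟨h, h'⟩ := representsOne_iff.1 h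
  have h0 : oneCochain w = 0 := coboundaries_one_eq_zero (HP.mk_eq_zero_iff.1 h')
  refine functional_ext fun x γ ↦ ?_
  rw [← oneCochain_loop, h0]
  rfl

lemma exists_representsOne (o : HP m 1 1) :
    ∃ w : Hlg X 1 →ₗ[ZMod 2] ZMod 2, RepresentsOne m w o := by
  obtain ⟨⟨f, hf⟩, rfl⟩ := QuotientAddGroup.mk_surjective o
  obtain ⟨w, rfl⟩ := exists_oneCochain hf.2
  exact ⟨w, representsOne_iff.2 ⟨hf, rfl⟩⟩

variable {φ : PhiIso m L}

/-- On a loop in a slice one projection is constant and the other is the loop, so the three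
difference terms of `rootClass_change` become the terms of the codifferential that do not vanish. -/
lemma twoCochain_change {r r' : RootPair (diagBundle L)}
    {w : Hlg (X × X) 1 →ₗ[ZMod 2] ZMod 2} (hw : IsFirstStiefelWhitney (RootCover.proj φ r) w)
    {w' : Hlg (X × X) 1 →ₗ[ZMod 2] ZMod 2} (hw' : IsFirstStiefelWhitney (RootCover.proj φ r') w')
    {d : Hlg X 1 →ₗ[ZMod 2] ZMod 2} (hd : IsFirstStiefelWhitney (DifferenceCover.proj r r') d) :
    twoCochain w' = twoCochain w + codiff m 1 (oneCochain d) := by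
  refine sub_eq_zero.1 (cochain_two_eq_zero (sub_mem (twoCochain_mem w')
    (add_mem (twoCochain_mem w) (codiff_one_mem (oneCochain_mem d)))) (fun x y γ ↦ ?_)
    fun x γ y ↦ ?_)
  · have h := rootClass_change hw hw' hd ((Path.refl x).prod γ)
    have h1 : d (loopClass (((Path.refl x).prod γ).map pr1.continuous)) = 0 :=
      functional_const d fun t ↦ rfl
    have h2 : loopClass (((Path.refl x).prod γ).map pr2.continuous) = loopClass γ :=
      loopClass_congr fun t ↦ rfl
    rw [h1, h2] at h
    rw [sub_apply, add_apply, twoCochain_point_loop, twoCochain_point_loop,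
      codiff_oneCochain_point_loop, h]
    ring
  · have h := rootClass_change hw hw' hd (γ.prod (Path.refl y))
    have h1 : d (loopClass ((γ.prod (Path.refl y)).map pr2.continuous)) = 0 :=
      functional_const d fun t ↦ rfl
    have h2 : loopClass ((γ.prod (Path.refl y)).map pr1.continuous) = loopClass γ :=
      loopClass_congr fun t ↦ rfl
    rw [h1, h2] at h
    rw [sub_apply, add_apply, twoCochain_loop_point, twoCochain_loop_point,
      codiff_oneCochain_loop_point, h]
    ring

/-- The cochain records `w` on loops in the slices, and these determine `w`. -/
lemma eq_zero_of_twoCochain_eq_zero {w : Hlg (X × X) 1 →ₗ[ZMod 2] ZMod 2}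
    (h : twoCochain w = 0) : w = 0 :=
  functional_prod_ext
    (fun x y γ ↦ (twoCochain_point_loop w x γ).symm.trans (by rw [h]; rfl))
    fun x γ y ↦ (twoCochain_loop_point w γ y).symm.trans (by rw [h]; rfl)

lemma twoCochain_zero : twoCochain (0 : Hlg (X × X) 1 →ₗ[ZMod 2] ZMod 2) = 0 := rfl

/-- If the obstruction cocycle is the coboundary of `δ`, then twisting by `δ` gives a compatible
square root. -/
lemma exists_isCompatible_twist {Y : Type u} [TopologicalSpace Y]
    (hY : LocallyContractibleSpace Y) (e : ContinuousMap.HomotopyEquiv X Y)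
    {r : RootPair (diagBundle L)} {w : Hlg (X × X) 1 →ₗ[ZMod 2] ZMod 2}
    (hw : IsFirstStiefelWhitney (RootCover.proj φ r) w) {d : Hlg X 1 →ₗ[ZMod 2] ZMod 2}
    (hd : codiff m 1 (oneCochain d) = twoCochain w) :
    ∃ r' : RootPair (diagBundle L), IsFirstStiefelWhitney (DifferenceCover.proj r' r) d ∧
      IsCompatible φ r' := by
  obtain ⟨r', hr'⟩ := r.exists_differenceClass_eq hY e d
  refine ⟨r', hr', ?_⟩
  obtain ⟨d', hd'⟩ := exists_differenceClass r r'
  obtain rfl : d' = d := differenceClass_comm hr' hd'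
  obtain ⟨w', hw'⟩ := exists_rootClass φ r'
  -- The twist adds the coboundary of `d`, which is the old cocycle itself, and twice anything is
  -- zero.
  have h0 : w' = 0 := eq_zero_of_twoCochain_eq_zero (by
    rw [twoCochain_change hw hw' hd', hd]
    exact ZModModule.add_self _)
  have := locallyPathConnectedSpace_of_locallyContractibleSpace hY
  -- `X × X` is homotopy equivalent to the locally path-connected space `Y × Y`, so vanishing of the
  -- class gives a section.
  have hs := (isRootCondition_squaresTo φ r').isDoubleCover.exists_section hw' h0 (e.prodCongr e)
  obtain ⟨s, hs⟩ := hs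
  exact isCompatible_of_section s hs

/-- Both obstruction cocycles vanish, hence so does the coboundary by which they differ. -/
lemma codiff_oneCochain_eq_zero {r r' : RootPair (diagBundle L)} (h : IsCompatible φ r)
    (h' : IsCompatible φ r') {d : Hlg X 1 →ₗ[ZMod 2] ZMod 2}
    (hd : IsFirstStiefelWhitney (DifferenceCover.proj r r') d) :
    codiff m 1 (oneCochain d) = 0 := by
  obtain ⟨w, hw⟩ := exists_rootClass φ r
  obtain ⟨w', hw'⟩ := exists_rootClass φ r'
  have h1 := twoCochain_change hw hw' hd
  rw [rootClass_eq_zero_of_isCompatible hw h, rootClass_eq_zero_of_isCompatible hw' h',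
    twoCochain_zero, zero_add] at h1
  exact h1.symm

/-- The obstruction class. -/
lemma exists_obstruction {Y : Type u} [TopologicalSpace Y]
    (hY : LocallyContractibleSpace Y) (e : ContinuousMap.HomotopyEquiv X Y)
    {χ : ChiIso m L} {ψ : PsiIso m L} (hassoc : IsAssociative φ χ ψ)
    (hK : Nonempty (RootPair (diagBundle L))) :
    ∃ o : HP m 2 1,
      (∀ r : RootPair (diagBundle L), ∃ w : Hlg (X × X) 1 →ₗ[ZMod 2] ZMod 2,
        (∀ w', IsFirstStiefelWhitney (RootCover.proj φ r) w' ↔ w' = w) ∧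
          RepresentsTwo m w o) ∧
      (Nonempty (CompatibleRoot φ) ↔ o = 0) := by
  obtain ⟨r₀⟩ := hK
  have hcoc : ∀ {r : RootPair (diagBundle L)} {w : Hlg (X × X) 1 →ₗ[ZMod 2] ZMod 2},
      IsFirstStiefelWhitney (RootCover.proj φ r) w → twoCochain w ∈ cocycles m 2 1 := fun hw ↦
    ⟨codiff_twoCochain_eq_zero fun p γ ↦ rootClass_assoc hassoc hw γ, twoCochain_mem _⟩
  obtain ⟨w₀, hw₀⟩ := exists_rootClass φ r₀
  -- The class does not depend on the pair: two cocycles differ by the coboundary of the difference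
  -- class.
  have hrep : ∀ {r : RootPair (diagBundle L)} {w : Hlg (X × X) 1 →ₗ[ZMod 2] ZMod 2}
      (hw : IsFirstStiefelWhitney (RootCover.proj φ r) w),
      HP.mk m ⟨twoCochain w, hcoc hw⟩ = HP.mk m ⟨twoCochain w₀, hcoc hw₀⟩ := by
    intro r w hw
    obtain ⟨d, hd⟩ := exists_differenceClass r₀ r
    exact HP.mk_eq_iff.2 (coboundaries_two_iff.2 ⟨d,
      eq_sub_of_add_eq' (twoCochain_change hw₀ hw hd).symm⟩)
  refine ⟨HP.mk m ⟨twoCochain w₀, hcoc hw₀⟩, fun r ↦ ?_, ?_, fun h ↦ ?_⟩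
  · obtain ⟨w, hw⟩ := exists_rootClass φ r
    exact ⟨w, isFirstStiefelWhitney_iff hw, ⟨_, hcoc hw⟩, fun r s ↦ rfl, hrep hw⟩
  · rintro ⟨s, r, -, hr⟩
    obtain ⟨w, hw⟩ := exists_rootClass φ r
    rw [← hrep hw, HP.mk_eq_zero_iff]
    exact coboundaries_two_iff.2 ⟨0, (map_zero (codiff m 1)).trans
      (congrArg twoCochain (rootClass_eq_zero_of_isCompatible hw hr)).symm⟩
  · obtain ⟨d, hd⟩ := coboundaries_two_iff.1 (HP.mk_eq_zero_iff.1 h)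
    obtain ⟨r', -, hr'⟩ := exists_isCompatible_twist hY e hw₀ hd
    exact ⟨CompatibleRoot.mk r' hr'⟩

lemma CompatibleRoot.exists_mk (s : CompatibleRoot φ) :
    ∃ (r : RootPair (diagBundle L)) (hr : IsCompatible φ r), CompatibleRoot.mk r hr = s := by
  obtain ⟨s, r, hr, h⟩ := s
  exact ⟨r, h, Subtype.ext hr⟩

/-- The difference of two compatible square roots. -/
lemma exists_difference (s₁ s₂ : CompatibleRoot φ) : ∃ o : HP m 1 1,
    ∀ (r₁ r₂ : RootPair (diagBundle L)) (h₁ : IsCompatible φ r₁) (h₂ : IsCompatible φ r₂),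
      CompatibleRoot.mk r₁ h₁ = s₁ → CompatibleRoot.mk r₂ h₂ = s₂ →
      ∀ w, IsFirstStiefelWhitney (DifferenceCover.proj r₁ r₂) w → RepresentsOne m w o := by
  obtain ⟨r₁, h₁, rfl⟩ := s₁.exists_mk
  obtain ⟨r₂, h₂, rfl⟩ := s₂.exists_mk
  obtain ⟨w, hw⟩ := exists_differenceClass r₁ r₂
  refine ⟨HP.mk m ⟨oneCochain w, codiff_oneCochain_eq_zero h₁ h₂ hw, oneCochain_mem w⟩,
    fun r₁' r₂' h₁' h₂' e₁ e₂ w' hw' ↦ ?_⟩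
  obtain ⟨a, ha⟩ := exists_differenceClass r₁' r₁
  obtain ⟨b, hb⟩ := exists_differenceClass r₁' r₂
  obtain ⟨c, hc⟩ := exists_differenceClass r₂ r₂'
  -- Independence of representatives: by additivity `w'` is `w` plus the classes `a` and `c` of
  -- isomorphic pairs, which vanish.
  obtain rfl : w' = w := by
    rw [differenceClass_trans hb hc hw', differenceClass_trans ha hw hb,
      differenceClass_eq_zero_of_iso ha (congrArg Subtype.val e₁),
      differenceClass_eq_zero_of_iso hc (congrArg Subtype.val e₂).symm, zero_add, add_zero]
  exact representsOne_iff.2 ⟨_, rfl⟩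

/-- Differences add up; a zero difference gives a section of the difference cover, hence an
isomorphism; and every closed class occurs, by twisting. -/
lemma exists_torsor {Y : Type u} [TopologicalSpace Y]
    (hY : LocallyContractibleSpace Y) (e : ContinuousMap.HomotopyEquiv X Y)
    (hne : Nonempty (CompatibleRoot φ)) :
    ∃ _ : AddTorsor (HP m 1 1) (CompatibleRoot φ),
      ∀ (r₁ r₂ : RootPair (diagBundle L)) (h₁ : IsCompatible φ r₁) (h₂ : IsCompatible φ r₂),
        ∃ w : Hlg X 1 →ₗ[ZMod 2] ZMod 2,
          (∀ w', IsFirstStiefelWhitney (DifferenceCover.proj r₁ r₂) w' ↔ w' = w) ∧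
            RepresentsOne m w (CompatibleRoot.mk r₁ h₁ -ᵥ CompatibleRoot.mk r₂ h₂) := by
  choose D hD using exists_difference (φ := φ)
  have trans : ∀ a b c, D a c = D a b + D b c := by
    intro a b c
    obtain ⟨ra, ha, rfl⟩ := a.exists_mk
    obtain ⟨rb, hb, rfl⟩ := b.exists_mk
    obtain ⟨rc, hc, rfl⟩ := c.exists_mk
    obtain ⟨w₁, hw₁⟩ := exists_differenceClass ra rb
    obtain ⟨w₂, hw₂⟩ := exists_differenceClass rb rc
    obtain ⟨w₃, hw₃⟩ := exists_differenceClass ra rc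
    have h := hD _ _ ra rc ha hc rfl rfl w₃ hw₃
    rw [differenceClass_trans hw₁ hw₂ hw₃] at h
    exact h.unique ((hD _ _ ra rb ha hb rfl rfl w₁ hw₁).add (hD _ _ rb rc hb hc rfl rfl w₂ hw₂))
  have inj : ∀ a b, D a b = 0 → a = b := by
    intro a b h
    obtain ⟨ra, ha, rfl⟩ := a.exists_mk
    obtain ⟨rb, hb, rfl⟩ := b.exists_mk
    obtain ⟨w, hw⟩ := exists_differenceClass ra rb
    have h1 := hD _ _ ra rb ha hb rfl rfl w hw
    rw [h] at h1
    have := locallyPathConnectedSpace_of_locallyContractibleSpace hY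
    have hs := (isRootCondition_isometry ra rb).isDoubleCover.exists_section hw h1.eq_zero e
    obtain ⟨s, hs⟩ := hs
    exact Subtype.ext (toRoot_eq_of_section s hs)
  have surj : ∀ g c, ∃ a, D a c = g := by
    intro g c
    obtain ⟨r, hr, rfl⟩ := c.exists_mk
    obtain ⟨d, hd⟩ := exists_representsOne g
    obtain ⟨hd', -⟩ := representsOne_iff.1 hd
    obtain ⟨w, hw⟩ := exists_rootClass φ r
    have hw0 := rootClass_eq_zero_of_isCompatible hw hr
    -- The obstruction cocycle of `r` is zero, so the condition for the twist to be compatible is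
    -- that `d` be closed.
    obtain ⟨r', hr', hc⟩ := exists_isCompatible_twist hY e hw (d := d) (by
      rw [hw0, twoCochain_zero]
      exact hd'.1)
    exact ⟨CompatibleRoot.mk r' hc, (hD _ _ r' r hc hr rfl rfl d hr').unique hd⟩
  obtain ⟨T, hT⟩ := exists_addTorsor D trans inj surj
  refine ⟨T, fun r₁ r₂ h₁ h₂ ↦ ?_⟩
  obtain ⟨w, hw⟩ := exists_differenceClass r₁ r₂
  refine ⟨w, isFirstStiefelWhitney_iff hw, ?_⟩
  rw [hT]
  exact hD _ _ r₁ r₂ h₁ h₂ rfl rfl w hw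

end Main

end HPSqrt

end

open HPSqrt
theorem proposition5p7 {X : Type u} [TopologicalSpace X]
    (hX : ∃ (Y : Type u) (_ : TopologicalSpace Y),
      LocallyContractibleSpace Y ∧ Nonempty (ContinuousMap.HomotopyEquiv X Y))
    (H : HSpaceStructure X) (L : LineBundle.{u, v} (X × X))
    (φ : PhiIso H.m L) (χ : ChiIso H.m L) (ψ : PsiIso H.m L) (hassoc : IsAssociative φ χ ψ)
    (hK : Nonempty (RootPair (diagBundle L))) :
    (∃ o : HP H.m 2 1,
      (∀ r : RootPair (diagBundle L), ∃ w : Hlg (X × X) 1 →ₗ[ZMod 2] ZMod 2,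
        (∀ w', IsFirstStiefelWhitney (RootCover.proj φ r) w' ↔ w' = w) ∧
          RepresentsTwo H.m w o) ∧
      (Nonempty (CompatibleRoot φ) ↔ o = 0)) ∧
    (Nonempty (CompatibleRoot φ) →
      ∃ _ : AddTorsor (HP H.m 1 1) (CompatibleRoot φ),
        ∀ (r₁ r₂ : RootPair (diagBundle L)) (h₁ : IsCompatible φ r₁) (h₂ : IsCompatible φ r₂),
          ∃ w : Hlg X 1 →ₗ[ZMod 2] ZMod 2,
            (∀ w', IsFirstStiefelWhitney (DifferenceCover.proj r₁ r₂) w' ↔ w' = w) ∧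
              RepresentsOne H.m w (CompatibleRoot.mk r₁ h₁ -ᵥ CompatibleRoot.mk r₂ h₂)) := by
  obtain ⟨Y, _, hY, ⟨e⟩⟩ := hX
  exact ⟨exists_obstruction hY e hassoc hK, exists_torsor hY e⟩
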